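/- Let $\mathbb T=\mathbb R/\mathbb Z$ and let $T=(T_1,\dots,T_l)$ be a finite collection of differential operators $T_j=\sum_\alpha c_{j,\alpha}\,\partial_1^{\alpha_1}\partial_2^{\alpha_2}$ with constant complex coefficients on $\mathbb T^2$. Let $C^T(\mathbb T^2)$ be the Banach space obtained from the trigonometric polynomials in two variables with the seminorm $\|f\|_T=\max_j\|T_jf\|_{C(\mathbb T^2)}$ by factoring out the null space and completing. Let $\mathcal M\subset\mathbb R^2$ be the set of all multiindices $\alpha$ of monomials occurring (with nonzero coefficient) in at least one $T_j$. A line $\Lambda=\{x/a+y/b=1\}$, $a,b>0$, is *admissible* if it contains at least two points of $\mathcal M$ and no point of $\mathcal M$ lies above it. The *$\Lambda$-senior part* of an operator consists of its monomials (with their coefficients) whose multiindices lie on $\Lambda$. Suppose at least one line is admissible. The *core* $\mathcal K$ is the union of the segments $\operatorname{conv}(\mathcal M\cap\Lambda)$ over all admissible lines $\Lambda$; it is a concave broken line. The *principal part* of an operator consists of its monomials whose multiindices lie on $\mathcal K$. A differential operator $r$ is *subordinate* if each multiindex $\alpha$ of its monomials satisfies $\alpha\notin\mathcal K$ and $\alpha\le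 q$ coordinatewise for some $q\in\mathcal K$ (that is, $\alpha$ lies in the domain bounded by the coordinate axes, the core, and the vertical and horizontal segments joining the endpoints of the core to the axes, but not on the core). It is *strictly subordinate* if moreover no such $\alpha$ lies on these vertical and horizontal segments, i.e. $\alpha_1<\max_{q\in\mathcal K}q_1$ and $\alpha_2<\max_{q\in\mathcal K}q_2$. The characteristic polynomial of $S=\sum_\alpha c_\alpha\partial_1^{\alpha_1}\partial_2^{\alpha_2}$ is $P_S(x,y)=\sum_\alpha c_\alpha(2\pi i x)^{\alpha_1}(2\pi i y)^{\alpha_2}$. A function $f$ on $\mathbb T^2$ is *proper* if $\hat f(m,n)=0$ whenever $m=0$ or $n=0$. **Theorem.** Assume that * for no admissible line $\Lambda$ are there two linearly independent operators among the $\Lambda$-senior parts of $T_1,\dots,T_l$; * at least one admissible line exists; * $T'=(T_1',\dots,T_l')$ is a normalization of $T$: it has the same linear span as $T$, and only $T_1'$ has a nonzero principal part; let $R$ be the principal part of $T_1'$; * (ellipticity) for every admissible line $\Lambda$, the characteristic polynomial of the $\Lambda$-senior part of $T'_1$ has no zeros $(x,y)\in\mathbb R^2$ with $x\ne0$ and $y\neq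 0$. Then: 1. $C^T(\mathbb T^2)$ is isomorphic, as a Banach space, to $C(\mathbb T^2)$. 2. For every subordinate operator $r$ and every $\varepsilon>0$ there is $M\in\mathbb N$ such that $\|rf\|_{C(\mathbb T^2)}\le\varepsilon\|Rf\|_{C(\mathbb T^2)}$ for all proper $f\in C(\mathbb T^2)$ with $\hat f(m,n)=0$ whenever $|m|\le M$ or $|n|\le M$. 3. For every strictly subordinate operator $r$ and every $\varepsilon>0$ there is $M\in\mathbb N$ such that $\|rf\|_{C(\mathbb T^2)}\le\varepsilon\|Rf\|_{C(\mathbb T^2)}$ for all proper $f\in C(\mathbb T^2)$ with $\hat f(m,n)=0$ whenever $|m|\le M$ and $|n|\le M$. In 2 and 3, $Rf$ and $rf$ are understood in the sense of distributions, and the claim is that whenever $Rf$ is a continuous function, so is $rf$, and the inequality holds. -/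

import Mathlib

noncomputable section

namespace SmoothTorus

/-- The torus `𝕋²`, with `𝕋 = ℝ/ℤ`, i.e. the unit circle parametrised by `t ↦ exp (2πit)`. -/
abbrev Torus : Type := UnitAddTorus (Fin 2)

/-! ### Trigonometric polynomials and partial derivatives -/

/-- The space of trigonometric polynomials on `𝕋²`, as a subspace of `C(𝕋²)`. -/
def trigPoly : Submodule ℂ C(Torus, ℂ) :=
  Submodule.span ℂ (Set.range (UnitAddTorus.mFourier (d := Fin 2)))

/-- The partial derivative of a function on the torus in the `j`-th (angular) variable. -/
def partialDeriv (j : Fin 2) (f : Torus → ℂ) (x : Torus) : ℂ :=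
  deriv (fun t : ℝ => f (x + Pi.single j (t : UnitAddCircle))) 0

theorem hasDerivAt_mFourier (j : Fin 2) (n : Fin 2 → ℤ) (x : Torus) :
    HasDerivAt (fun t : ℝ => UnitAddTorus.mFourier n (x + Pi.single j (t : UnitAddCircle)))
      (2 * Real.pi * Complex.I * (n j) * UnitAddTorus.mFourier n x) 0 := by
  have h1 : ∀ t : ℝ, UnitAddTorus.mFourier n (x + Pi.single j (t : UnitAddCircle))
      = UnitAddTorus.mFourier n x * fourier (n j) (t : UnitAddCircle) := by
    intro t
    have h2 : UnitAddTorus.mFourier n (x + Pi.single j (t : UnitAddCircle))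
        = UnitAddTorus.mFourier n x
          * UnitAddTorus.mFourier n (Pi.single j (t : UnitAddCircle)) := by
      simp only [UnitAddTorus.mFourier, ContinuousMap.coe_mk, Pi.add_apply,
        ← Finset.prod_mul_distrib]
      refine Finset.prod_congr rfl fun i _ => ?_
      simp [fourier_apply, smul_add, AddCircle.toCircle_add]
    rw [h2]
    congr 1
    simp only [UnitAddTorus.mFourier, ContinuousMap.coe_mk]
    rw [Finset.prod_eq_single j]
    · simp
    · intro b _ hb
      simp [Pi.single_eq_of_ne hb]
    · simp
  simp only [h1]
  have h3 := (hasDerivAt_fourier (1 : ℝ) (n j) 0).const_mul (UnitAddTorus.mFourier n x)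
  have h4 : (2 * Real.pi * Complex.I * (n j) * UnitAddTorus.mFourier n x : ℂ)
      = UnitAddTorus.mFourier n x * (2 * Real.pi * Complex.I * (n j) / (1 : ℝ)
        * fourier (n j) ((0 : ℝ) : UnitAddCircle)) := by
    rw [QuotientAddGroup.mk_zero, fourier_eval_zero]
    push_cast
    ring
  rw [h4]
  exact h3

theorem exists_hasDerivAt {f : C(Torus, ℂ)} (hf : f ∈ trigPoly) (j : Fin 2) :
    ∃ g ∈ trigPoly, ∀ x : Torus,
      HasDerivAt (fun t : ℝ => f (x + Pi.single j (t : UnitAddCircle))) (g x) 0 := by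
  induction hf using Submodule.span_induction with
  | mem f hf =>
    obtain ⟨n, rfl⟩ := hf
    exact ⟨(2 * Real.pi * Complex.I * (n j)) • UnitAddTorus.mFourier n,
      Submodule.smul_mem _ _ (Submodule.subset_span ⟨n, rfl⟩),
      fun x => by simpa using hasDerivAt_mFourier j n x⟩
  | zero => exact ⟨0, Submodule.zero_mem _, fun x => by simpa using hasDerivAt_const (0 : ℝ) (0 : ℂ)⟩
  | add f₁ f₂ _ _ h₁ h₂ =>
    obtain ⟨g₁, m₁, d₁⟩ := h₁
    obtain ⟨g₂, m₂, d₂⟩ := h₂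
    exact ⟨g₁ + g₂, Submodule.add_mem _ m₁ m₂, fun x => (d₁ x).add (d₂ x)⟩
  | smul c f _ h =>
    obtain ⟨g, m, d⟩ := h
    exact ⟨c • g, Submodule.smul_mem _ c m, fun x => (d x).const_smul c⟩

theorem exists_partialDeriv (f : trigPoly) (j : Fin 2) :
    ∃ g : trigPoly, ∀ x : Torus, (g : C(Torus, ℂ)) x = partialDeriv j (f : C(Torus, ℂ)) x := by
  obtain ⟨g, hg, h⟩ := exists_hasDerivAt f.2 j
  exact ⟨⟨g, hg⟩, fun x => (h x).deriv.symm⟩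

theorem differentiableAt_trigPoly (f : trigPoly) (j : Fin 2) (x : Torus) :
    DifferentiableAt ℝ
      (fun t : ℝ => (f : C(Torus, ℂ)) (x + Pi.single j (t : UnitAddCircle))) 0 := by
  obtain ⟨g, _, h⟩ := exists_hasDerivAt f.2 j
  exact (h x).differentiableAt

/-- The operator `∂ⱼ` on trigonometric polynomials: `∂ⱼ f` is the trigonometric polynomial whose
value at each point is `partialDeriv j f`. -/
def pderiv (j : Fin 2) : Module.End ℂ trigPoly where
  toFun f := (exists_partialDeriv f j).choose
  map_add' f g := by
    ext x
    simp only [Submodule.coe_add, ContinuousMap.add_apply,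
      (exists_partialDeriv (f + g) j).choose_spec, (exists_partialDeriv f j).choose_spec,
      (exists_partialDeriv g j).choose_spec]
    exact deriv_fun_add (differentiableAt_trigPoly f j x) (differentiableAt_trigPoly g j x)
  map_smul' c f := by
    ext x
    simp only [Submodule.coe_smul, ContinuousMap.smul_apply, RingHom.id_apply,
      (exists_partialDeriv (c • f) j).choose_spec, (exists_partialDeriv f j).choose_spec]
    exact deriv_fun_const_smul c (differentiableAt_trigPoly f j x)

/-! ### Differential operators with constant coefficients -/

/-- A differential operator with constant complex coefficients on `𝕋²`. The polynomial
`∑ c_α X₀^α₀ X₁^α₁` stands for the operator `∑ c_α ∂₁^α₀ ∂₂^α₁`. -/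
abbrev DiffOp : Type := MvPolynomial (Fin 2) ℂ

/-- The action of a differential operator on trigonometric polynomials. -/
def DiffOp.act (S : DiffOp) : Module.End ℂ trigPoly :=
  ∑ α ∈ S.support, S.coeff α • (pderiv 0 ^ α 0 * pderiv 1 ^ α 1)

/-- The characteristic polynomial `P_S(x, y) = ∑ c_α (2πix)^α₀ (2πiy)^α₁` at real points. -/
def DiffOp.charPoly (S : DiffOp) (x y : ℝ) : ℂ :=
  MvPolynomial.eval ![2 * Real.pi * Complex.I * x, 2 * Real.pi * Complex.I * y] S

/-- For continuous `f` and `g`: `S f = g` in the sense of distributions on the torus, expressed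
through Fourier coefficients. -/
def DiffOp.Maps (S : DiffOp) (f g : C(Torus, ℂ)) : Prop :=
  ∀ n : Fin 2 → ℤ, UnitAddTorus.mFourierCoeff g n
    = S.charPoly (n 0) (n 1) * UnitAddTorus.mFourierCoeff f n

/-- The operator composed of those monomials of `S` (with their coefficients) whose multiindices
satisfy `p`. -/
def DiffOp.part (S : DiffOp) (p : (Fin 2 →₀ ℕ) → Prop) : DiffOp :=
  open Classical in ∑ α ∈ S.support with p α, MvPolynomial.monomial α (S.coeff α)

/-! ### The space of smooth functions generated by a collection of operators -/

section Space

variable {l : ℕ}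

/-- The map `f ↦ (T₁ f, …, T_l f)` from trigonometric polynomials to `C(𝕋²)^l`. -/
def actAll (T : Fin l → DiffOp) : trigPoly →ₗ[ℂ] (Fin l → C(Torus, ℂ)) :=
  LinearMap.pi fun j => trigPoly.subtype ∘ₗ (T j).act

/-- Trigonometric polynomials, endowed with the seminorm `‖f‖_T = max_j ‖T_j f‖_{C(𝕋²)}`. -/
def SeminormedTrigPoly (_T : Fin l → DiffOp) : Type := trigPoly

instance (T : Fin l → DiffOp) : AddCommGroup (SeminormedTrigPoly T) :=
  inferInstanceAs (AddCommGroup trigPoly)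

instance (T : Fin l → DiffOp) : Module ℂ (SeminormedTrigPoly T) :=
  inferInstanceAs (Module ℂ trigPoly)

instance (T : Fin l → DiffOp) : SeminormedAddCommGroup (SeminormedTrigPoly T) :=
  SeminormedAddCommGroup.induced (SeminormedTrigPoly T) (Fin l → C(Torus, ℂ))
    (show SeminormedTrigPoly T →ₗ[ℂ] (Fin l → C(Torus, ℂ)) from actAll T)

instance (T : Fin l → DiffOp) : NormedSpace ℂ (SeminormedTrigPoly T) :=
  NormedSpace.induced ℂ (SeminormedTrigPoly T) (Fin l → C(Torus, ℂ))
    (show SeminormedTrigPoly T →ₗ[ℂ] (Fin l → C(Torus, ℂ)) from actAll T)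

/-- The Banach space `C^T(𝕋²)`: the quotient of the trigonometric polynomials by the null space of
the seminorm `‖·‖_T`, completed. -/
abbrev SmoothSpace (T : Fin l → DiffOp) : Type :=
  UniformSpace.Completion (SeparationQuotient (SeminormedTrigPoly T))

end Space

/-! ### Admissible lines, the core of the broken line, principal parts -/

section Lines

variable {l : ℕ}

/-- A multiindex as a point of the plane. -/
def toPoint (α : Fin 2 →₀ ℕ) : ℝ × ℝ := (α 0, α 1)

/-- The points of the plane whose coordinates are multiindices of the differential monomials
involved in at least one of the operators `T_j`. -/
def points (T : Fin l → DiffOp) : Set (ℝ × ℝ) :=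
  {p | ∃ j, ∃ α ∈ (T j).support, toPoint α = p}

/-- The line `x / a + y / b = 1`. -/
def line (a b : ℝ) : Set (ℝ × ℝ) := {p | p.1 / a + p.2 / b = 1}

/-- The line `x / a + y / b = 1` is admissible for `T`: it meets both positive semiaxes, no point
of `points T` lies above it, and it passes through at least two points of `points T`. -/
def IsAdmissible (T : Fin l → DiffOp) (a b : ℝ) : Prop :=
  0 < a ∧ 0 < b ∧ (∀ p ∈ points T, p.1 / a + p.2 / b ≤ 1) ∧ (points T ∩ line a b).Nontrivial

/-- The senior part of `S` with respect to the line `x / a + y / b = 1`. -/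
def seniorPart (a b : ℝ) (S : DiffOp) : DiffOp := S.part fun α => toPoint α ∈ line a b

/-- The core of the broken line determined by `T`: the union of the links `[Z_t, Z_{t+1}]`, each of
which is the segment spanned by the points of `points T` on an admissible line. -/
def core (T : Fin l → DiffOp) : Set (ℝ × ℝ) :=
  {p | ∃ a b : ℝ, IsAdmissible T a b ∧ p ∈ convexHull ℝ (points T ∩ line a b)}

/-- The principal part of `S`: the monomials corresponding to points of the core. -/
def principalPart (T : Fin l → DiffOp) (S : DiffOp) : DiffOp :=
  S.part fun α => toPoint α ∈ core T

/-- The ellipticity condition: the characteristic polynomials of the senior parts of `S` with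
respect to all admissible lines do not vanish on `ℝ²` outside the coordinate axes. -/
def IsElliptic (T : Fin l → DiffOp) (S : DiffOp) : Prop :=
  ∀ a b : ℝ, IsAdmissible T a b →
    ∀ x y : ℝ, x ≠ 0 → y ≠ 0 → (seniorPart a b S).charPoly x y ≠ 0

/-- `r` is subordinate to the principal part: each of its monomials corresponds to a point that
does not lie on the core but lies in the domain bounded by the coordinate semiaxes, the core, and
the vertical and horizontal segments that join the endpoints of the core to the axes. As all
coordinates are nonnegative, and the core is the graph of a decreasing concave function, this domain
consists of the points that are dominated coordinatewise by some point of the core. -/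
def IsSubordinate (T : Fin l → DiffOp) (r : DiffOp) : Prop :=
  ∀ α ∈ r.support, toPoint α ∉ core T ∧
    ∃ q ∈ core T, (toPoint α).1 ≤ q.1 ∧ (toPoint α).2 ≤ q.2

/-- `r` is strictly subordinate: it is subordinate and none of its monomials corresponds to a point
of the vertical or of the horizontal segment that joins an endpoint of the core to an axis, i.e.,
no exponent in it attains the largest first (respectively second) coordinate on the core. -/
def IsStrictlySubordinate (T : Fin l → DiffOp) (r : DiffOp) : Prop :=
  IsSubordinate T r ∧ ∀ α ∈ r.support,
    (∃ q ∈ core T, (toPoint α).1 < q.1) ∧ (∃ q ∈ core T, (toPoint α).2 < q.2)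

end Lines

/-- `f` is proper: its Fourier coefficients vanish on the coordinate axes. -/
def IsProper (f : C(Torus, ℂ)) : Prop :=
  ∀ n : Fin 2 → ℤ, n 0 = 0 ∨ n 1 = 0 → UnitAddTorus.mFourierCoeff f n = 0

end SmoothTorus

end

noncomputable section

open Filter Topology MeasureTheory

namespace SmoothTorus

/-! ### The space of continuous functions on the torus -/

/-! Everything is a statement about Fourier multipliers on `C(𝕋²)`. Singular integrals can be
avoided because strict subordination gains a power. By the geometry of the core
(`exists_power_gain`), a strictly subordinate monomial multiplied by `|mn|^δ` is still dominated by
a monomial of the core. Ellipticity bounds `|R(m, n)|` from below by a multiple of the sum of the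
core monomials once `|m|` or `|n|` is large and neither vanishes (`exists_lower_bound`). Hence the
symbol `r / R` is `O(|mn|^(-δ))`, and a discrete Leibniz rule makes its mixed difference
`O(|mn|^(-1-δ))`. Double Abel summation turns the multiplier into a series of products of
one-dimensional partial sum projections, whose norms grow more slowly than any given power, so the
series converges absolutely in operator norm (`exists_quadrant_mult`). Finitely many terms carry all
but `ε` of it, and they only see frequencies in a square; this is assertion 3.

The lower bound is proved by contradiction and compactness. Divide `R` by its largest monomial along
a sequence of bad points and pass to the limit. Either one monomial survives, which is absurd, or
the surviving monomials lie on one admissible line and the limit exhibits a zero of a senior part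
off the axes.

If a subordinate monomial `∂^α` is not strictly subordinate, it lies on the segment joining an
extreme vertex `q` of the core to an axis. Then `R = ∂_j^(c+1) (a_q ∂^α + s)` with `s` strictly
subordinate, and `∂^α` is obtained by solving this relation: integration in `x_j` and `s` are both
small at high frequencies (`isSmall_of_extremal`). This gives assertion 2.

For the isomorphism, away from the axes `‖f‖_T` is equivalent to `‖R f‖` by assertion 2. What
remains is a finite union of lines in the frequency plane; on each line the symbols are polynomials
in one variable, and the highest power dominates outside a finite set. Gluing yields one symbol `q`
with `‖f‖_T` equivalent to `‖q f‖` (`exists_equivOn`), so that `C^T` is isomorphic to the space of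
continuous functions with spectrum in `{q ≠ 0}` (`nonempty_smoothSpace_equiv`).

This set contains all frequencies outside the bands `|m| ≤ M`, `|n| ≤ M`. A missing line is absorbed
without changing the isomorphism type. Multiplying the functions with spectrum on it by bumps that
have disjoint supports and high frequencies places a sequence of copies inside the space, and
shifting along the copies gives `X ≅ X × D` (`nonempty_equiv_prod`). Finitely many absorptions lead
to `C(𝕋²)` (`nonempty_spectralSpace_equiv_top`). -/

/-- The Banach space `C(𝕋²)`, with its instances sealed. -/
def CT : Type := C(Torus, ℂ)

instance : NormedAddCommGroup CT := inferInstanceAs (NormedAddCommGroup C(Torus, ℂ))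
instance : NormedSpace ℂ CT := inferInstanceAs (NormedSpace ℂ C(Torus, ℂ))
instance : CompleteSpace CT := inferInstanceAs (CompleteSpace C(Torus, ℂ))
instance : FunLike CT Torus ℂ := inferInstanceAs (FunLike C(Torus, ℂ) Torus ℂ)

namespace CT

theorem ext {f g : CT} (h : ∀ x, f x = g x) : f = g := DFunLike.ext f g h

theorem continuous (f : CT) : Continuous f := ContinuousMap.continuous (f : C(Torus, ℂ))

theorem add_apply (f g : CT) (x : Torus) : (f + g) x = f x + g x := rfl

theorem smul_apply (c : ℂ) (f : CT) (x : Torus) : (c • f) x = c * f x := rfl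

theorem norm_apply_le (f : CT) (x : Torus) : ‖f x‖ ≤ ‖f‖ :=
  ContinuousMap.norm_coe_le_norm (f : C(Torus, ℂ)) x

theorem norm_le {f : CT} {C : ℝ} (hC : 0 ≤ C) : ‖f‖ ≤ C ↔ ∀ x, ‖f x‖ ≤ C :=
  ContinuousMap.norm_le (f : C(Torus, ℂ)) hC

/-- A continuous function as an element of `C(𝕋²)`. -/
def mk (f : Torus → ℂ) (h : Continuous f) : CT := (⟨f, h⟩ : C(Torus, ℂ))

/-- The evaluation at a point. -/
def eval (x : Torus) : CT →L[ℂ] ℂ :=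
  LinearMap.mkContinuous
    { toFun := fun f => f x, map_add' := fun _ _ => rfl, map_smul' := fun _ _ => rfl } 1
    (fun f => (norm_apply_le f x).trans_eq (one_mul _).symm)

theorem sum_apply {ι : Type*} (s : Finset ι) (f : ι → CT) (x : Torus) :
    (∑ i ∈ s, f i) x = ∑ i ∈ s, f i x := map_sum (eval x) f s

end CT

/-! ### Fourier coefficients of continuous functions on the torus -/

section Coefficients

/-- The normalised Haar measure, as in the definition of `UnitAddTorus.mFourierCoeff`. -/
local instance : MeasureSpace UnitAddCircle := ⟨AddCircle.haarAddCircle⟩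

local instance : IsProbabilityMeasure (volume : Measure UnitAddCircle) :=
  inferInstanceAs (IsProbabilityMeasure AddCircle.haarAddCircle)

theorem integrable_torus {f : Torus → ℂ} (hf : Continuous f) : Integrable f :=
  hf.integrable_of_hasCompactSupport (HasCompactSupport.of_compactSpace _)

/-- The `n`-th Fourier coefficient as a continuous linear functional on `C(𝕋²)`. -/
def coeff (n : Fin 2 → ℤ) : CT →L[ℂ] ℂ :=
  LinearMap.mkContinuous
    { toFun := fun f => UnitAddTorus.mFourierCoeff f n
      map_add' := fun f g => by
        simp only [UnitAddTorus.mFourierCoeff, smul_eq_mul, CT.add_apply, mul_add]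
        exact integral_add
          (integrable_torus ((UnitAddTorus.mFourier (-n)).continuous.mul f.continuous))
          (integrable_torus ((UnitAddTorus.mFourier (-n)).continuous.mul g.continuous))
      map_smul' := fun c f => by
        simp only [UnitAddTorus.mFourierCoeff, smul_eq_mul, CT.smul_apply, RingHom.id_apply,
          mul_left_comm _ c]
        exact integral_const_mul c _ } 1 (fun f => by
      have h : ∀ x, ‖UnitAddTorus.mFourier (-n) x • f x‖ ≤ ‖f‖ := fun x => by
        rw [norm_smul]
        have h1 := (UnitAddTorus.mFourier (-n)).norm_coe_le_norm x
        rw [UnitAddTorus.mFourier_norm] at h1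
        have h2 := f.norm_apply_le x
        have h3 := norm_nonneg (f x)
        nlinarith
      rw [one_mul]
      refine (norm_integral_le_of_norm_le_const (μ := (volume : Measure Torus))
        (Eventually.of_forall h)).trans ?_
      simp)

/-- The exponential monomials on the torus. -/
def expo (k : Fin 2 → ℤ) : CT := UnitAddTorus.mFourier k

theorem coeff_expo (n k : Fin 2 → ℤ) : coeff n (expo k) = if n = k then 1 else 0 := by
  have h1 : coeff n (expo k) = UnitAddTorus.mFourierCoeff
    (ContinuousMap.toLp (E := ℂ) 2 volume ℂ (UnitAddTorus.mFourier k)) n :=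
    (UnitAddTorus.mFourierCoeff_toLp (UnitAddTorus.mFourier k) n).symm
  have h2 : ContinuousMap.toLp (E := ℂ) 2 volume ℂ (UnitAddTorus.mFourier k)
      = UnitAddTorus.mFourierBasis (d := Fin 2) k := by
    rw [UnitAddTorus.coe_mFourierBasis]
  rw [h1, h2]
  refine (UnitAddTorus.mFourierBasis_repr _ n).symm.trans ?_
  rw [HilbertBasis.repr_self]
  simp [lp.single_apply, Pi.single_apply]

/-- A Fourier series with zero coefficients is summable, hence converges uniformly to `f`, and its
sum is zero. -/
theorem eq_zero_of_coeff_eq_zero (f : C(Torus, ℂ)) (h : UnitAddTorus.mFourierCoeff f = fun _ => 0) :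
    f = 0 := by
  have h2 := UnitAddTorus.hasSum_mFourier_series_of_summable (f := f)
    (by rw [h]; exact summable_zero)
  refine h2.unique ?_
  convert! hasSum_zero (α := C(Torus, ℂ)) (β := Fin 2 → ℤ) using 2 with i
  rw [h]
  ext x
  exact zero_mul _

theorem eq_of_coeff_eq {f g : CT} (h : ∀ n, coeff n f = coeff n g) : f = g := by
  rw [← sub_eq_zero]
  exact eq_zero_of_coeff_eq_zero (f - g : CT) (funext fun n =>
    (map_sub (coeff n) f g).trans (sub_eq_zero.2 (h n)))

end Coefficients

/-- The trigonometric polynomials, as a subspace of `CT`. -/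
def trig : Submodule ℂ CT := trigPoly

theorem dense_trig : Dense (trig : Set CT) := by
  rw [Submodule.dense_iff_topologicalClosure_eq_top]
  exact UnitAddTorus.span_mFourier_closure_eq_top

theorem expo_mem (k : Fin 2 → ℤ) : expo k ∈ trig :=
  (Submodule.subset_span ⟨k, rfl⟩ : UnitAddTorus.mFourier k ∈ trigPoly)

theorem clm_ext_expo {F : Type*} [TopologicalSpace F] [AddCommMonoid F] [Module ℂ F] [T2Space F]
    {A B : CT →L[ℂ] F} (h : ∀ k, A (expo k) = B (expo k)) : A = B := by
  apply ContinuousLinearMap.ext_on (s := Set.range expo)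
  · exact dense_trig
  · rintro _ ⟨k, rfl⟩; exact h k

/-! ### Fourier multipliers -/

/-- `A` is the Fourier multiplier with symbol `a`. -/
def IsMult (A : CT →L[ℂ] CT) (a : (Fin 2 → ℤ) → ℂ) : Prop :=
  ∀ k, A (expo k) = a k • expo k

/-- Both sides are continuous in `g` and agree on the exponentials, whose span is dense. Identities
between multipliers can then be checked one frequency at a time. -/
theorem IsMult.coeff {A : CT →L[ℂ] CT} {a : (Fin 2 → ℤ) → ℂ}
    (h : IsMult A a) (n : Fin 2 → ℤ) (g : CT) :
    coeff n (A g) = a n * coeff n g := by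
  have : (SmoothTorus.coeff n).comp A = a n • SmoothTorus.coeff n := by
    apply clm_ext_expo
    intro k
    simp only [ContinuousLinearMap.comp_apply, h k, map_smul, _root_.smul_apply,
      coeff_expo]
    split_ifs with hk
    · rw [hk]
    · simp
  exact congrArg (fun B => B g) this

theorem isMult_id : IsMult (ContinuousLinearMap.id ℂ _) (fun _ => 1) := fun k => by simp

theorem IsMult.comp {A B : CT →L[ℂ] CT} {a b : (Fin 2 → ℤ) → ℂ}
    (hA : IsMult A a) (hB : IsMult B b) : IsMult (A.comp B) (fun k => a k * b k) := fun k => by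
  simp [hB k, hA k, smul_smul, mul_comm]

theorem IsMult.sub {A B : CT →L[ℂ] CT} {a b : (Fin 2 → ℤ) → ℂ}
    (hA : IsMult A a) (hB : IsMult B b) : IsMult (A - B) (fun k => a k - b k) := fun k => by
  simp [hB k, hA k, sub_smul]

/-! ### Translations and convolutions in one variable -/

theorem expo_add_single (j : Fin 2) (k : Fin 2 → ℤ) (x : Torus) (t : UnitAddCircle) :
    expo k (x + Pi.single j t) = fourier (k j) t * expo k x := by
  have h2 : UnitAddTorus.mFourier k (x + Pi.single j t)
      = UnitAddTorus.mFourier k x * UnitAddTorus.mFourier k (Pi.single j t) := by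
    simp only [UnitAddTorus.mFourier, ContinuousMap.coe_mk, Pi.add_apply,
      ← Finset.prod_mul_distrib]
    refine Finset.prod_congr rfl fun i _ => ?_
    simp [fourier_apply, smul_add, AddCircle.toCircle_add]
  refine h2.trans ?_
  rw [mul_comm]
  congr 1
  simp only [UnitAddTorus.mFourier, ContinuousMap.coe_mk]
  rw [Finset.prod_eq_single j]
  · simp
  · intro b _ hb
    simp [Pi.single_eq_of_ne hb]
  · simp

/-- The composition with a continuous self-map of the torus. -/
def compMap (s : Torus → Torus) (hs : Continuous s) : CT →L[ℂ] CT :=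
  LinearMap.mkContinuous
    { toFun := fun g => CT.mk (fun x => g (s x)) (g.continuous.comp hs)
      map_add' := fun _ _ => rfl
      map_smul' := fun _ _ => rfl } 1
    (fun g => by
      rw [one_mul]
      exact (CT.norm_le (norm_nonneg _)).2 fun _ => g.norm_apply_le _)

theorem norm_compMap_le (s : Torus → Torus) (hs : Continuous s) (g : CT) :
    ‖compMap s hs g‖ ≤ ‖g‖ :=
  (CT.norm_le (norm_nonneg _)).2 fun _ => g.norm_apply_le _

theorem continuous_shift (j : Fin 2) (t : UnitAddCircle) :
    Continuous fun x : Torus => x + Pi.single j t :=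
  continuous_id.add continuous_const

/-- The translation operator `(τ_t g)(x) = g (x + t e_j)`. -/
def translate (j : Fin 2) (t : UnitAddCircle) : CT →L[ℂ] CT := compMap _ (continuous_shift j t)

theorem translate_apply (j : Fin 2) (t : UnitAddCircle) (g : CT) (x : Torus) :
    translate j t g x = g (x + Pi.single j t) := rfl

theorem norm_translate_le (j : Fin 2) (t : UnitAddCircle) (g : CT) :
    ‖translate j t g‖ ≤ ‖g‖ := norm_compMap_le _ _ g

theorem isMult_translate (j : Fin 2) (t : UnitAddCircle) :
    IsMult (translate j t) (fun k => fourier (k j) t) := fun k => by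
  apply CT.ext
  intro x
  rw [translate_apply, expo_add_single, CT.smul_apply]

theorem continuous_ct_of_uncurry {X : Type*} [TopologicalSpace X] {F : X → CT}
    (h : Continuous fun p : X × Torus => F p.1 p.2) : Continuous F :=
  ContinuousMap.continuous_of_continuous_uncurry (fun x => (F x : C(Torus, ℂ))) h

theorem continuous_translate (j : Fin 2) (g : CT) :
    Continuous fun t : UnitAddCircle => translate j t g := by
  apply continuous_ct_of_uncurry
  simp only [translate_apply]
  refine g.continuous.comp (continuous_snd.add ?_)
  exact (continuous_single j).comp continuous_fst

theorem continuous_convIntegrand (j : Fin 2) {φ : ℝ → ℂ} (hφ : Continuous φ) (g : CT) :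
    Continuous fun t : ℝ => φ t • translate j ((-t : ℝ) : UnitAddCircle) g := by
  refine hφ.smul ((continuous_translate j g).comp ?_)
  exact (AddCircle.continuous_mk' (1 : ℝ)).comp continuous_neg

theorem norm_convIntegrand_le (j : Fin 2) {φ : ℝ → ℂ} (hφ : Continuous φ) (g : CT) :
    ‖∫ t in (0 : ℝ)..1, φ t • translate j ((-t : ℝ) : UnitAddCircle) g‖
      ≤ (∫ t in (0 : ℝ)..1, ‖φ t‖) * ‖g‖ := by
  rw [← intervalIntegral.integral_mul_const]
  refine intervalIntegral.norm_integral_le_of_norm_le zero_le_one ?_ ?_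
  · refine Eventually.of_forall fun t _ => ?_
    rw [norm_smul]
    exact mul_le_mul_of_nonneg_left (norm_translate_le _ _ _) (norm_nonneg _)
  · exact (Continuous.mul (by fun_prop) continuous_const).intervalIntegrable _ _

/-- The convolution with `φ` in the `j`-th variable. -/
def conv (j : Fin 2) {φ : ℝ → ℂ} (hφ : Continuous φ) : CT →L[ℂ] CT :=
  LinearMap.mkContinuous
    { toFun := fun g => ∫ t in (0 : ℝ)..1, φ t • translate j ((-t : ℝ) : UnitAddCircle) g
      map_add' := fun f g => by
        simp only [map_add, smul_add]
        exact intervalIntegral.integral_add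
          ((continuous_convIntegrand j hφ f).intervalIntegrable _ _)
          ((continuous_convIntegrand j hφ g).intervalIntegrable _ _)
      map_smul' := fun c f => by
        simp only [map_smul, RingHom.id_apply, smul_comm _ c]
        exact intervalIntegral.integral_smul c _ }
    (∫ t in (0 : ℝ)..1, ‖φ t‖) (fun g => norm_convIntegrand_le j hφ g)

theorem conv_apply (j : Fin 2) {φ : ℝ → ℂ} (hφ : Continuous φ) (g : CT) :
    conv j hφ g = ∫ t in (0 : ℝ)..1, φ t • translate j ((-t : ℝ) : UnitAddCircle) g := rfl

theorem norm_conv_le (j : Fin 2) {φ : ℝ → ℂ} (hφ : Continuous φ) (g : CT) :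
    ‖conv j hφ g‖ ≤ (∫ t in (0 : ℝ)..1, ‖φ t‖) * ‖g‖ := norm_convIntegrand_le j hφ g

theorem isMult_conv (j : Fin 2) {φ : ℝ → ℂ} (hφ : Continuous φ) :
    IsMult (conv j hφ) (fun k => ∫ t in (0 : ℝ)..1, φ t * fourier (-k j) (t : UnitAddCircle)) := by
  intro k
  rw [conv_apply]
  refine Eq.trans ?_ (intervalIntegral.integral_smul_const _ (expo k))
  refine intervalIntegral.integral_congr fun t _ => ?_
  simp only [isMult_translate j _ k, smul_smul]
  congr 2
  rw [fourier_coe_apply, fourier_coe_apply]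
  congr 1
  push_cast
  ring

/-- The function `t ↦ exp (2πimt)` on the line. -/
def wave (m : ℤ) (t : ℝ) : ℂ := Complex.exp (2 * Real.pi * Complex.I * m * t)

theorem continuous_wave (m : ℤ) : Continuous (wave m) := by unfold wave; fun_prop

theorem fourier_eq_wave (m : ℤ) (t : ℝ) : fourier m (t : UnitAddCircle) = wave m t := by
  rw [fourier_coe_apply, wave]
  simp

theorem wave_mul (m n : ℤ) (t : ℝ) : wave m t * wave n t = wave (m + n) t := by
  rw [wave, wave, wave, ← Complex.exp_add]
  congr 1
  push_cast
  ring

theorem integral_wave (m : ℤ) : ∫ t in (0 : ℝ)..1, wave m t = if m = 0 then 1 else 0 := by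
  unfold wave
  split_ifs with hm
  · subst hm
    simp
  · have hc : (2 * Real.pi * Complex.I * m : ℂ) ≠ 0 := by
      simp [Real.pi_ne_zero, hm]
    rw [integral_exp_mul_complex hc]
    have h2 : Complex.exp ((2 * Real.pi * Complex.I * m) * (1 : ℝ)) = 1 := by
      rw [Complex.exp_eq_one_iff]
      exact ⟨m, by push_cast; ring⟩
    rw [h2]
    simp

theorem continuous_sum_wave {ι : Type*} (s : Finset ι) (m : ι → ℤ) :
    Continuous fun t => ∑ i ∈ s, wave (m i) t :=
  continuous_finsetSum s fun i _ => continuous_wave (m i)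

theorem isMult_conv_sum_wave {ι : Type*} (j : Fin 2) (s : Finset ι) (m : ι → ℤ) :
    IsMult (conv j (continuous_sum_wave s m))
      (fun k => ∑ i ∈ s, if m i = k j then 1 else 0) := by
  intro k
  rw [isMult_conv]
  congr 1
  simp only [fourier_eq_wave, Finset.sum_mul, wave_mul]
  rw [intervalIntegral.integral_finsetSum
    (fun i _ => (continuous_wave _).intervalIntegrable _ _)]
  refine Finset.sum_congr rfl fun i _ => ?_
  rw [integral_wave]
  simp only [← sub_eq_add_neg, sub_eq_zero]

theorem isMult_conv_wave (j : Fin 2) (m : ℤ) :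
    IsMult (conv j (continuous_wave m)) (fun k => if m = k j then 1 else 0) := by
  intro k
  rw [isMult_conv]
  congr 1
  simp only [fourier_eq_wave, wave_mul]
  rw [integral_wave]
  simp only [← sub_eq_add_neg, sub_eq_zero]

/-! ### Spectral subspaces and bounded spectral projections -/

/-- The closed subspace of the functions whose spectrum is contained in `S`. -/
def spectralSpace (S : Set (Fin 2 → ℤ)) : Submodule ℂ CT :=
  ⨅ n ∈ Sᶜ, LinearMap.ker (coeff n).toLinearMap

theorem mem_spectralSpace {S : Set (Fin 2 → ℤ)} {f : CT} :
    f ∈ spectralSpace S ↔ ∀ n, n ∉ S → coeff n f = 0 := by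
  simp [spectralSpace, Submodule.mem_iInf]

theorem isClosed_spectralSpace (S : Set (Fin 2 → ℤ)) :
    IsClosed (spectralSpace S : Set CT) := by
  have : (spectralSpace S : Set CT) = ⋂ n ∈ Sᶜ, {f | coeff n f = 0} := by
    ext f
    simp [mem_spectralSpace]
  rw [this]
  exact isClosed_biInter fun n _ => isClosed_eq (coeff n).continuous continuous_const

instance (S : Set (Fin 2 → ℤ)) : CompleteSpace (spectralSpace S) :=
  (isClosed_spectralSpace S).completeSpace_coe

open Classical in
/-- The projection onto the frequencies in `S` is bounded in the uniform norm. -/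
def IsBddSet (S : Set (Fin 2 → ℤ)) : Prop :=
  ∃ A : CT →L[ℂ] CT, IsMult A (fun k => if k ∈ S then 1 else 0)

open Classical in
/-- The spectral projection to a set `S` for which it is bounded. -/
def IsBddSet.proj {S : Set (Fin 2 → ℤ)} (h : IsBddSet S) : CT →L[ℂ] CT :=
  h.choose

namespace IsBddSet

variable {S S' : Set (Fin 2 → ℤ)}

open Classical in
theorem isMult_proj (h : IsBddSet S) : IsMult h.proj (fun k => if k ∈ S then 1 else 0) :=
  h.choose_spec

open Classical in
theorem coeff_proj (h : IsBddSet S) (n : Fin 2 → ℤ) (g : CT) :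
    coeff n (h.proj g) = if n ∈ S then coeff n g else 0 := by
  rw [h.isMult_proj.coeff]
  split_ifs <;> simp

theorem proj_mem (h : IsBddSet S) (g : CT) : h.proj g ∈ spectralSpace S := by
  rw [mem_spectralSpace]
  intro n hn
  rw [h.coeff_proj, if_neg hn]

theorem proj_eq_self (h : IsBddSet S) {g : CT} (hg : g ∈ spectralSpace S) :
    h.proj g = g := by
  apply eq_of_coeff_eq
  intro n
  rw [h.coeff_proj]
  split_ifs with hn
  · rfl
  · rw [mem_spectralSpace.1 hg n hn]

theorem univ : IsBddSet Set.univ := ⟨ContinuousLinearMap.id ℂ _, fun k => by simp⟩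

/-- Together with `inter` this makes the bounded sets a Boolean algebra. The sets needed later arise
from coordinate lines by finitely many Boolean operations. -/
theorem compl (h : IsBddSet S) : IsBddSet Sᶜ := by
  classical
  refine ⟨ContinuousLinearMap.id ℂ _ - h.proj, ?_⟩
  convert isMult_id.sub h.isMult_proj using 2 with k
  by_cases hk : k ∈ S <;> simp [hk]

theorem inter (h : IsBddSet S) (h' : IsBddSet S') : IsBddSet (S ∩ S') := by
  classical
  refine ⟨h.proj.comp h'.proj, ?_⟩
  convert h.isMult_proj.comp h'.isMult_proj using 2 with k
  by_cases hk : k ∈ S <;> by_cases hk' : k ∈ S' <;> simp [hk, hk']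

theorem union (h : IsBddSet S) (h' : IsBddSet S') : IsBddSet (S ∪ S') := by
  have := (h.compl.inter h'.compl).compl
  rwa [Set.compl_inter, compl_compl, compl_compl] at this

theorem diff (h : IsBddSet S) (h' : IsBddSet S') : IsBddSet (S \ S') := h.inter h'.compl

theorem empty : IsBddSet ∅ := by simpa using univ.compl

theorem biUnion {ι : Type*} {s : Set ι} (hs : s.Finite) {f : ι → Set (Fin 2 → ℤ)}
    (h : ∀ i ∈ s, IsBddSet (f i)) : IsBddSet (⋃ i ∈ s, f i) := by
  induction s, hs using Set.Finite.induction_on with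
  | empty => simpa using empty
  | @insert a s _ _ ih =>
    rw [Set.biUnion_insert]
    exact (h a (Set.mem_insert _ _)).union (ih fun i hi => h i (Set.mem_insert_of_mem _ hi))

theorem coord_eq (j : Fin 2) (m : ℤ) : IsBddSet {k | k j = m} := by
  classical
  refine ⟨conv j (continuous_wave m), ?_⟩
  convert isMult_conv_wave j m using 2 with k
  simp [eq_comm]

theorem coord_mem (j : Fin 2) {s : Set ℤ} (hs : s.Finite) : IsBddSet {k | k j ∈ s} := by
  have : {k : Fin 2 → ℤ | k j ∈ s} = ⋃ m ∈ s, {k | k j = m} := by ext k; simp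
  rw [this]
  exact biUnion hs fun m _ => coord_eq j m

theorem coord_abs_le (j : Fin 2) (M : ℕ) : IsBddSet {k | |k j| ≤ M} := by
  have := coord_mem j (s := {m | |m| ≤ (M : ℤ)})
    ((Set.finite_Icc (-(M : ℤ)) M).subset fun m hm => by simpa [abs_le] using hm)
  exact this

theorem singleton (k : Fin 2 → ℤ) : IsBddSet {k} := by
  have : ({k} : Set (Fin 2 → ℤ)) = {n | n 0 = k 0} ∩ {n | n 1 = k 1} := by
    ext n
    simp only [Set.mem_singleton_iff, Set.mem_inter_iff, Set.mem_ofPred_eq]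
    constructor
    · rintro rfl; simp
    · rintro ⟨h0, h1⟩
      ext i
      fin_cases i
      · exact h0
      · exact h1
  rw [this]
  exact (coord_eq 0 _).inter (coord_eq 1 _)

theorem finite (hS : S.Finite) : IsBddSet S := by
  have : S = ⋃ k ∈ S, {k} := by simp
  rw [this]
  exact biUnion hS fun k _ => singleton k

end IsBddSet

/-! ### The Dirichlet kernel -/

/-- The one-sided Dirichlet kernel. -/
def dirichlet (σ : ℤ) (i : ℕ) (t : ℝ) : ℂ := ∑ l ∈ Finset.range (i + 1), wave (σ * (l + 1)) t

theorem norm_wave (m : ℤ) (t : ℝ) : ‖wave m t‖ = 1 := by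
  have : (2 * Real.pi * Complex.I * m * t : ℂ) = ((2 * Real.pi * m * t : ℝ) : ℂ) * Complex.I := by
    push_cast; ring
  rw [wave, this, Complex.norm_exp_ofReal_mul_I]

theorem wave_eq_pow (σ : ℤ) (l : ℕ) (t : ℝ) : wave (σ * (l + 1)) t = wave σ t ^ (l + 1) := by
  rw [wave, wave, ← Complex.exp_nat_mul]
  congr 1
  push_cast
  ring

theorem norm_dirichlet_le (σ : ℤ) (i : ℕ) (t : ℝ) : ‖dirichlet σ i t‖ ≤ (i + 1 : ℝ) := by
  refine (norm_sum_le _ _).trans ?_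
  simp [norm_wave]

theorem norm_dirichlet_mul_le (σ : ℤ) (i : ℕ) (t : ℝ) :
    ‖dirichlet σ i t‖ * ‖wave σ t - 1‖ ≤ 2 := by
  rw [← norm_mul]
  have : dirichlet σ i t * (wave σ t - 1) = wave σ t * (wave σ t ^ (i + 1) - 1) := by
    simp only [dirichlet, wave_eq_pow]
    rw [← geom_sum_mul, ← mul_assoc, Finset.mul_sum]
    simp only [pow_succ']
  rw [this, norm_mul, norm_wave, one_mul]
  refine (norm_sub_le _ _).trans ?_
  rw [norm_pow, norm_wave]
  norm_num

theorem norm_wave_sub_one {σ : ℤ} (hσ : σ = 1 ∨ σ = -1) (t : ℝ) :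
    ‖wave σ t - 1‖ = 2 * |Real.sin (Real.pi * t)| := by
  have h : (2 * Real.pi * Complex.I * σ * t : ℂ)
      = Complex.I * ((2 * Real.pi * σ * t : ℝ) : ℂ) := by push_cast; ring
  rw [wave, h, Complex.norm_exp_I_mul_ofReal_sub_one, norm_mul, Real.norm_eq_abs, Real.norm_eq_abs,
    abs_two]
  congr 1
  rcases hσ with rfl | rfl
  · congr 2; push_cast; ring
  · rw [← abs_neg, ← Real.sin_neg]; congr 2; push_cast; ring

/-- Summing the geometric progression bounds the kernel by `1 / sin (πt)`, and Jordan's inequality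
gives `sin (πt) ≥ 2t` on `[0, 1/2]`. The value at `1 - t` covers the other half of the period. -/
theorem norm_dirichlet_le_inv {σ : ℤ} (hσ : σ = 1 ∨ σ = -1) (i : ℕ) {t : ℝ} (h0 : 0 < t)
    (h1 : t ≤ 1 / 2) : ‖dirichlet σ i t‖ ≤ t⁻¹ ∧ ‖dirichlet σ i (1 - t)‖ ≤ t⁻¹ := by
  have hs : 2 * t ≤ Real.sin (Real.pi * t) := by
    have := Real.mul_le_sin (x := Real.pi * t) (by positivity) (by nlinarith [Real.pi_pos])
    rwa [show 2 / Real.pi * (Real.pi * t) = 2 * t by field_simp] at this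
  have hs' : Real.sin (Real.pi * (1 - t)) = Real.sin (Real.pi * t) := by
    rw [show Real.pi * (1 - t) = Real.pi - Real.pi * t by ring, Real.sin_pi_sub]
  have key : ∀ s, Real.sin (Real.pi * s) = Real.sin (Real.pi * t) → ‖dirichlet σ i s‖ ≤ t⁻¹ := by
    intro s h
    have h2 := norm_dirichlet_mul_le σ i s
    rw [norm_wave_sub_one hσ, h, abs_of_pos (by linarith)] at h2
    rw [← one_div, le_div_iff₀ h0]
    nlinarith [norm_nonneg (dirichlet σ i s)]
  exact ⟨key t rfl, key (1 - t) hs'⟩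

theorem le_rpow_mul_rpow {x A B ε : ℝ} (hx : 0 ≤ x) (hA : x ≤ A) (hB : x ≤ B) (h0 : 0 < ε)
    (h1 : ε < 1) : x ≤ A ^ ε * B ^ (1 - ε) := by
  calc x = x ^ ε * x ^ (1 - ε) := by
        rw [← Real.rpow_add_of_nonneg hx h0.le (by linarith)]; simp
    _ ≤ A ^ ε * B ^ (1 - ε) :=
        mul_le_mul (Real.rpow_le_rpow hx hA h0.le) (Real.rpow_le_rpow hx hB (by linarith))
          (Real.rpow_nonneg hx _) (Real.rpow_nonneg (hx.trans hA) _)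

/-- Interpolating between the bounds `i + 1` and `1 / t` gives `(i + 1)^ε t^(ε - 1)`, which is
integrable. The logarithmic growth of the Lebesgue constants is not needed, since the coefficients
to be summed later decay with a power to spare. -/
theorem integral_norm_dirichlet_le {ε : ℝ} (h0 : 0 < ε) (h1 : ε < 1) :
    ∃ C : ℝ, 0 < C ∧ ∀ σ : ℤ, (σ = 1 ∨ σ = -1) → ∀ i : ℕ,
      ∫ t in (0 : ℝ)..1, ‖dirichlet σ i t‖ ≤ C * (i + 1 : ℝ) ^ ε := by
  have hint : IntervalIntegrable (fun t : ℝ => t ^ (ε - 1)) volume 0 1 :=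
    intervalIntegral.intervalIntegrable_rpow' (by linarith)
  have hint' : IntervalIntegrable (fun t : ℝ => (1 - t) ^ (ε - 1)) volume 0 1 := by
    simpa using (hint.comp_sub_left 1).symm
  refine ⟨(∫ t in (0 : ℝ)..1, t ^ (ε - 1) + (1 - t) ^ (ε - 1)) + 1, ?_, ?_⟩
  · have : 0 ≤ ∫ t in (0 : ℝ)..1, t ^ (ε - 1) + (1 - t) ^ (ε - 1) := by
      refine intervalIntegral.integral_nonneg zero_le_one fun t ht => ?_
      have := Real.rpow_nonneg ht.1 (ε - 1)
      have := Real.rpow_nonneg (sub_nonneg.2 ht.2) (ε - 1)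
      linarith
    linarith
  intro σ hσ i
  have hb : ∀ t ∈ Set.Ioo (0 : ℝ) 1, ‖dirichlet σ i t‖
      ≤ (t ^ (ε - 1) + (1 - t) ^ (ε - 1)) * (i + 1 : ℝ) ^ ε := by
    intro t ht
    have e1 := Real.rpow_nonneg ht.1.le (ε - 1)
    have e2 := Real.rpow_nonneg (sub_nonneg.2 ht.2.le) (ε - 1)
    have e3 := Real.rpow_nonneg (by positivity : (0 : ℝ) ≤ i + 1) ε
    have inv : ∀ s : ℝ, 0 < s → s⁻¹ ^ (1 - ε) = s ^ (ε - 1) := fun s hs => by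
      rw [Real.inv_rpow hs.le, ← Real.rpow_neg hs.le]; congr 1; ring
    rcases le_total t (1 / 2) with h | h
    · have := le_rpow_mul_rpow (norm_nonneg _) (norm_dirichlet_le σ i t)
        (norm_dirichlet_le_inv hσ i ht.1 h).1 h0 h1
      rw [inv t ht.1] at this
      nlinarith
    · have h3 := (norm_dirichlet_le_inv hσ i (t := 1 - t) (by linarith [ht.2]) (by linarith)).2
      rw [sub_sub_cancel] at h3
      have := le_rpow_mul_rpow (norm_nonneg _) (norm_dirichlet_le σ i t) h3 h0 h1
      rw [inv _ (by linarith [ht.2])] at this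
      nlinarith
  have hc : Continuous fun t => ‖dirichlet σ i t‖ :=
    (continuous_sum_wave (Finset.range (i + 1)) fun l => σ * (l + 1)).norm
  calc ∫ t in (0 : ℝ)..1, ‖dirichlet σ i t‖
      ≤ ∫ t in (0 : ℝ)..1, (t ^ (ε - 1) + (1 - t) ^ (ε - 1)) * (i + 1 : ℝ) ^ ε := by
        refine intervalIntegral.integral_mono_on_of_le_Ioo zero_le_one
          (hc.intervalIntegrable _ _) ((hint.add hint').mul_const _) hb
    _ = (∫ t in (0 : ℝ)..1, t ^ (ε - 1) + (1 - t) ^ (ε - 1)) * (i + 1 : ℝ) ^ ε := by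
        rw [intervalIntegral.integral_mul_const]
    _ ≤ _ := by
        have e3 := Real.rpow_nonneg (by positivity : (0 : ℝ) ≤ i + 1) ε
        nlinarith

/-- The projection onto the frequencies with `1 ≤ σ n_j ≤ i + 1`. -/
def partialProj (j : Fin 2) (σ : ℤ) (i : ℕ) : CT →L[ℂ] CT :=
  conv j (φ := dirichlet σ i) (continuous_sum_wave (Finset.range (i + 1)) fun l => σ * (l + 1))

theorem isMult_partialProj (j : Fin 2) {σ : ℤ} (hσ : σ = 1 ∨ σ = -1) (i : ℕ) :
    IsMult (partialProj j σ i) (fun k => if 0 < σ * k j ∧ σ * k j ≤ i + 1 then 1 else 0) := by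
  intro k
  refine (isMult_conv_sum_wave j (Finset.range (i + 1)) (fun l => σ * (l + 1)) k).trans ?_
  congr 1
  have hσ2 : σ * σ = 1 := by rcases hσ with rfl | rfl <;> rfl
  have h : ∀ l : ℕ, (σ * ((l : ℤ) + 1) = k j ↔ l = σ * k j - 1) := fun l => by
    constructor
    · intro h; rw [← h, ← mul_assoc, hσ2]; ring
    · intro h; rw [h]; ring_nf; rw [pow_two, hσ2, one_mul]
  simp only [h]
  symm
  split_ifs with hk
  · rw [Finset.sum_eq_single (σ * k j - 1).toNat]
    · rw [if_pos]; omega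
    · intro b _ hb; rw [if_neg]; omega
    · intro hb; exact absurd (Finset.mem_range.2 (by omega)) hb
  · rw [Finset.sum_eq_zero]
    intro l hl
    rw [Finset.mem_range] at hl
    rw [if_neg]; omega

theorem norm_partialProj_le {ε : ℝ} (h0 : 0 < ε) (h1 : ε < 1) :
    ∃ C : ℝ, 0 < C ∧ ∀ j, ∀ σ : ℤ, (σ = 1 ∨ σ = -1) → ∀ i : ℕ, ∀ g : CT,
      ‖partialProj j σ i g‖ ≤ C * (i + 1 : ℝ) ^ ε * ‖g‖ := by
  obtain ⟨C, hC, h⟩ := integral_norm_dirichlet_le h0 h1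
  refine ⟨C, hC, fun j σ hσ i g => (norm_conv_le j _ g).trans ?_⟩
  exact mul_le_mul_of_nonneg_right (h σ hσ i) (norm_nonneg _)

/-! ### Absolutely convergent combinations of multipliers -/

/-- The series converges absolutely in operator norm. For the smallness, `F` carries all but `ε` of
the majorant; if the terms in `F` annihilate `g`, only the tail acts on it. -/
theorem exists_hasSum_clm {ι : Type*} (Q : ι → CT →L[ℂ] CT) (d : ι → ℂ) (w : ι → ℝ)
    (hw : ∀ i, 0 ≤ w i) (hQ : ∀ i g, ‖Q i g‖ ≤ w i * ‖g‖) (hs : Summable fun i => ‖d i‖ * w i) :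
    ∃ U : CT →L[ℂ] CT, (∀ g, HasSum (fun i => d i • Q i g) (U g)) ∧
      ∀ ε : ℝ, 0 < ε → ∃ F : Finset ι, ∀ g, (∀ i ∈ F, Q i g = 0) → ‖U g‖ ≤ ε * ‖g‖ := by
  have hb : ∀ i g, ‖d i • Q i g‖ ≤ ‖d i‖ * w i * ‖g‖ := fun i g => by
    rw [norm_smul, mul_assoc]
    exact mul_le_mul_of_nonneg_left (hQ i g) (norm_nonneg _)
  have hn : ∀ i, ‖d i • Q i‖ ≤ ‖d i‖ * w i := fun i =>
    ContinuousLinearMap.opNorm_le_bound _ (mul_nonneg (norm_nonneg _) (hw i)) (hb i)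
  have hsum : Summable fun i => d i • Q i := Summable.of_norm_bounded hs hn
  have hU : ∀ g, HasSum (fun i => d i • Q i g) ((∑' i, d i • Q i) g) := fun g =>
    hsum.hasSum.mapL (ContinuousLinearMap.apply ℂ CT g)
  refine ⟨∑' i, d i • Q i, hU, fun ε hε => ?_⟩
  obtain ⟨F, hF⟩ := (hs.hasSum.eventually (lt_mem_nhds (sub_lt_self _ hε))).exists
  refine ⟨F, fun g hg => ?_⟩
  rw [← (hU g).tsum_eq]
  have hs' : Summable fun i => ‖d i‖ * w i * ‖g‖ := hs.mul_right _
  have hsn : Summable fun i => ‖d i • Q i g‖ :=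
    Summable.of_nonneg_of_le (fun _ => norm_nonneg _) (hb · g) hs'
  refine (norm_tsum_le_tsum_norm hsn).trans ?_
  have e1 := hsn.sum_add_tsum_compl (s := F)
  have e2 := hs.sum_add_tsum_compl (s := F)
  have e3 : ∑ i ∈ F, ‖d i • Q i g‖ = 0 := Finset.sum_eq_zero fun i hi => by simp [hg i hi]
  have e4 : ∑' i : ↑(↑F : Set ι)ᶜ, ‖d i • Q i g‖
      ≤ ∑' i : ↑(↑F : Set ι)ᶜ, ‖d i‖ * w i * ‖g‖ :=
    Summable.tsum_le_tsum (fun i => hb i g) (hsn.subtype _) (hs'.subtype _)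
  rw [tsum_mul_right] at e4
  have e5 : ∑' i : ↑(↑F : Set ι)ᶜ, ‖d i‖ * w i ≤ ε := by linarith
  have := mul_le_mul_of_nonneg_right e5 (norm_nonneg g)
  linarith

theorem sum_range_ite_sub {E : Type*} [AddCommGroup E] (b : ℕ → E) (p L : ℕ) :
    ∑ i ∈ Finset.range L, (if p ≤ i then b i - b (i + 1) else 0)
      = if p ≤ L then b p - b L else 0 := by
  induction L with
  | zero =>
    rcases Nat.eq_zero_or_pos p with rfl | h
    · simp
    · simp [h.ne']
  | succ L ih =>
    rw [Finset.sum_range_succ, ih]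
    by_cases h : p ≤ L
    · simp [h, h.trans (Nat.le_succ L)]
    · by_cases h' : p ≤ L + 1
      · have : p = L + 1 := by omega
        subst this
        simp
      · simp [h, h']

theorem tendsto_range_prod :
    Tendsto (fun L => Finset.range L ×ˢ Finset.range L) atTop (atTop : Filter (Finset (ℕ × ℕ))) := by
  refine tendsto_atTop_finset_of_monotone (fun a b h => ?_) (fun x => ⟨x.1 + x.2 + 1, ?_⟩)
  · exact Finset.product_subset_product (Finset.range_mono h) (Finset.range_mono h)
  · simp only [Finset.mem_product, Finset.mem_range]; omega

/-- The mixed second difference. -/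
def mixedDiff (a : ℕ → ℕ → ℂ) (i j : ℕ) : ℂ := a i j - a (i + 1) j - (a i (j + 1) - a (i + 1) (j + 1))

/-- Abel summation in both variables. The indicators are the values at the frequency `(p + 1, q +
1)` of the symbols of the partial sum projections, and the terms with index `L` are boundary terms
that later tend to zero. -/
theorem sum_mixedDiff (a : ℕ → ℕ → ℂ) {p q L : ℕ} (hp : p ≤ L) (hq : q ≤ L) :
    ∑ x ∈ Finset.range L ×ˢ Finset.range L,
      mixedDiff a x.1 x.2 * ((if p ≤ x.1 then 1 else 0) * (if q ≤ x.2 then 1 else 0))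
      = a p q - a L q - (a p L - a L L) := by
  rw [Finset.sum_product]
  have h1 : ∀ i, ∑ j ∈ Finset.range L,
      mixedDiff a i j * ((if p ≤ i then 1 else 0) * (if q ≤ j then 1 else 0))
      = if p ≤ i then (a i q - a i L) - (a (i + 1) q - a (i + 1) L) else 0 := by
    intro i
    split_ifs with h
    · have := sum_range_ite_sub (fun j => a i j - a (i + 1) j) q L
      rw [if_pos hq] at this
      rw [show a i q - a i L - (a (i + 1) q - a (i + 1) L)
        = a i q - a (i + 1) q - (a i L - a (i + 1) L) by ring, ← this]
      refine Finset.sum_congr rfl fun j _ => ?_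
      split_ifs <;> simp [mixedDiff]
    · simp
  simp only [h1]
  rw [sum_range_ite_sub (fun i => a i q - a i L) p L, if_pos hp]
  ring

theorem tendsto_rpow_prod {δ : ℝ} (hδ : 0 < δ) {x : ℕ → ℕ} {y : ℕ → ℕ}
    (hx : Tendsto (fun L => (x L + 1) * (y L + 1)) atTop atTop) :
    Tendsto (fun L => (((x L : ℝ) + 1) * (y L + 1)) ^ (-δ)) atTop (𝓝 0) := by
  refine (tendsto_rpow_neg_atTop hδ).comp ?_
  have := (tendsto_natCast_atTop_atTop (R := ℝ)).comp hx
  refine this.congr fun L => ?_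
  simp

theorem summable_rpow_prod {δ : ℝ} (hδ : 0 < δ) :
    Summable fun x : ℕ × ℕ => (((x.1 : ℝ) + 1) * (x.2 + 1)) ^ (-1 - δ) := by
  have h : Summable fun i : ℕ => ((i : ℝ) + 1) ^ (-1 - δ) := by
    have := (summable_nat_add_iff 1).2 (Real.summable_nat_rpow (p := -1 - δ) |>.2 (by linarith))
    simpa using this
  have := h.mul_of_nonneg h (fun i => by positivity) (fun i => by positivity)
  refine this.congr fun x => ?_
  rw [Real.mul_rpow (by positivity) (by positivity)]

/-- A bounded multiplier whose mixed differences decay slightly faster than `1 / |mn|`, on one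
quadrant of the frequency plane. -/
theorem exists_quadrant_mult {σ τ : ℤ} (hσ : σ = 1 ∨ σ = -1) (hτ : τ = 1 ∨ τ = -1)
    (a : ℕ → ℕ → ℂ) {δ C : ℝ} (hδ : 0 < δ) (hδ1 : δ < 1) (K : ℕ)
    (ha : ∀ i j, K ≤ i ∨ K ≤ j → ‖a i j‖ ≤ C * (((i : ℝ) + 1) * (j + 1)) ^ (-δ))
    (hd : ∀ i j, K ≤ i ∨ K ≤ j →
      ‖mixedDiff a i j‖ ≤ C * (((i : ℝ) + 1) * (j + 1)) ^ (-1 - δ)) :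
    ∃ U : CT →L[ℂ] CT, (∀ n g, coeff n (U g) = (if 0 < σ * n 0 ∧ 0 < τ * n 1 then
        a (σ * n 0 - 1).toNat (τ * n 1 - 1).toNat else 0) * coeff n g) ∧
      ∀ ε : ℝ, 0 < ε → ∃ M : ℕ, ∀ g, (∀ n : Fin 2 → ℤ, |n 0| ≤ M ∧ |n 1| ≤ M → coeff n g = 0) →
        ‖U g‖ ≤ ε * ‖g‖ := by
  -- The projections cost the power `δ / 2` while the mixed differences gain `1 + δ`; the net
  -- exponent `-1 - δ / 2` is summable.
  obtain ⟨B, hB, hP⟩ := norm_partialProj_le (ε := δ / 2) (by linarith) (by linarith)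
  set Q : ℕ × ℕ → CT →L[ℂ] CT := fun x => (partialProj 0 σ x.1).comp (partialProj 1 τ x.2) with hQ
  set w : ℕ × ℕ → ℝ := fun x => B * B * (((x.1 : ℝ) + 1) * (x.2 + 1)) ^ (δ / 2) with hw
  have hQw : ∀ x g, ‖Q x g‖ ≤ w x * ‖g‖ := by
    intro x g
    refine (hP 0 σ hσ x.1 _).trans ?_
    have h1 := hP 1 τ hτ x.2 g
    have h2 : 0 ≤ B * ((x.1 : ℝ) + 1) ^ (δ / 2) := by positivity
    refine (mul_le_mul_of_nonneg_left h1 h2).trans_eq ?_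
    rw [hw]
    simp only
    rw [Real.mul_rpow (by positivity) (by positivity)]
    ring
  have hsum : Summable fun x : ℕ × ℕ => ‖mixedDiff a x.1 x.2‖ * w x := by
    refine Summable.of_norm_bounded_eventually
      ((summable_rpow_prod (half_pos hδ)).mul_left (C * (B * B))) ?_
    -- The bounds may fail only on the finite square `i, j < K`, which does not affect summability.
    have hfin : {x : ℕ × ℕ | ¬ (K ≤ x.1 ∨ K ≤ x.2)}.Finite := by
      refine (Finset.range K ×ˢ Finset.range K).finite_toSet.subset fun x hx => ?_
      simp only [Set.mem_ofPred_eq, not_or, not_le] at hx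
      simpa using hx
    refine hfin.subset fun x hx => ?_
    intro hx'
    apply hx
    have h0 : (0 : ℝ) < ((x.1 : ℝ) + 1) * (x.2 + 1) := by positivity
    simp only [Set.mem_ofPred_eq, norm_mul, norm_norm]
    rw [Real.norm_of_nonneg (by positivity : 0 ≤ w x)]
    refine (mul_le_mul_of_nonneg_right (hd x.1 x.2 hx') (by positivity)).trans_eq ?_
    rw [hw]
    simp only
    rw [show -1 - δ / 2 = (-1 - δ) + δ / 2 by ring, Real.rpow_add h0]
    ring
  obtain ⟨U, hU, hsmall⟩ := exists_hasSum_clm Q (fun x => mixedDiff a x.1 x.2) w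
    (fun x => by positivity) hQw hsum
  have hQc : ∀ x n g, coeff n (Q x g) = ((if 0 < σ * n 0 ∧ σ * n 0 ≤ x.1 + 1 then 1 else 0)
      * (if 0 < τ * n 1 ∧ τ * n 1 ≤ x.2 + 1 then 1 else 0)) * coeff n g := fun x n g =>
    ((isMult_partialProj 0 hσ x.1).comp (isMult_partialProj 1 hτ x.2)).coeff n g
  refine ⟨U, fun n g => ?_, fun ε hε => ?_⟩
  · have h1 := ((hU g).mapL (coeff n)).comp tendsto_range_prod
    simp only [Function.comp_def, map_smul, hQc, smul_eq_mul] at h1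
    refine tendsto_nhds_unique h1 ?_
    by_cases hn : 0 < σ * n 0 ∧ 0 < τ * n 1
    · rw [if_pos hn]
      obtain ⟨p, hp⟩ : ∃ p : ℕ, σ * n 0 = p + 1 := ⟨(σ * n 0 - 1).toNat, by omega⟩
      obtain ⟨q, hq⟩ : ∃ q : ℕ, τ * n 1 = q + 1 := ⟨(τ * n 1 - 1).toNat, by omega⟩
      rw [hp, hq]
      simp only [add_sub_cancel_right, Int.toNat_natCast]
      -- Decay of `a` along any sequence leaving all finite squares, applied to the three boundary
      -- terms of the Abel summation.
      have hz : ∀ x y : ℕ → ℕ, Tendsto (fun L => (x L + 1) * (y L + 1)) atTop atTop →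
          (∀ L, K ≤ L → K ≤ x L ∨ K ≤ y L) →
          Tendsto (fun L => a (x L) (y L)) atTop (𝓝 0) := fun x y hxy hK => by
        have := (tendsto_rpow_prod hδ hxy).const_mul C
        rw [mul_zero] at this
        refine squeeze_zero_norm' ?_ this
        filter_upwards [eventually_ge_atTop K] with L hL using ha _ _ (hK L hL)
      have t1 := hz id (fun _ => q) (tendsto_atTop_mono (fun L => by simp; nlinarith) tendsto_id)
        (fun L hL => Or.inl hL)
      have t2 := hz (fun _ => p) id (tendsto_atTop_mono (fun L => by simp; nlinarith) tendsto_id)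
        (fun L hL => Or.inr hL)
      have t3 := hz id id (tendsto_atTop_mono (fun L => by simp; nlinarith) tendsto_id)
        (fun L hL => Or.inr hL)
      have t4 : Tendsto (fun L => (a p q - a L q - (a p L - a L L)) * coeff n g) atTop
          (𝓝 ((a p q - 0 - (0 - 0)) * coeff n g)) :=
        ((tendsto_const_nhds.sub t1).sub (t2.sub t3)).mul_const _
      rw [show a p q - 0 - (0 - 0) = a p q by ring] at t4
      refine t4.congr' ?_
      filter_upwards [eventually_ge_atTop p, eventually_ge_atTop q] with L hpL hqL
      rw [← sum_mixedDiff a hpL hqL, Finset.sum_mul]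
      refine Finset.sum_congr rfl fun x _ => ?_
      rw [mul_assoc]
      congr 3
      · congr 1; rw [eq_iff_iff]; omega
      · congr 1; rw [eq_iff_iff]; omega
    · rw [if_neg hn, zero_mul]
      refine tendsto_const_nhds.congr fun L => ?_
      rw [Finset.sum_eq_zero]
      intro x _
      rcases not_and_or.1 hn with h | h <;> simp [h]
  · obtain ⟨F, hF⟩ := hsmall ε hε
    -- This `M` exceeds every frequency passed by a projection with index in `F`, so these
    -- projections annihilate `g`.
    refine ⟨∑ x ∈ F, (x.1 + x.2 + 2), fun g hg => hF g fun x hx => eq_of_coeff_eq fun n => ?_⟩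
    have hM : x.1 + x.2 + 2 ≤ ∑ x ∈ F, (x.1 + x.2 + 2) :=
      Finset.single_le_sum (f := fun x : ℕ × ℕ => x.1 + x.2 + 2) (fun _ _ => Nat.zero_le _) hx
    rw [hQc, map_zero]
    by_cases h0 : 0 < σ * n 0 ∧ σ * n 0 ≤ x.1 + 1
    · by_cases h1 : 0 < τ * n 1 ∧ τ * n 1 ≤ x.2 + 1
      · rw [hg n, mul_zero]
        constructor
        · rw [abs_le]; rcases hσ with rfl | rfl <;> constructor <;> omega
        · rw [abs_le]; rcases hτ with rfl | rfl <;> constructor <;> omega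
      · simp [h1]
    · simp [h0]

/-- The multiplier with symbol `b (σ n_j - 1)` on the half plane `σ n_j > 0`. -/
theorem exists_halfplane_mult (j : Fin 2) {σ : ℤ} (hσ : σ = 1 ∨ σ = -1) (b : ℕ → ℂ)
    (hb : Tendsto b atTop (𝓝 0)) (hd : ∀ i, ‖b i - b (i + 1)‖ ≤ ((i : ℝ) + 1) ^ (-2 : ℝ)) :
    ∃ U : CT →L[ℂ] CT, (∀ n g, coeff n (U g)
        = (if 0 < σ * n j then b (σ * n j - 1).toNat else 0) * coeff n g) ∧
      ∀ ε : ℝ, 0 < ε → ∃ M : ℕ, ∀ g, (∀ n : Fin 2 → ℤ, |n j| ≤ M → coeff n g = 0) → ‖U g‖ ≤ ε * ‖g‖ := by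
  obtain ⟨B, hB, hP⟩ := norm_partialProj_le (ε := 1 / 2) (by norm_num) (by norm_num)
  have hsum : Summable fun i : ℕ => ‖b i - b (i + 1)‖ * (B * ((i : ℝ) + 1) ^ (1 / 2 : ℝ)) := by
    have h : Summable fun i : ℕ => ((i : ℝ) + 1) ^ (-3 / 2 : ℝ) := by
      have := (summable_nat_add_iff 1).2
        (Real.summable_nat_rpow (p := -3 / 2) |>.2 (by norm_num))
      simpa using this
    refine Summable.of_nonneg_of_le (fun i => by positivity) (fun i => ?_) (h.mul_left B)
    refine (mul_le_mul_of_nonneg_right (hd i) (by positivity)).trans_eq ?_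
    rw [show (-3 / 2 : ℝ) = -2 + 1 / 2 by norm_num, Real.rpow_add (by positivity)]
    ring
  obtain ⟨U, hU, hsmall⟩ := exists_hasSum_clm (fun i => partialProj j σ i)
    (fun i => b i - b (i + 1)) _ (fun i => by positivity) (fun i g => hP j σ hσ i g) hsum
  have hQc : ∀ i n g, coeff n (partialProj j σ i g)
      = (if 0 < σ * n j ∧ σ * n j ≤ i + 1 then 1 else 0) * coeff n g := fun i n g =>
    (isMult_partialProj j hσ i).coeff n g
  refine ⟨U, fun n g => ?_, fun ε hε => ?_⟩
  · have h1 := ((hU g).mapL (coeff n)).tendsto_sum_nat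
    simp only [map_smul, hQc, smul_eq_mul] at h1
    refine tendsto_nhds_unique h1 ?_
    by_cases hn : 0 < σ * n j
    · rw [if_pos hn]
      obtain ⟨p, hp⟩ : ∃ p : ℕ, σ * n j = p + 1 := ⟨(σ * n j - 1).toNat, by omega⟩
      rw [hp]
      simp only [add_sub_cancel_right, Int.toNat_natCast]
      have t4 : Tendsto (fun L => (b p - b L) * coeff n g) atTop (𝓝 ((b p - 0) * coeff n g)) :=
        (tendsto_const_nhds.sub hb).mul_const _
      rw [sub_zero] at t4
      refine t4.congr' ?_
      filter_upwards [eventually_ge_atTop p] with L hpL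
      have := sum_range_ite_sub b p L
      rw [if_pos hpL] at this
      rw [← this, Finset.sum_mul]
      refine Finset.sum_congr rfl fun x _ => ?_
      have h5 : (0 < (p : ℤ) + 1 ∧ (p : ℤ) + 1 ≤ x + 1) ↔ p ≤ x := by omega
      simp only [h5]
      split_ifs <;> simp
    · rw [if_neg hn, zero_mul]
      refine tendsto_const_nhds.congr fun L => ?_
      rw [Finset.sum_eq_zero]
      intro x _
      simp [hn]
  · obtain ⟨F, hF⟩ := hsmall ε hε
    refine ⟨∑ x ∈ F, (x + 2), fun g hg => hF g fun x hx => eq_of_coeff_eq fun n => ?_⟩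
    have hM : x + 2 ≤ ∑ x ∈ F, (x + 2) :=
      Finset.single_le_sum (f := fun x : ℕ => x + 2) (fun _ _ => Nat.zero_le _) hx
    rw [hQc, map_zero]
    by_cases h0 : 0 < σ * n j ∧ σ * n j ≤ x + 1
    · rw [hg n, mul_zero]
      rw [abs_le]; rcases hσ with rfl | rfl <;> constructor <;> omega
    · simp [h0]

/-- Integration in one variable: its norm is small on functions with high frequencies. -/
theorem exists_integration (j : Fin 2) : ∃ U : CT →L[ℂ] CT,
    (∀ n g, coeff n (U g) = (2 * Real.pi * Complex.I * n j)⁻¹ * coeff n g) ∧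
      ∀ ε : ℝ, 0 < ε → ∃ M : ℕ, ∀ g, (∀ n : Fin 2 → ℤ, |n j| ≤ M → coeff n g = 0) → ‖U g‖ ≤ ε * ‖g‖ := by
  have key : ∀ σ : ℤ, (σ = 1 ∨ σ = -1) → ∃ U : CT →L[ℂ] CT,
      (∀ n g, coeff n (U g) = (if 0 < σ * n j then
        (2 * Real.pi * Complex.I * n j)⁻¹ else 0) * coeff n g) ∧
      ∀ ε : ℝ, 0 < ε → ∃ M : ℕ, ∀ g, (∀ n : Fin 2 → ℤ, |n j| ≤ M → coeff n g = 0) → ‖U g‖ ≤ ε * ‖g‖ := by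
    intro σ hσ
    have hpi : (1 : ℝ) ≤ 2 * Real.pi := by linarith [Real.pi_gt_three]
    have hs2 : (σ : ℂ) * σ = 1 := by rcases hσ with rfl | rfl <;> norm_num
    have hsn : ‖(σ : ℂ)‖ = 1 := by rcases hσ with rfl | rfl <;> simp
    have hpi2 : ‖(2 * Real.pi * Complex.I : ℂ)‖ = 2 * Real.pi := by
      simp [abs_of_pos Real.pi_pos]
    have h1 : ∀ i : ℕ, ‖((i : ℂ) + 1)‖ = (i : ℝ) + 1 := fun i => by
      rw [show (i : ℂ) + 1 = ((i + 1 : ℕ) : ℂ) by push_cast; ring, Complex.norm_natCast]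
      push_cast; ring
    have htend : Tendsto (fun i : ℕ => (2 * Real.pi * Complex.I * (σ * (i + 1)) : ℂ)⁻¹) atTop (𝓝 0) := by
      rw [tendsto_zero_iff_norm_tendsto_zero]
      simp only [norm_inv, norm_mul _ ((σ : ℂ) * _), hpi2, norm_mul (σ : ℂ), hsn, one_mul, h1]
      refine squeeze_zero (fun i => by positivity) (fun i => ?_)
        tendsto_one_div_add_atTop_nhds_zero_nat
      rw [one_div]
      gcongr
      nlinarith [(Nat.cast_nonneg i : (0 : ℝ) ≤ i)]
    have hdiff : ∀ i : ℕ, ‖(2 * Real.pi * Complex.I * (σ * (i + 1)) : ℂ)⁻¹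
          - (2 * Real.pi * Complex.I * (σ * ((i + 1 : ℕ) + 1)) : ℂ)⁻¹‖ ≤ ((i : ℝ) + 1) ^ (-2 : ℝ) := by
      intro i
      have e : (2 * Real.pi * Complex.I * (σ * (i + 1)) : ℂ)⁻¹
          - (2 * Real.pi * Complex.I * (σ * ((i + 1 : ℕ) + 1)))⁻¹
          = (2 * Real.pi * Complex.I * (σ * ((i + 1) * ((i + 1 : ℕ) + 1))))⁻¹ := by
        have a1 : (i : ℂ) + 1 ≠ 0 := by exact_mod_cast Nat.succ_ne_zero i
        have a2 : ((i + 1 : ℕ) : ℂ) + 1 ≠ 0 := by exact_mod_cast Nat.succ_ne_zero (i + 1)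
        have a3 : (σ : ℂ) ≠ 0 := left_ne_zero_of_mul_eq_one hs2
        have a4 : (Real.pi : ℂ) ≠ 0 := by exact_mod_cast Real.pi_ne_zero
        field_simp
        push_cast
        ring
      rw [e, norm_inv, norm_mul, hpi2, norm_mul, hsn, norm_mul, h1, h1, Real.rpow_neg (by positivity),
        Real.rpow_two]
      gcongr
      push_cast
      nlinarith [(Nat.cast_nonneg i : (0 : ℝ) ≤ i)]
    obtain ⟨U, hU, hU'⟩ := exists_halfplane_mult j hσ _ htend hdiff
    refine ⟨U, fun n g => ?_, hU'⟩
    rw [hU]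
    congr 1
    split_ifs with h
    · have h3 : ((σ * n j - 1).toNat : ℤ) = σ * n j - 1 := by omega
      have h4 : (((σ * n j - 1).toNat : ℕ) : ℂ) = σ * n j - 1 := by exact_mod_cast h3
      rw [h4, sub_add_cancel, ← mul_assoc (σ : ℂ), hs2, one_mul]
    · rfl
  obtain ⟨U, hU, hU'⟩ := key 1 (Or.inl rfl)
  obtain ⟨V, hV, hV'⟩ := key (-1) (Or.inr rfl)
  refine ⟨U + V, fun n g => ?_, fun ε hε => ?_⟩
  · rw [_root_.add_apply, map_add, hU, hV, ← add_mul]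
    congr 1
    rcases lt_trichotomy (n j) 0 with h | h | h
    · rw [if_neg (by omega), if_pos (by omega), zero_add]
    -- On the line `n j = 0` both half-plane multipliers vanish, in accordance with the convention
    -- `0⁻¹ = 0`.
    · simp [h]
    · rw [if_pos (by omega), if_neg (by omega), add_zero]
  · obtain ⟨M, hM⟩ := hU' (ε / 2) (half_pos hε)
    obtain ⟨M', hM'⟩ := hV' (ε / 2) (half_pos hε)
    refine ⟨max M M', fun g hg => ?_⟩
    have h1 := hM g fun n hn => hg n (hn.trans (by exact_mod_cast le_max_left _ _))
    have h2 := hM' g fun n hn => hg n (hn.trans (by exact_mod_cast le_max_right _ _))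
    rw [_root_.add_apply]
    refine (norm_add_le _ _).trans ?_
    linarith

/-- Iterated integration in one variable. -/
theorem exists_integration_pow (j : Fin 2) (c : ℕ) : ∃ U : CT →L[ℂ] CT,
    (∀ n g, coeff n (U g) = ((2 * Real.pi * Complex.I * n j) ^ (c + 1))⁻¹ * coeff n g) ∧
      ∀ ε : ℝ, 0 < ε → ∃ M : ℕ, ∀ g, (∀ n : Fin 2 → ℤ, |n j| ≤ M → coeff n g = 0) → ‖U g‖ ≤ ε * ‖g‖ := by
  obtain ⟨U, hU, hU'⟩ := exists_integration j
  -- The powers start at one: the zeroth power is the identity, which has no smallness. In the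
  -- induction only one factor needs to be small; the other is bounded by the constant `1`.
  induction c with
  | zero => exact ⟨U, fun n g => by rw [hU, zero_add, pow_one], hU'⟩
  | succ c ih =>
    obtain ⟨V, hV, hV'⟩ := ih
    refine ⟨V.comp U, fun n g => ?_, fun ε hε => ?_⟩
    · rw [ContinuousLinearMap.comp_apply, hV, hU, ← mul_assoc, ← mul_inv, ← pow_succ]
    · obtain ⟨M, hM⟩ := hU' ε hε
      obtain ⟨M', hM'⟩ := hV' 1 one_pos
      refine ⟨max M M', fun g hg => ?_⟩
      have h1 := hM g fun n hn => hg n (hn.trans (by exact_mod_cast le_max_left _ _))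
      have h2 := hM' (U g) fun n hn => by
        rw [hU, hg n (hn.trans (by exact_mod_cast le_max_right _ _)), mul_zero]
      rw [ContinuousLinearMap.comp_apply]
      linarith

/-! ### Geometry of the core -/

section Geometry

variable {l : ℕ} {T : Fin l → DiffOp}

theorem finite_points (T : Fin l → DiffOp) : (points T).Finite := by
  have : points T = ⋃ j, toPoint '' ((T j).support : Set (Fin 2 →₀ ℕ)) := by
    ext p; simp [points]
  rw [this]
  exact Set.finite_iUnion fun j => (Finset.finite_toSet _).image _

theorem points_nonneg {p : ℝ × ℝ} (hp : p ∈ points T) : 0 ≤ p.1 ∧ 0 ≤ p.2 := by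
  obtain ⟨j, α, _, rfl⟩ := hp
  exact ⟨Nat.cast_nonneg _, Nat.cast_nonneg _⟩

theorem toPoint_injective : Function.Injective toPoint := by
  intro α β h
  rw [toPoint, toPoint, Prod.mk.injEq, Nat.cast_inj, Nat.cast_inj] at h
  ext i
  fin_cases i
  · exact h.1
  · exact h.2

theorem le_of_mem_convexHull {S : Set (ℝ × ℝ)} {s t c : ℝ} (h : ∀ p ∈ S, s * p.1 + t * p.2 ≤ c)
    {p : ℝ × ℝ} (hp : p ∈ convexHull ℝ S) : s * p.1 + t * p.2 ≤ c := by
  have hc : Convex ℝ {p : ℝ × ℝ | s * p.1 + t * p.2 ≤ c} := by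
    intro x hx y hy a b ha hb hab
    simp only [Set.mem_ofPred_eq, Prod.fst_add, Prod.smul_fst, smul_eq_mul, Prod.snd_add,
      Prod.smul_snd] at *
    have h1 := mul_le_mul_of_nonneg_left hx ha
    have h2 := mul_le_mul_of_nonneg_left hy hb
    calc _ = a * (s * x.1 + t * x.2) + b * (s * y.1 + t * y.2) := by ring
      _ ≤ a * c + b * c := by linarith
      _ = c := by rw [← add_mul, hab, one_mul]
  exact convexHull_min (s := S) h hc hp

theorem exists_ge_of_mem_convexHull {S : Set (ℝ × ℝ)} (hS : S.Finite) {p : ℝ × ℝ}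
    (hp : p ∈ convexHull ℝ S) (s t : ℝ) :
    ∃ q ∈ S, s * p.1 + t * p.2 ≤ s * q.1 + t * q.2 := by
  have hne : S.Nonempty := convexHull_nonempty_iff.1 ⟨p, hp⟩
  obtain ⟨q, hq, hmax⟩ := Set.exists_max_image S (fun q => s * q.1 + t * q.2) hS hne
  exact ⟨q, hq, le_of_mem_convexHull hmax hp⟩

theorem div_eq_inv_mul_add (a b : ℝ) (p : ℝ × ℝ) : p.1 / a + p.2 / b = a⁻¹ * p.1 + b⁻¹ * p.2 := by
  rw [div_eq_inv_mul, div_eq_inv_mul]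

theorem mem_core_of_mem_line {a b : ℝ} (h : IsAdmissible T a b) {p : ℝ × ℝ} (hp : p ∈ points T)
    (hl : p ∈ line a b) : p ∈ core T := ⟨a, b, h, subset_convexHull ℝ _ ⟨hp, hl⟩⟩

theorem core_le {a b : ℝ} (h : IsAdmissible T a b) {p : ℝ × ℝ} (hp : p ∈ core T) :
    p.1 / a + p.2 / b ≤ 1 := by
  obtain ⟨a', b', _, hp⟩ := hp
  rw [div_eq_inv_mul_add]
  refine le_of_mem_convexHull (fun q hq => ?_) hp
  rw [← div_eq_inv_mul_add]
  exact h.2.2.1 q hq.1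

theorem exists_line_of_mem_core {p : ℝ × ℝ} (hp : p ∈ core T) :
    ∃ a b, IsAdmissible T a b ∧ p ∈ line a b := by
  obtain ⟨a, b, h, hp⟩ := hp
  refine ⟨a, b, h, ?_⟩
  have h1 : p.1 / a + p.2 / b ≤ 1 := core_le h ⟨a, b, h, hp⟩
  have h2 : (-a⁻¹) * p.1 + (-b⁻¹) * p.2 ≤ -1 := by
    refine le_of_mem_convexHull (fun q hq => ?_) hp
    have : q.1 / a + q.2 / b = 1 := hq.2
    rw [div_eq_inv_mul_add] at this
    linarith
  have h3 := div_eq_inv_mul_add a b p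
  show p.1 / a + p.2 / b = 1
  linarith

theorem core_subset_convexHull : core T ⊆ convexHull ℝ (points T ∩ core T) := by
  rintro p ⟨a, b, h, hp⟩
  exact convexHull_mono (s := points T ∩ line a b) (t := points T ∩ core T)
    (fun q hq => ⟨hq.1, mem_core_of_mem_line h hq.1 hq.2⟩) hp

/-- The core is an antichain. An admissible line through `z` has positive coefficients and no core
point above it, so a core point dominating `z` must coincide with `z`. -/
theorem core_lt_of_lt {z p : ℝ × ℝ} (hp : p ∈ core T) (h : z ≤ p) (hne : z ≠ p) : z ∉ core T := by
  intro hz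
  obtain ⟨a, b, hab, hl⟩ := exists_line_of_mem_core hz
  have h1 := core_le hab hp
  have h2 : z.1 / a + z.2 / b = 1 := hl
  have e1 : z.1 / a ≤ p.1 / a := div_le_div_of_nonneg_right h.1 hab.1.le
  have e2 : z.2 / b ≤ p.2 / b := div_le_div_of_nonneg_right h.2 hab.2.1.le
  apply hne
  have e3 : z.1 / a = p.1 / a := by linarith
  have e4 : z.2 / b = p.2 / b := by linarith
  exact Prod.ext ((div_left_inj' hab.1.ne').1 e3) ((div_left_inj' hab.2.1.ne').1 e4)

/-- Rotate a supporting line of slope parameter `t` about the origin until it meets a point with `f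
< 0`: the stopping parameter is the largest ratio `g / -f`. It is at most `t`, so the points with `f
≥ 0` stay below the line. -/
theorem exists_rotation {ι : Type*} {S : Set ι} (hS : S.Finite) (f g : ι → ℝ) {t : ℝ}
    (h : ∀ z ∈ S, t * f z + g z ≤ 0) {p : ι} (hp : p ∈ S) (hf : f p < 0) (hg : 0 < g p) :
    ∃ t' : ℝ, 0 < t' ∧ ∃ z ∈ S, f z < 0 ∧ 0 < g z ∧ t' * f z + g z = 0 ∧
      ∀ z' ∈ S, t' * f z' + g z' ≤ 0 := by
  obtain ⟨z, ⟨hz, hfz⟩, hmax⟩ := Set.exists_max_image {z ∈ S | f z < 0} (fun z => g z / -f z)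
    (hS.subset (Set.sep_subset _ _)) ⟨p, hp, hf⟩
  have hpos : 0 < g z / -f z := (div_pos hg (neg_pos.2 hf)).trans_le (hmax p ⟨hp, hf⟩)
  have hgz : 0 < g z := by
    have := mul_pos hpos (neg_pos.2 hfz)
    rwa [div_mul_cancel₀ _ (neg_pos.2 hfz).ne'] at this
  have hle : g z / -f z ≤ t := by
    rw [div_le_iff₀ (neg_pos.2 hfz)]
    linarith [h z hz]
  refine ⟨g z / -f z, hpos, z, hz, hfz, hgz, ?_, fun z' hz' => ?_⟩
  · have := hfz.ne
    field_simp
    ring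
  · rcases lt_or_ge (f z') 0 with h' | h'
    · have := hmax z' ⟨hz', h'⟩
      rw [div_le_iff₀ (neg_pos.2 h')] at this
      linarith
    · have := mul_le_mul_of_nonneg_right hle h'
      linarith [h z' hz']

/-- The supporting line through `q` with normal `(s, t)` has intercepts `C / s` and `C / t`, where
`C = s q₁ + t q₂`. If `C` were zero, both `q` and `z` would be the origin, as the coordinates are
nonnegative. -/
theorem exists_admissible_of_normal {q z : ℝ × ℝ} (hq : q ∈ points T) (hz : z ∈ points T)
    (hne : q ≠ z) {s t : ℝ} (hs : 0 < s) (ht : 0 < t)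
    (hle : ∀ p ∈ points T, s * (p.1 - q.1) + t * (p.2 - q.2) ≤ 0)
    (heq : s * (z.1 - q.1) + t * (z.2 - q.2) = 0) :
    ∃ a b, IsAdmissible T a b ∧ ∀ p, p ∈ line a b ↔ s * (p.1 - q.1) + t * (p.2 - q.2) = 0 := by
  obtain ⟨hq1, hq2⟩ := points_nonneg hq
  obtain ⟨hz1, hz2⟩ := points_nonneg hz
  have hC : 0 < s * q.1 + t * q.2 := by
    have h1 := mul_nonneg hs.le hq1
    have h2 := mul_nonneg ht.le hq2
    have h3 := mul_nonneg hs.le hz1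
    have h4 := mul_nonneg ht.le hz2
    refine lt_of_le_of_ne (add_nonneg h1 h2) fun h0 => hne ?_
    have e1 : s * q.1 = 0 := by linarith
    have e2 : t * q.2 = 0 := by linarith
    have e3 : s * z.1 = 0 := by nlinarith
    have e4 : t * z.2 = 0 := by nlinarith
    simp only [mul_eq_zero, hs.ne', ht.ne', false_or] at e1 e2 e3 e4
    exact Prod.ext (by rw [e1, e3]) (by rw [e2, e4])
  set C := s * q.1 + t * q.2 with hCdef
  have hval : ∀ p : ℝ × ℝ, p.1 / (C / s) + p.2 / (C / t)
      = 1 + (s * (p.1 - q.1) + t * (p.2 - q.2)) / C := by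
    intro p
    field_simp
    rw [hCdef]
    ring
  have hline : ∀ p, p ∈ line (C / s) (C / t) ↔ s * (p.1 - q.1) + t * (p.2 - q.2) = 0 := by
    intro p
    show p.1 / (C / s) + p.2 / (C / t) = 1 ↔ _
    rw [hval]
    constructor
    · intro h
      have : (s * (p.1 - q.1) + t * (p.2 - q.2)) / C = 0 := by linarith
      simpa [hC.ne'] using this
    · intro h
      rw [h]
      simp
  refine ⟨C / s, C / t, ⟨div_pos hC hs, div_pos hC ht, fun p hp => ?_, ?_⟩, hline⟩
  · rw [hval]
    have := div_nonpos_of_nonpos_of_nonneg (hle p hp) hC.le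
    linarith
  · refine ⟨q, ⟨hq, (hline q).2 (by ring)⟩, z, ⟨hz, (hline z).2 heq⟩, hne⟩

theorem admissible_slope {a b : ℝ} (h : IsAdmissible T a b) {q : ℝ × ℝ} (hq : q ∈ line a b)
    {p : ℝ × ℝ} (hp : p ∈ points T) :
    b / a * (p.1 - q.1) + (p.2 - q.2) ≤ 0 ∧ a / b * (p.2 - q.2) + (p.1 - q.1) ≤ 0 := by
  obtain ⟨ha, hb, hle, _⟩ := h
  have h1 := hle p hp
  have h2 : q.1 / a + q.2 / b = 1 := hq
  have h3 : (p.1 - q.1) / a + (p.2 - q.2) / b ≤ 0 := by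
    rw [sub_div, sub_div]; linarith
  constructor
  · have : b / a * (p.1 - q.1) + (p.2 - q.2) = b * ((p.1 - q.1) / a + (p.2 - q.2) / b) := by
      field_simp
    rw [this]
    exact mul_nonpos_of_nonneg_of_nonpos hb.le h3
  · have : a / b * (p.2 - q.2) + (p.1 - q.1) = a * ((p.1 - q.1) / a + (p.2 - q.2) / b) := by
      field_simp
      ring
    rw [this]
    exact mul_nonpos_of_nonneg_of_nonpos ha.le h3

/-- Every point of `points T` is dominated by a point of the core. -/
theorem exists_core_ge (hline : ∃ a b, IsAdmissible T a b) {p : ℝ × ℝ} (hp : p ∈ points T) :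
    ∃ q ∈ core T, p ≤ q := by
  have hfin : (points T ∩ core T).Finite := (finite_points T).subset Set.inter_subset_left
  -- No point lies to the right of the core: otherwise the admissible line at the rightmost vertex
  -- could be rotated about this vertex to another admissible line, which contains a vertex still
  -- further right.
  have hright : ∃ q ∈ points T ∩ core T, p.1 ≤ q.1 := by
    by_contra! hcon
    have hne : (points T ∩ core T).Nonempty := by
      obtain ⟨a, b, hab⟩ := hline
      obtain ⟨z, hz⟩ := hab.2.2.2.nonempty
      exact ⟨z, hz.1, mem_core_of_mem_line hab hz.1 hz.2⟩
    obtain ⟨q, hq, hmax⟩ := Set.exists_max_image _ (fun q : ℝ × ℝ => q.1) hfin hne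
    obtain ⟨a, b, hab, hl⟩ := exists_line_of_mem_core hq.2
    have hslope := fun z hz => (admissible_slope hab hl (p := z) hz).2
    have hpq := hcon q hq
    have h2 : p.2 - q.2 < 0 := by
      have := hslope p hp
      by_contra! h
      have := mul_nonneg (div_pos hab.1 hab.2.1).le h
      linarith
    obtain ⟨t, ht, z, hz, hz2, hz1, heq, hle⟩ := exists_rotation (finite_points T)
      (fun z => z.2 - q.2) (fun z => z.1 - q.1) hslope hp h2 (by linarith)
    obtain ⟨a', b', hab', hl'⟩ := exists_admissible_of_normal hq.1 hz
      (fun h => by rw [h] at hz1; simp at hz1) one_pos ht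
      (fun y hy => by linarith [hle y hy]) (by linarith)
    have := hmax z ⟨hz, mem_core_of_mem_line hab' hz ((hl' z).2 (by linarith))⟩
    linarith
  -- Take the leftmost vertex not to the left of `p`. If `p` is higher than it, rotating about it
  -- yields a link to a vertex `z`; minimality puts `z` to the left of `p`, and the point of this
  -- link vertically above `p` dominates `p`.
  obtain ⟨q, ⟨hq, hpq⟩, hmin⟩ := Set.exists_min_image {q ∈ points T ∩ core T | p.1 ≤ q.1}
    (fun q => q.1) (hfin.subset (Set.sep_subset _ _)) hright
  rcases le_or_gt p.2 q.2 with h | h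
  · exact ⟨q, hq.2, hpq, h⟩
  obtain ⟨a, b, hab, hl⟩ := exists_line_of_mem_core hq.2
  have hslope := fun z hz => (admissible_slope hab hl (p := z) hz).1
  have h1 : p.1 - q.1 < 0 := by
    have := hslope p hp
    by_contra! h
    have := mul_nonneg (div_pos hab.2.1 hab.1).le h
    linarith
  obtain ⟨t, ht, z, hz, hz1, hz2, heq, hle⟩ := exists_rotation (finite_points T)
    (fun z => z.1 - q.1) (fun z => z.2 - q.2) hslope hp h1 (by linarith)
  obtain ⟨a', b', hab', hl'⟩ := exists_admissible_of_normal hq.1 hz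
    (fun h => by rw [h] at hz2; simp at hz2) ht one_pos
    (fun y hy => by linarith [hle y hy]) (by linarith)
  have hzl : z ∈ line a' b' := (hl' z).2 (by linarith)
  have hql : q ∈ line a' b' := (hl' q).2 (by ring)
  have hzp : z.1 < p.1 := by
    by_contra! hc
    have := hmin z ⟨⟨hz, mem_core_of_mem_line hab' hz hzl⟩, hc⟩
    linarith
  have hd : 0 < q.1 - z.1 := by linarith
  set c := (q.1 - p.1) / (q.1 - z.1) with hc
  have hc0 : 0 ≤ c := div_nonneg (by linarith) hd.le
  have hc1 : c ≤ 1 := by rw [hc, div_le_one hd]; linarith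
  have hmem : (1 - c) • q + c • z ∈ core T :=
    ⟨a', b', hab', (convex_convexHull ℝ _) 
      (subset_convexHull ℝ (points T ∩ line a' b') ⟨hq.1, hql⟩)
      (subset_convexHull ℝ (points T ∩ line a' b') ⟨hz, hzl⟩) (by linarith) hc0 (by ring)⟩
  have hcd : c * (q.1 - z.1) = q.1 - p.1 := div_mul_cancel₀ _ hd.ne'
  have e1 : ((1 - c) • q + c • z).1 = p.1 := by
    simp only [Prod.fst_add, Prod.smul_fst, smul_eq_mul]
    linarith
  have e2 : ((1 - c) • q + c • z).2 = q.2 + t * (q.1 - p.1) := by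
    simp only [Prod.snd_add, Prod.smul_snd, smul_eq_mul]
    have : z.2 = q.2 + t * (q.1 - z.1) := by linarith
    rw [this, ← hcd]
    ring
  refine ⟨_, hmem, e1.ge, ?_⟩
  rw [e2]
  linarith [hle p hp]

/-- A strictly subordinate multiindex is dominated strictly in both coordinates by a point of the
convex hull of the core. -/
theorem exists_strict_domination {p : ℝ × ℝ} (hp : p ∉ core T) (h : ∃ q ∈ core T, p ≤ q)
    (h1 : ∃ q ∈ core T, p.1 < q.1) (h2 : ∃ q ∈ core T, p.2 < q.2) :
    ∃ q ∈ convexHull ℝ (points T ∩ core T), p.1 < q.1 ∧ p.2 < q.2 := by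
  -- A point that dominates strictly in one coordinate is moved slightly towards a point that is
  -- strictly larger in the other. The step `(x - s) / (2D)` is short enough to keep the first
  -- strict inequality.
  have key : ∀ s t x y x' y' : ℝ, s < x → t ≤ y → t < y' →
      ∃ c : ℝ, 0 ≤ c ∧ c ≤ 1 ∧ s < (1 - c) * x + c * x' ∧ t < (1 - c) * y + c * y' := by
    intro s t x y x' y' hx hy hy'
    set D := |x - x'| + (x - s) with hD
    have hDpos : 0 < D := by have := abs_nonneg (x - x'); linarith
    refine ⟨(x - s) / (2 * D), by have := sub_pos.2 hx; positivity, ?_, ?_, ?_⟩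
    · rw [div_le_one (by linarith)]
      have := abs_nonneg (x - x'); linarith
    · have h3 : (x - s) / (2 * D) * (x - x') < x - s := by
        rw [div_mul_eq_mul_div, div_lt_iff₀ (by linarith)]
        have := le_abs_self (x - x')
        nlinarith [sub_pos.2 hx]
      linarith
    · have h0 : 0 < (x - s) / (2 * D) := by have := sub_pos.2 hx; positivity
      have h3 : (x - s) / (2 * D) ≤ 1 := by
        rw [div_le_one (by linarith)]
        have := abs_nonneg (x - x'); linarith
      nlinarith
  obtain ⟨q, hq, hpq⟩ := h
  have hq' := core_subset_convexHull hq
  rcases eq_or_lt_of_le hpq.1 with e1 | e1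
  · rcases eq_or_lt_of_le hpq.2 with e2 | e2
    · exact absurd (by rwa [show p = q from Prod.ext e1 e2]) hp
    · obtain ⟨r, hr, hpr⟩ := h1
      obtain ⟨c, hc0, hc1, a2, a1⟩ := key p.2 p.1 q.2 q.1 r.2 r.1 e2 hpq.1 hpr
      exact ⟨(1 - c) • q + c • r, (convex_convexHull ℝ _) hq' (core_subset_convexHull hr)
        (by linarith) hc0 (by ring), a1, a2⟩
  · obtain ⟨r, hr, hpr⟩ := h2
    obtain ⟨c, hc0, hc1, a1, a2⟩ := key p.1 p.2 q.1 q.2 r.1 r.2 e1 hpq.2 hpr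
    exact ⟨(1 - c) • q + c • r, (convex_convexHull ℝ _) hq' (core_subset_convexHull hr)
      (by linarith) hc0 (by ring), a1, a2⟩

/-- Power gain of the core over a strictly subordinate monomial. -/
theorem exists_power_gain {p : ℝ × ℝ} (hp : p ∉ core T) (h : ∃ q ∈ core T, p ≤ q)
    (h1 : ∃ q ∈ core T, p.1 < q.1) (h2 : ∃ q ∈ core T, p.2 < q.2) :
    ∃ δ : ℝ, 0 < δ ∧ ∀ x y : ℝ, 1 ≤ x → 1 ≤ y → ∃ q ∈ points T ∩ core T,
      x ^ p.1 * y ^ p.2 * (x * y) ^ δ ≤ x ^ q.1 * y ^ q.2 := by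
  obtain ⟨q, hq, e1, e2⟩ := exists_strict_domination hp h h1 h2
  -- In logarithmic coordinates a monomial is a linear functional of its exponent. Its value at the
  -- hull point `q` is at most its value at some multiindex of the core.
  refine ⟨min (q.1 - p.1) (q.2 - p.2), lt_min (by linarith) (by linarith), fun x y hx hy => ?_⟩
  obtain ⟨r, hr, hle⟩ := exists_ge_of_mem_convexHull
    ((finite_points T).subset Set.inter_subset_left) hq (Real.log x) (Real.log y)
  have hx0 : 0 < x := by linarith
  have hy0 : 0 < y := by linarith
  refine ⟨r, hr, ?_⟩
  rw [Real.mul_rpow hx0.le hy0.le]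
  simp only [Real.rpow_def_of_pos hx0, Real.rpow_def_of_pos hy0, ← Real.exp_add]
  refine Real.exp_le_exp.2 (le_trans ?_ hle)
  have lx := Real.log_nonneg hx
  have ly := Real.log_nonneg hy
  have m1 := mul_le_mul_of_nonneg_left (min_le_left (q.1 - p.1) (q.2 - p.2)) lx
  have m2 := mul_le_mul_of_nonneg_left (min_le_right (q.1 - p.1) (q.2 - p.2)) ly
  linarith

end Geometry

/-! ### Parts of operators and their characteristic polynomials -/

section Operators

variable {l : ℕ} {T : Fin l → DiffOp}

/-- The characteristic polynomial of a monomial. -/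
def charMon (α : Fin 2 →₀ ℕ) (x y : ℝ) : ℂ :=
  (2 * Real.pi * Complex.I * x) ^ α 0 * (2 * Real.pi * Complex.I * y) ^ α 1

theorem charPoly_eq_sum (S : DiffOp) (x y : ℝ) :
    S.charPoly x y = ∑ α ∈ S.support, S.coeff α * charMon α x y := by
  rw [DiffOp.charPoly, MvPolynomial.eval_eq']
  simp [charMon, Fin.prod_univ_two]

theorem charPoly_add (S S' : DiffOp) (x y : ℝ) :
    (S + S').charPoly x y = S.charPoly x y + S'.charPoly x y := map_add _ _ _

theorem charPoly_smul (c : ℂ) (S : DiffOp) (x y : ℝ) :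
    (c • S).charPoly x y = c * S.charPoly x y := by
  rw [DiffOp.charPoly, MvPolynomial.smul_eval, DiffOp.charPoly]

theorem charPoly_monomial (α : Fin 2 →₀ ℕ) (c : ℂ) (x y : ℝ) :
    DiffOp.charPoly (MvPolynomial.monomial α c) x y = c * charMon α x y := by
  rw [DiffOp.charPoly, MvPolynomial.eval_monomial]
  simp [charMon, Finsupp.prod_fintype, Fin.prod_univ_two]

open Classical in
theorem coeff_part (S : DiffOp) (p : (Fin 2 →₀ ℕ) → Prop) (α : Fin 2 →₀ ℕ) :
    (S.part p).coeff α = if p α then S.coeff α else 0 := by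
  rw [DiffOp.part, MvPolynomial.coeff_sum]
  simp only [MvPolynomial.coeff_monomial, Finset.sum_ite_eq', Finset.mem_filter,
    MvPolynomial.mem_support_iff]
  by_cases h : p α <;> by_cases h' : S.coeff α = 0 <;> simp [h, h']

theorem mem_support_part {S : DiffOp} {p : (Fin 2 →₀ ℕ) → Prop} {α : Fin 2 →₀ ℕ} :
    α ∈ (S.part p).support ↔ α ∈ S.support ∧ p α := by
  classical
  rw [MvPolynomial.mem_support_iff, MvPolynomial.mem_support_iff, coeff_part]
  by_cases h : p α <;> simp [h]

theorem part_add_part_not (S : DiffOp) (p : (Fin 2 →₀ ℕ) → Prop) :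
    S.part p + S.part (fun α => ¬ p α) = S := by
  classical
  ext α
  rw [MvPolynomial.coeff_add, coeff_part, coeff_part]
  by_cases h : p α <;> simp [h]

theorem coeff_eq_zero_of_mem_span {A : Fin l → DiffOp} {α : Fin 2 →₀ ℕ}
    (h : ∀ j, (A j).coeff α = 0) {S : DiffOp} (hS : S ∈ Submodule.span ℂ (Set.range A)) :
    S.coeff α = 0 := by
  have : Submodule.span ℂ (Set.range A) ≤ LinearMap.ker (MvPolynomial.lcoeff ℂ α) := by
    rw [Submodule.span_le]
    rintro _ ⟨j, rfl⟩
    exact h j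
  exact this hS

theorem toPoint_mem_points {α : Fin 2 →₀ ℕ} :
    toPoint α ∈ points T ↔ ∃ j, α ∈ (T j).support := by
  constructor
  · rintro ⟨j, β, hβ, h⟩
    exact ⟨j, by rwa [← toPoint_injective h]⟩
  · rintro ⟨j, hj⟩
    exact ⟨j, α, hj, rfl⟩

theorem support_subset_points {T' : Fin l → DiffOp}
    (hspan : Submodule.span ℂ (Set.range T') = Submodule.span ℂ (Set.range T)) {j : Fin l}
    {α : Fin 2 →₀ ℕ} (hα : α ∈ (T' j).support) : toPoint α ∈ points T := by
  by_contra h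
  rw [toPoint_mem_points] at h
  simp only [MvPolynomial.mem_support_iff, not_exists, not_not] at h hα
  exact hα (coeff_eq_zero_of_mem_span h (hspan ▸ Submodule.subset_span ⟨j, rfl⟩))

/-- This is where normalization enters. If a core monomial were absent from `T' j₀`, it would be
absent from every `T' j`, hence from their span and from every `T i`. -/
theorem mem_support_principalPart_iff {T' : Fin l → DiffOp} {j₀ : Fin l}
    (hspan : Submodule.span ℂ (Set.range T') = Submodule.span ℂ (Set.range T))
    (hnorm : ∀ j, j ≠ j₀ → principalPart T (T' j) = 0) (α : Fin 2 →₀ ℕ) :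
    α ∈ (principalPart T (T' j₀)).support ↔ toPoint α ∈ points T ∩ core T := by
  classical
  rw [principalPart, mem_support_part]
  refine ⟨fun h => ⟨support_subset_points hspan h.1, h.2⟩, fun h => ⟨?_, h.2⟩⟩
  by_contra h0
  rw [MvPolynomial.mem_support_iff, not_not] at h0
  have hall : ∀ j, (T' j).coeff α = 0 := by
    intro j
    by_cases hj : j = j₀
    · rw [hj, h0]
    · have := congrArg (MvPolynomial.coeff α) (hnorm j hj)
      rwa [principalPart, coeff_part, if_pos h.2, MvPolynomial.coeff_zero] at this
  obtain ⟨i, hi⟩ := toPoint_mem_points.1 h.1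
  rw [MvPolynomial.mem_support_iff] at hi
  exact hi (coeff_eq_zero_of_mem_span hall (hspan ▸ Submodule.subset_span ⟨i, rfl⟩))

/-- Multiindices of `points T` on an admissible line belong to the core, so ellipticity of an
operator passes to its principal part. -/
theorem seniorPart_principalPart {S : DiffOp} (hS : ∀ α ∈ S.support, toPoint α ∈ points T)
    {a b : ℝ} (h : IsAdmissible T a b) :
    seniorPart a b (principalPart T S) = seniorPart a b S := by
  classical
  ext α
  rw [seniorPart, seniorPart, principalPart, coeff_part, coeff_part, coeff_part]
  by_cases h1 : toPoint α ∈ line a b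
  · by_cases h2 : α ∈ S.support
    · simp [h1, mem_core_of_mem_line h (hS α h2) h1]
    · rw [MvPolynomial.notMem_support_iff] at h2
      simp [h2]
  · simp [h1]

/-! ### The lower bound for an elliptic principal part -/

theorem charMon_sign (α : Fin 2 →₀ ℕ) (sx sy x y : ℝ) :
    charMon α (sx * x) (sy * y)
      = charMon α sx sy * ((x ^ α 0 * y ^ α 1 : ℝ) : ℂ) := by
  simp only [charMon]
  push_cast
  rw [← mul_assoc _ (sx : ℂ), ← mul_assoc _ (sy : ℂ), mul_pow _ (x : ℂ), mul_pow _ (y : ℂ)]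
  ring

theorem exists_sign_mul_exp {x : ℝ} (hx : 1 ≤ |x|) :
    ∃ s u : ℝ, (s = 1 ∨ s = -1) ∧ 0 ≤ u ∧ x = s * Real.exp u ∧ |x| = Real.exp u := by
  have h0 : 0 < |x| := by linarith
  rcases le_total 0 x with h | h
  · refine ⟨1, Real.log |x|, Or.inl rfl, Real.log_nonneg hx, ?_, (Real.exp_log h0).symm⟩
    rw [Real.exp_log h0, abs_of_nonneg h, one_mul]
  · refine ⟨-1, Real.log |x|, Or.inr rfl, Real.log_nonneg hx, ?_, (Real.exp_log h0).symm⟩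
    rw [Real.exp_log h0, abs_of_nonpos h]
    ring

theorem exp_pow_mul_exp_pow (u v : ℝ) (α : Fin 2 →₀ ℕ) :
    Real.exp u ^ α 0 * Real.exp v ^ α 1 = Real.exp (α 0 * u + α 1 * v) := by
  rw [Real.exp_add, Real.exp_nat_mul, Real.exp_nat_mul]

theorem not_le_of_core {p q : ℝ × ℝ} (hp : p ∈ core T) (hq : q ∈ core T) (hne : p ≠ q) :
    ¬ p ≤ q := fun h => core_lt_of_lt hq h hne hp

/-- Along an ultrafilter, if two monomials of the core are comparable, then the limits of the ratios
of the core monomials are governed by an admissible line. -/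
theorem exists_line_of_tendsto (hline : ∃ a b, IsAdmissible T a b) {𝒰 : Filter ℕ} [𝒰.NeBot]
    {u v : ℕ → ℝ} (huv : Tendsto (fun k => u k + v k) 𝒰 atTop) {q q' : ℝ × ℝ}
    (hq : q ∈ points T ∩ core T) (hq' : q' ∈ points T ∩ core T) (hne : q ≠ q')
    (hmax : ∀ p ∈ points T ∩ core T,
      ∀ᶠ k in 𝒰, (p.1 - q.1) * u k + (p.2 - q.2) * v k ≤ 0)
    {m : ℝ} (hm : Tendsto (fun k => (q'.1 - q.1) * u k + (q'.2 - q.2) * v k) 𝒰 (𝓝 m)) :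
    ∃ a b c, IsAdmissible T a b ∧ q ∈ line a b ∧ ∀ p ∈ points T ∩ core T,
      (p ∈ line a b → Tendsto (fun k => (p.1 - q.1) * u k + (p.2 - q.2) * v k) 𝒰
        (𝓝 ((p.1 - q.1) * c))) ∧
      (p ∉ line a b → Tendsto (fun k => (p.1 - q.1) * u k + (p.2 - q.2) * v k) 𝒰 atBot) := by
  -- Since the core is an antichain, the coordinates of `q` and `q'` are oppositely ordered; `(D2,
  -- D1)` is the positive normal of the line through them.
  obtain ⟨D1, D2, μ, hD1, hD2, heq, hμ⟩ : ∃ D1 D2 μ : ℝ, 0 < D1 ∧ 0 < D2 ∧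
      D2 * (q'.1 - q.1) + D1 * (q'.2 - q.2) = 0 ∧
      Tendsto (fun k => D1 * u k - D2 * v k) 𝒰 (𝓝 μ) := by
    have n1 := not_le_of_core hq.2 hq'.2 hne
    have n2 := not_le_of_core hq'.2 hq.2 hne.symm
    rw [Prod.le_def, not_and_or, not_le, not_le] at n1 n2
    have hcase : (q.1 < q'.1 ∧ q'.2 < q.2) ∨ (q'.1 < q.1 ∧ q.2 < q'.2) := by
      rcases n1 with h | h <;> rcases n2 with h' | h'
      · exact absurd h h'.not_gt
      · exact Or.inr ⟨h, h'⟩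
      · exact Or.inl ⟨h', h⟩
      · exact absurd h h'.not_gt
    rcases hcase with ⟨h1, h2⟩ | ⟨h1, h2⟩
    · refine ⟨q'.1 - q.1, q.2 - q'.2, m, by linarith, by linarith, by ring, ?_⟩
      exact hm.congr fun k => by ring
    · refine ⟨q.1 - q'.1, q'.2 - q.2, -m, by linarith, by linarith, by ring, ?_⟩
      exact hm.neg.congr fun k => by ring
  have hv : Tendsto v 𝒰 atTop := by
    have h1 : Tendsto (fun k => D1 * (u k + v k) + -(D1 * u k - D2 * v k)) 𝒰 atTop :=
      tendsto_atTop_add_right_of_le' _ (-(μ + 1)) (huv.const_mul_atTop hD1) (by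
        filter_upwards [hμ.eventually (gt_mem_nhds (lt_add_one μ))] with k hk
        linarith)
    have h2 := h1.const_mul_atTop (inv_pos.2 (add_pos hD1 hD2))
    refine h2.congr fun k => ?_
    have : D1 + D2 ≠ 0 := (add_pos hD1 hD2).ne'
    field_simp
    ring
  -- The first summand converges, and the second is the normal component of `p - q` times a sequence
  -- tending to infinity. The sign of that component thus decides the limit.
  have hdecomp : ∀ (p : ℝ × ℝ) k, (p.1 - q.1) * u k + (p.2 - q.2) * v k
      = (p.1 - q.1) / D1 * (D1 * u k - D2 * v k)
        + (D2 * (p.1 - q.1) + D1 * (p.2 - q.2)) / D1 * v k := by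
    intro p k
    field_simp
    ring
  -- A positive normal component would make the exponent tend to infinity, against the maximality of
  -- `q`.
  have hcore : ∀ p ∈ points T ∩ core T, D2 * (p.1 - q.1) + D1 * (p.2 - q.2) ≤ 0 := by
    intro p hp
    by_contra! hpos
    have h1 := (hμ.const_mul ((p.1 - q.1) / D1)).add_atTop
      (hv.const_mul_atTop (div_pos hpos hD1))
    obtain ⟨k, hk1, hk2⟩ := ((h1.eventually_gt_atTop 0).and (hmax p hp)).exists
    rw [hdecomp] at hk2
    linarith
  have hall : ∀ p ∈ points T, D2 * (p.1 - q.1) + D1 * (p.2 - q.2) ≤ 0 := by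
    intro p hp
    obtain ⟨r, hr, hpr⟩ := exists_core_ge hline hp
    have h1 := le_of_mem_convexHull (s := D2) (t := D1) (c := D2 * q.1 + D1 * q.2)
      (fun z hz => by linarith [hcore z hz]) (core_subset_convexHull hr)
    have h2 := mul_le_mul_of_nonneg_left hpr.1 hD2.le
    have h3 := mul_le_mul_of_nonneg_left hpr.2 hD1.le
    linarith
  obtain ⟨a, b, hab, hl⟩ := exists_admissible_of_normal hq.1 hq'.1 hne hD2 hD1 hall heq
  refine ⟨a, b, μ / D1, hab, (hl q).2 (by ring), fun p hp => ⟨fun h => ?_, fun h => ?_⟩⟩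
  · simp only [hdecomp]
    rw [(hl p).1 h]
    simp only [zero_div, zero_mul, add_zero]
    convert hμ.const_mul ((p.1 - q.1) / D1) using 2
    ring
  · simp only [hdecomp]
    have hneg : (D2 * (p.1 - q.1) + D1 * (p.2 - q.2)) / D1 < 0 :=
      div_neg_of_neg_of_pos (lt_of_le_of_ne (hcore p hp) fun h0 => h ((hl p).2 h0)) hD1
    exact (hμ.const_mul ((p.1 - q.1) / D1)).add_atBot (hv.const_mul_atTop_of_neg hneg)

theorem charPoly_seniorPart (R : DiffOp) (a b x y : ℝ) :
    open Classical in (seniorPart a b R).charPoly x y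
      = ∑ α ∈ R.support, if toPoint α ∈ line a b then R.coeff α * charMon α x y else 0 := by
  classical
  rw [seniorPart, DiffOp.part]
  have : ∀ S : DiffOp, S.charPoly x y
      = MvPolynomial.eval ![2 * Real.pi * Complex.I * x, 2 * Real.pi * Complex.I * y] S :=
    fun _ => rfl
  rw [this, map_sum, Finset.sum_filter]
  refine Finset.sum_congr rfl fun α _ => ?_
  split_ifs
  · rw [← this, charPoly_monomial]
  · rfl

theorem support_nonempty (hline : ∃ a b, IsAdmissible T a b) {R : DiffOp}
    (hsupp : ∀ α, α ∈ R.support ↔ toPoint α ∈ points T ∩ core T) : R.support.Nonempty := by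
  obtain ⟨a, b, hab⟩ := hline
  obtain ⟨z, ⟨j, α, hα, rfl⟩, hz⟩ := hab.2.2.2.nonempty
  have h1 : toPoint α ∈ points T := ⟨j, α, hα, rfl⟩
  exact ⟨α, (hsupp α).2 ⟨h1, mem_core_of_mem_line hab h1 hz⟩⟩

/-- An elliptic principal part dominates all its monomials at high frequencies. -/
theorem exists_lower_bound (hline : ∃ a b, IsAdmissible T a b) {R : DiffOp}
    (hsupp : ∀ α, α ∈ R.support ↔ toPoint α ∈ points T ∩ core T)
    (hell : ∀ a b : ℝ, IsAdmissible T a b → ∀ x y : ℝ, x ≠ 0 → y ≠ 0 →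
      (seniorPart a b R).charPoly x y ≠ 0) :
    ∃ c : ℝ, 0 < c ∧ ∃ K : ℝ, ∀ x y : ℝ, 1 ≤ |x| → 1 ≤ |y| → (K ≤ |x| ∨ K ≤ |y|) →
      c * ∑ α ∈ R.support, |x| ^ α 0 * |y| ^ α 1 ≤ ‖R.charPoly x y‖ := by
  classical
  by_contra! hcon
  -- Negate the bound with `c = 1 / (k + 1)` and `K = k + 1`, and write the points as signs times
  -- exponentials.
  have hseq : ∀ k : ℕ, ∃ sx sy u v : ℝ, (sx = 1 ∨ sx = -1) ∧ (sy = 1 ∨ sy = -1) ∧ 0 ≤ u ∧ 0 ≤ v ∧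
      Real.log (k + 1) ≤ u + v ∧ ‖R.charPoly (sx * Real.exp u) (sy * Real.exp v)‖
        ≤ (1 / ((k : ℝ) + 1)) * ∑ α ∈ R.support, Real.exp (α 0 * u + α 1 * v) := by
    intro k
    obtain ⟨x, y, hx, hy, hK, hlt⟩ := hcon (1 / ((k : ℝ) + 1)) Nat.one_div_pos_of_nat (k + 1)
    obtain ⟨sx, u, hsx, hu, hxu, hxu'⟩ := exists_sign_mul_exp hx
    obtain ⟨sy, v, hsy, hv, hyv, hyv'⟩ := exists_sign_mul_exp hy
    refine ⟨sx, sy, u, v, hsx, hsy, hu, hv, ?_, ?_⟩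
    · rw [Real.log_le_iff_le_exp (by positivity), Real.exp_add]
      rw [hxu', hyv'] at hK
      have := Real.one_le_exp hu
      have := Real.one_le_exp hv
      rcases hK with h | h <;> nlinarith
    · rw [← hxu, ← hyv]
      refine hlt.le.trans_eq ?_
      rw [hxu', hyv']
      simp only [exp_pow_mul_exp_pow]
  choose sx sy u v hsx hsy hu hv hlog hle using hseq
  -- A nonprincipal ultrafilter replaces repeated passage to subsequences: it fixes the signs and
  -- the largest monomial, and makes all ratios in `[0, 1]` converge.
  set 𝒰 : Ultrafilter ℕ := hyperfilter ℕ
  have h𝒰 : (𝒰 : Filter ℕ) ≤ atTop := Nat.hyperfilter_le_atTop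
  have huv : Tendsto (fun k => u k + v k) 𝒰 atTop :=
    (tendsto_atTop_mono hlog (Real.tendsto_log_atTop.comp
      (tendsto_atTop_add_const_right _ _ tendsto_natCast_atTop_atTop))).mono_left h𝒰
  obtain ⟨σ, hσ, hσev⟩ : ∃ σ : ℝ, (σ = 1 ∨ σ = -1) ∧ ∀ᶠ k in (𝒰 : Filter ℕ), sx k = σ := by
    rcases 𝒰.eventually_or.1 (Eventually.of_forall hsx) with h | h
    exacts [⟨1, Or.inl rfl, h⟩, ⟨-1, Or.inr rfl, h⟩]
  obtain ⟨τ, hτ, hτev⟩ : ∃ τ : ℝ, (τ = 1 ∨ τ = -1) ∧ ∀ᶠ k in (𝒰 : Filter ℕ), sy k = τ := by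
    rcases 𝒰.eventually_or.1 (Eventually.of_forall hsy) with h | h
    exacts [⟨1, Or.inl rfl, h⟩, ⟨-1, Or.inr rfl, h⟩]
  have hσ0 : σ ≠ 0 := by rcases hσ with rfl | rfl <;> norm_num
  have hτ0 : τ ≠ 0 := by rcases hτ with rfl | rfl <;> norm_num
  have hsupp_ne := support_nonempty hline hsupp
  set E : (Fin 2 →₀ ℕ) → ℕ → ℝ := fun α k => α 0 * u k + α 1 * v k with hE
  obtain ⟨q, hq, hqmax⟩ : ∃ q ∈ R.support, ∀ᶠ k in (𝒰 : Filter ℕ), ∀ α ∈ R.support,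
      E α k ≤ E q k := by
    have h1 : ∀ᶠ k in (𝒰 : Filter ℕ), ∃ q ∈ (R.support : Set (Fin 2 →₀ ℕ)), ∀ α ∈ R.support,
        E α k ≤ E q k :=
      Eventually.of_forall fun k => Finset.exists_max_image _ (fun α => E α k) hsupp_ne
    rwa [Ultrafilter.eventually_exists_mem_iff (Finset.finite_toSet _)] at h1
  have hrel : ∀ α k, E α k - E q k = ((toPoint α).1 - (toPoint q).1) * u k
      + ((toPoint α).2 - (toPoint q).2) * v k := fun α k => by
    simp only [hE, toPoint]; ring
  -- After division by the largest monomial the sum of the ratios is at most the number of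
  -- monomials, so the factor `1 / (k + 1)` forces the limit of `R` to vanish.
  have hlimzero : ∀ t : (Fin 2 →₀ ℕ) → ℝ, (∀ α ∈ R.support,
      Tendsto (fun k => Real.exp (E α k - E q k)) 𝒰 (𝓝 (t α))) →
      ∑ α ∈ R.support, R.coeff α * charMon α σ τ * (t α : ℂ) = 0 := by
    intro t ht
    have h1 : Tendsto (fun k => ∑ α ∈ R.support,
        R.coeff α * charMon α σ τ * ((Real.exp (E α k - E q k) : ℝ) : ℂ)) 𝒰
        (𝓝 (∑ α ∈ R.support, R.coeff α * charMon α σ τ * (t α : ℂ))) :=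
      tendsto_finsetSum _ fun α hα =>
        ((Complex.continuous_ofReal.tendsto _).comp (ht α hα)).const_mul _
    refine tendsto_nhds_unique h1 (squeeze_zero_norm' (a := fun k : ℕ =>
      (1 / ((k : ℝ) + 1)) * R.support.card) ?_ ?_)
    · filter_upwards [hσev, hτev, hqmax] with k h1 h2 h3
      have e1 : ∑ α ∈ R.support, R.coeff α * charMon α σ τ * ((Real.exp (E α k - E q k) : ℝ) : ℂ)
          = R.charPoly (sx k * Real.exp (u k)) (sy k * Real.exp (v k))
            * ((Real.exp (-E q k) : ℝ) : ℂ) := by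
        rw [charPoly_eq_sum, Finset.sum_mul, h1, h2]
        refine Finset.sum_congr rfl fun α _ => ?_
        rw [charMon_sign, exp_pow_mul_exp_pow, sub_eq_add_neg, Real.exp_add (E α k)]
        simp only [hE]
        push_cast
        ring
      rw [e1, norm_mul, Complex.norm_real, Real.norm_of_nonneg (Real.exp_pos _).le]
      refine (mul_le_mul_of_nonneg_right (hle k) (Real.exp_pos _).le).trans ?_
      rw [mul_assoc]
      refine mul_le_mul_of_nonneg_left ?_ (by positivity)
      rw [Finset.sum_mul, ← nsmul_one, ← Finset.sum_const]
      refine Finset.sum_le_sum fun α hα => ?_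
      rw [← Real.exp_add, Real.exp_le_one_iff]
      linarith [h3 α hα]
    · have := (tendsto_one_div_add_atTop_nhds_zero_nat (𝕜 := ℝ)).mul_const (R.support.card : ℝ)
      rw [zero_mul] at this
      exact this.mono_left h𝒰
  have hcq : R.coeff q * charMon q σ τ ≠ 0 := by
    refine mul_ne_zero (MvPolynomial.mem_support_iff.1 hq) ?_
    simp [charMon, hσ0, hτ0, Real.pi_ne_zero]
  have hlim : ∀ α ∈ R.support, ∃ t : ℝ, 0 ≤ t ∧
      Tendsto (fun k => Real.exp (E α k - E q k)) 𝒰 (𝓝 t) := by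
    intro α hα
    have hmem : Set.Icc (0 : ℝ) 1 ∈ 𝒰.map (fun k => Real.exp (E α k - E q k)) := by
      rw [Ultrafilter.mem_map]
      filter_upwards [hqmax] with k hk
      exact ⟨(Real.exp_pos _).le, Real.exp_le_one_iff.2 (by linarith [hk α hα])⟩
    obtain ⟨t, ht, ht'⟩ := isCompact_Icc.ultrafilter_le_nhds' _ hmem
    exact ⟨t, ht.1, ht'⟩
  have hq1 : Tendsto (fun k => Real.exp (E q k - E q k)) 𝒰 (𝓝 1) := by
    simp only [sub_self, Real.exp_zero]
    exact tendsto_const_nhds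
  -- If only the monomial `q` survives, the limit is its coefficient times a nonzero value, a
  -- contradiction.
  by_cases hdeg : ∀ α ∈ R.support, α ≠ q →
      Tendsto (fun k => Real.exp (E α k - E q k)) 𝒰 (𝓝 0)
  · have := hlimzero (fun α => if α = q then 1 else 0) fun α hα => by
      by_cases h : α = q
      · rw [if_pos h, h]; exact hq1
      · rw [if_neg h]; exact hdeg α hα h
    rw [Finset.sum_eq_single q (fun α _ h => by simp [h]) (fun h => absurd hq h)] at this
    simp only [if_true, Complex.ofReal_one, mul_one] at this
    exact hcq this
  · push Not at hdeg
    obtain ⟨α', hα', hne, hnot⟩ := hdeg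
    obtain ⟨t, ht0, ht⟩ := hlim α' hα'
    have htpos : t ≠ 0 := by rintro rfl; exact hnot ht
    have hm := ht.log htpos
    simp only [Real.log_exp, hrel] at hm
    obtain ⟨a, b, c, hab, hql, hlimits⟩ := exists_line_of_tendsto hline huv ((hsupp q).1 hq)
      ((hsupp α').1 hα') (fun h => hne (toPoint_injective h).symm) (fun p hp => by
        obtain ⟨⟨j, α, hα, rfl⟩, hc⟩ := hp
        have hα2 : α ∈ R.support := (hsupp α).2 ⟨⟨j, α, hα, rfl⟩, hc⟩
        filter_upwards [hqmax] with k hk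
        rw [← hrel]
        linarith [hk α hα2]) hm
    have hz := hlimzero (fun α => if toPoint α ∈ line a b then
        Real.exp (((toPoint α).1 - (toPoint q).1) * c) else 0) fun α hα => by
      simp only [hrel]
      split_ifs with h
      · exact (Real.continuous_exp.tendsto _).comp ((hlimits _ ((hsupp α).1 hα)).1 h)
      · exact Real.tendsto_exp_atBot.comp ((hlimits _ ((hsupp α).1 hα)).2 h)
    -- Along the admissible line the limiting ratios are `exp ((α₀ - q₀) c)`, the monomial ratios at
    -- `(e^c, 1)`. So the vanishing limit is, up to a positive factor, the senior part at `(σ e^c,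
    -- τ)`.
    refine hell a b hab (σ * Real.exp c) (τ * Real.exp 0) (by positivity) (by positivity) ?_
    rw [charPoly_seniorPart]
    have hfac : ∀ α ∈ R.support, (if toPoint α ∈ line a b then
          R.coeff α * charMon α (σ * Real.exp c) (τ * Real.exp 0) else 0)
        = ((Real.exp ((toPoint q).1 * c) : ℝ) : ℂ) * (R.coeff α * charMon α σ τ *
          ((if toPoint α ∈ line a b then
            Real.exp (((toPoint α).1 - (toPoint q).1) * c) else 0 : ℝ) : ℂ)) := by
      intro α _
      split_ifs with h
      · have e : Real.exp (α 0 * c + α 1 * 0)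
            = Real.exp ((toPoint q).1 * c) * Real.exp (((toPoint α).1 - (toPoint q).1) * c) := by
          rw [← Real.exp_add]
          congr 1
          simp only [toPoint]
          ring
        rw [charMon_sign, exp_pow_mul_exp_pow, e, Complex.ofReal_mul]
        ring
      · simp
    rw [Finset.sum_congr rfl hfac, ← Finset.mul_sum, hz, mul_zero]

end Operators

/-! ### Differences of polynomials and of their quotients -/

section Differences

theorem mul_add_one_pow_sub_le {x : ℝ} (hx : 1 ≤ x) (a : ℕ) :
    x * ((x + 1) ^ a - x ^ a) ≤ 3 ^ a * x ^ a := by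
  induction a with
  | zero => simp
  | succ a ih =>
    have h0 : 0 ≤ x ^ a := by positivity
    have h3 : (1 : ℝ) ≤ 3 ^ a := one_le_pow₀ (by norm_num)
    have e : x * ((x + 1) ^ (a + 1) - x ^ (a + 1))
        = (x + 1) * (x * ((x + 1) ^ a - x ^ a)) + x * x ^ a := by ring
    rw [e]
    calc (x + 1) * (x * ((x + 1) ^ a - x ^ a)) + x * x ^ a
        ≤ (x + 1) * (3 ^ a * x ^ a) + x * (3 ^ a * x ^ a) := by
          gcongr
          exact le_mul_of_one_le_left h0 h3
      _ ≤ 3 * x * (3 ^ a * x ^ a) := by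
          have : 0 ≤ 3 ^ a * x ^ a := by positivity
          nlinarith
      _ = 3 ^ (a + 1) * x ^ (a + 1) := by ring

theorem add_one_pow_sub_le (i a : ℕ) :
    |((i + 1 : ℕ) + 1 : ℝ) ^ a - ((i : ℝ) + 1) ^ a| ≤ 3 ^ a * ((i : ℝ) + 1) ^ a * ((i : ℝ) + 1)⁻¹ := by
  have h1 : (1 : ℝ) ≤ (i : ℝ) + 1 := by linarith [(Nat.cast_nonneg i : (0 : ℝ) ≤ i)]
  have h := mul_add_one_pow_sub_le h1 a
  have h2 : ((i + 1 : ℕ) + 1 : ℝ) = ((i : ℝ) + 1) + 1 := by push_cast; ring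
  rw [h2, abs_of_nonneg (sub_nonneg.2 (by gcongr; linarith)), ← div_eq_mul_inv,
    le_div_iff₀ (by linarith)]
  linarith

/-- The sum of the absolute values of the monomials of an operator. -/
def monSum (P : DiffOp) (i j : ℕ) : ℝ :=
  ∑ α ∈ P.support, ((i : ℝ) + 1) ^ α 0 * ((j : ℝ) + 1) ^ α 1

theorem monSum_mono (P : DiffOp) {i i' j j' : ℕ} (hi : i ≤ i') (hj : j ≤ j') :
    monSum P i j ≤ monSum P i' j' := by
  have hi' : (i : ℝ) ≤ i' := by exact_mod_cast hi
  have hj' : (j : ℝ) ≤ j' := by exact_mod_cast hj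
  refine Finset.sum_le_sum fun α _ => ?_
  gcongr

/-- The values of the characteristic polynomial at the integer points of a quadrant. -/
def latticeVal (P : DiffOp) (σ τ : ℤ) (i j : ℕ) : ℂ :=
  P.charPoly ((σ : ℝ) * ((i : ℝ) + 1)) ((τ : ℝ) * ((j : ℝ) + 1))

theorem latticeVal_eq (P : DiffOp) (σ τ : ℤ) (i j : ℕ) :
    latticeVal P σ τ i j = ∑ α ∈ P.support,
      P.coeff α * charMon α σ τ * ((((i : ℝ) + 1) ^ α 0 * ((j : ℝ) + 1) ^ α 1 : ℝ) : ℂ) := by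
  rw [latticeVal, charPoly_eq_sum]
  refine Finset.sum_congr rfl fun α _ => ?_
  rw [charMon_sign, mul_assoc]

/-- A difference in one variable gains the reciprocal of that variable on each monomial, with a
crude constant `3^a`. Bounding by `monSum` instead of the value of `P` makes cancellation between
monomials irrelevant. -/
theorem exists_difference_bounds (P : DiffOp) (σ τ : ℤ) : ∃ C : ℝ, 0 < C ∧ ∀ i j : ℕ,
    ‖latticeVal P σ τ i j‖ ≤ C * monSum P i j ∧
    ‖latticeVal P σ τ (i + 1) j - latticeVal P σ τ i j‖
      ≤ C * monSum P i j * ((i : ℝ) + 1)⁻¹ ∧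
    ‖latticeVal P σ τ i (j + 1) - latticeVal P σ τ i j‖
      ≤ C * monSum P i j * ((j : ℝ) + 1)⁻¹ ∧
    ‖mixedDiff (latticeVal P σ τ) i j‖
      ≤ C * monSum P i j * (((i : ℝ) + 1)⁻¹ * ((j : ℝ) + 1)⁻¹) := by
  set c : (Fin 2 →₀ ℕ) → ℂ := fun α => P.coeff α * charMon α σ τ with hc
  set B : (Fin 2 →₀ ℕ) → ℝ := fun α => ‖c α‖ * 3 ^ (α 0 + α 1) with hB
  have key : ∀ (φ : (Fin 2 →₀ ℕ) → ℝ) (i j : ℕ) (s : ℝ), 0 ≤ s →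
      (∀ α, |φ α| ≤ 3 ^ (α 0 + α 1) * (((i : ℝ) + 1) ^ α 0 * ((j : ℝ) + 1) ^ α 1) * s) →
      ‖∑ α ∈ P.support, c α * (φ α : ℂ)‖ ≤ (∑ α ∈ P.support, B α + 1) * monSum P i j * s := by
    intro φ i j s hs hφ
    have h1 : ∀ α ∈ P.support, ‖c α * (φ α : ℂ)‖
        ≤ B α * (((i : ℝ) + 1) ^ α 0 * ((j : ℝ) + 1) ^ α 1) * s := by
      intro α _
      rw [norm_mul, Complex.norm_real, Real.norm_eq_abs]
      refine (mul_le_mul_of_nonneg_left (hφ α) (norm_nonneg _)).trans_eq ?_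
      simp only [hB]
      ring
    refine (norm_sum_le _ _).trans ((Finset.sum_le_sum h1).trans ?_)
    rw [← Finset.sum_mul]
    refine mul_le_mul_of_nonneg_right ?_ hs
    rw [monSum, Finset.mul_sum]
    refine Finset.sum_le_sum fun α hα => ?_
    refine mul_le_mul_of_nonneg_right ?_ (by positivity)
    have := Finset.single_le_sum (f := B) (fun α _ => by positivity) hα
    linarith
  have hp3 : ∀ a : ℕ, (1 : ℝ) ≤ 3 ^ a := fun a => one_le_pow₀ (by norm_num)
  have hself : ∀ (i a : ℕ), |((i : ℝ) + 1) ^ a| ≤ 3 ^ a * ((i : ℝ) + 1) ^ a := fun i a => by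
    rw [abs_of_nonneg (by positivity)]
    exact le_mul_of_one_le_left (by positivity) (hp3 a)
  refine ⟨∑ α ∈ P.support, B α + 1, ?_, fun i j => ⟨?_, ?_, ?_, ?_⟩⟩
  · have : 0 ≤ ∑ α ∈ P.support, B α := Finset.sum_nonneg fun α _ => by positivity
    linarith
  · have := key (fun α => ((i : ℝ) + 1) ^ α 0 * ((j : ℝ) + 1) ^ α 1) i j 1 zero_le_one fun α => by
      rw [abs_mul]
      refine (mul_le_mul (hself i _) (hself j _) (abs_nonneg _) (by positivity)).trans_eq ?_
      ring
    rw [mul_one] at this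
    rwa [latticeVal_eq]
  · have := key (fun α => (((i + 1 : ℕ) + 1 : ℝ) ^ α 0 - ((i : ℝ) + 1) ^ α 0)
        * ((j : ℝ) + 1) ^ α 1) i j ((i : ℝ) + 1)⁻¹ (by positivity) fun α => by
      rw [abs_mul]
      refine (mul_le_mul (add_one_pow_sub_le i _) (hself j _) (abs_nonneg _)
        (by positivity)).trans_eq ?_
      ring
    refine (le_of_eq ?_).trans this
    rw [latticeVal_eq, latticeVal_eq, ← Finset.sum_sub_distrib]
    congr 1
    refine Finset.sum_congr rfl fun α _ => ?_
    simp only [hc]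
    push_cast
    ring
  · have := key (fun α => ((i : ℝ) + 1) ^ α 0
        * (((j + 1 : ℕ) + 1 : ℝ) ^ α 1 - ((j : ℝ) + 1) ^ α 1)) i j ((j : ℝ) + 1)⁻¹
        (by positivity) fun α => by
      rw [abs_mul]
      refine (mul_le_mul (hself i _) (add_one_pow_sub_le j _) (abs_nonneg _)
        (by positivity)).trans_eq ?_
      ring
    refine (le_of_eq ?_).trans this
    rw [latticeVal_eq, latticeVal_eq, ← Finset.sum_sub_distrib]
    congr 1
    refine Finset.sum_congr rfl fun α _ => ?_
    simp only [hc]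
    push_cast
    ring
  · have := key (fun α => (((i + 1 : ℕ) + 1 : ℝ) ^ α 0 - ((i : ℝ) + 1) ^ α 0)
        * (((j + 1 : ℕ) + 1 : ℝ) ^ α 1 - ((j : ℝ) + 1) ^ α 1)) i j
        (((i : ℝ) + 1)⁻¹ * ((j : ℝ) + 1)⁻¹) (by positivity) fun α => by
      rw [abs_mul]
      refine (mul_le_mul (add_one_pow_sub_le i _) (add_one_pow_sub_le j _) (abs_nonneg _)
        (by positivity)).trans_eq ?_
      ring
    refine (le_of_eq ?_).trans this
    rw [mixedDiff, latticeVal_eq, latticeVal_eq, latticeVal_eq, latticeVal_eq,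
      ← Finset.sum_sub_distrib, ← Finset.sum_sub_distrib, ← Finset.sum_sub_distrib]
    congr 1
    refine Finset.sum_congr rfl fun α _ => ?_
    simp only [hc]
    push_cast
    ring

/-- A discrete quotient rule for mixed differences. -/
theorem norm_mixedDiff_div_le {k r R : ℕ → ℕ → ℂ} {C c N w A B : ℝ} {i j : ℕ} (hC : 0 < C)
    (hc : 0 < c) (hN : 0 < N) (hw : 0 ≤ w) (hA0 : 0 ≤ A) (hA1 : A ≤ 1) (hB0 : 0 ≤ B) (hB1 : B ≤ 1)
    (hk : ∀ i j, k i j = r i j / R i j)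
    (h00 : c * N ≤ ‖R i j‖) (h10 : c * N ≤ ‖R (i + 1) j‖) (h01 : c * N ≤ ‖R i (j + 1)‖)
    (h11 : c * N ≤ ‖R (i + 1) (j + 1)‖)
    (r0 : ‖r i j‖ ≤ C * (w * N)) (r1 : ‖r (i + 1) j - r i j‖ ≤ C * (w * N) * A)
    (r2 : ‖r i (j + 1) - r i j‖ ≤ C * (w * N) * B) (r3 : ‖mixedDiff r i j‖ ≤ C * (w * N) * (A * B))
    (R1 : ‖R (i + 1) j - R i j‖ ≤ C * N * A) (R2 : ‖R i (j + 1) - R i j‖ ≤ C * N * B)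
    (R3 : ‖mixedDiff R i j‖ ≤ C * N * (A * B)) :
    ‖k i j‖ ≤ C / c * w ∧
      ‖mixedDiff k i j‖ ≤ (C + C / c * C + 4 * C * ((C + C / c * C) / c)) / c * (w * (A * B)) := by
  have hcN : 0 < c * N := mul_pos hc hN
  have ne : ∀ {z : ℂ}, c * N ≤ ‖z‖ → z ≠ 0 := fun h => norm_pos_iff.1 (hcN.trans_le h)
  have e00 : k i j * R i j = r i j := by rw [hk, div_mul_cancel₀ _ (ne h00)]
  have e10 : k (i + 1) j * R (i + 1) j = r (i + 1) j := by rw [hk, div_mul_cancel₀ _ (ne h10)]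
  have e01 : k i (j + 1) * R i (j + 1) = r i (j + 1) := by rw [hk, div_mul_cancel₀ _ (ne h01)]
  have e11 : k (i + 1) (j + 1) * R (i + 1) (j + 1) = r (i + 1) (j + 1) := by
    rw [hk, div_mul_cancel₀ _ (ne h11)]
  have bound : ∀ {z Z : ℂ} {X : ℝ}, c * N ≤ ‖Z‖ → ‖z * Z‖ ≤ X * N → ‖z‖ ≤ X / c := by
    intro z Z X hZ hz
    rw [norm_mul] at hz
    have h1 := mul_le_mul_of_nonneg_left hZ (norm_nonneg z)
    rw [le_div_iff₀ hc]
    refine le_of_mul_le_mul_right ?_ hN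
    linarith
  have hk0 : ‖k i j‖ ≤ C / c * w := by
    rw [div_mul_eq_mul_div]
    refine bound h00 ?_
    rw [e00]
    linarith
  set D := (C + C / c * C) / c with hD
  have hCc : 0 < C / c := div_pos hC hc
  have hd1 : ‖k (i + 1) j - k i j‖ ≤ D * (w * A) := by
    rw [hD, div_mul_eq_mul_div]
    refine bound h10 ?_
    have e : (k (i + 1) j - k i j) * R (i + 1) j
        = (r (i + 1) j - r i j) - k i j * (R (i + 1) j - R i j) := by
      rw [← e10, ← e00]; ring
    rw [e]
    refine (norm_sub_le _ _).trans ?_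
    rw [norm_mul]
    have := mul_le_mul hk0 R1 (norm_nonneg _) (by positivity)
    linarith
  have hd2 : ‖k i (j + 1) - k i j‖ ≤ D * (w * B) := by
    rw [hD, div_mul_eq_mul_div]
    refine bound h01 ?_
    have e : (k i (j + 1) - k i j) * R i (j + 1)
        = (r i (j + 1) - r i j) - k i j * (R i (j + 1) - R i j) := by
      rw [← e01, ← e00]; ring
    rw [e]
    refine (norm_sub_le _ _).trans ?_
    rw [norm_mul]
    have := mul_le_mul hk0 R2 (norm_nonneg _) (by positivity)
    linarith
  refine ⟨hk0, ?_⟩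
  have hDpos : 0 < D := by positivity
  have R4 : ‖R (i + 1) (j + 1) - R (i + 1) j‖ ≤ 2 * C * N * B := by
    have e : R (i + 1) (j + 1) - R (i + 1) j = mixedDiff R i j + (R i (j + 1) - R i j) := by
      rw [mixedDiff]; ring
    rw [e]
    refine (norm_add_le _ _).trans ?_
    have : C * N * (A * B) ≤ C * N * B :=
      mul_le_mul_of_nonneg_left (mul_le_of_le_one_left hB0 hA1) (by positivity)
    linarith
  have R5 : ‖R (i + 1) (j + 1) - R i (j + 1)‖ ≤ 2 * C * N * A := by
    have e : R (i + 1) (j + 1) - R i (j + 1) = mixedDiff R i j + (R (i + 1) j - R i j) := by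
      rw [mixedDiff]; ring
    rw [e]
    refine (norm_add_le _ _).trans ?_
    have : C * N * (A * B) ≤ C * N * A :=
      mul_le_mul_of_nonneg_left (mul_le_of_le_one_right hA0 hB1) (by positivity)
    linarith
  rw [div_mul_eq_mul_div]
  refine bound h11 ?_
  -- The Leibniz rule for `r = k R`, solved for the mixed difference of `k`, so that only a division
  -- by `R (i + 1) (j + 1)` is required.
  have e : mixedDiff k i j * R (i + 1) (j + 1) = mixedDiff r i j - k i j * mixedDiff R i j
      - (k (i + 1) j - k i j) * (R (i + 1) (j + 1) - R (i + 1) j)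
      - (k i (j + 1) - k i j) * (R (i + 1) (j + 1) - R i (j + 1)) := by
    simp only [mixedDiff]
    rw [← e00, ← e01, ← e10, ← e11]
    ring
  rw [e]
  have n1 : ‖k i j * mixedDiff R i j‖ ≤ (C / c * w) * (C * N * (A * B)) := by
    rw [norm_mul]; exact mul_le_mul hk0 R3 (norm_nonneg _) (by positivity)
  have n2 : ‖(k (i + 1) j - k i j) * (R (i + 1) (j + 1) - R (i + 1) j)‖
      ≤ D * (w * A) * (2 * C * N * B) := by
    rw [norm_mul]; exact mul_le_mul hd1 R4 (norm_nonneg _) (by positivity)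
  have n3 : ‖(k i (j + 1) - k i j) * (R (i + 1) (j + 1) - R i (j + 1))‖
      ≤ D * (w * B) * (2 * C * N * A) := by
    rw [norm_mul]; exact mul_le_mul hd2 R5 (norm_nonneg _) (by positivity)
  refine (norm_sub_le _ _).trans ?_
  have := norm_sub_le (mixedDiff r i j - k i j * mixedDiff R i j)
    ((k (i + 1) j - k i j) * (R (i + 1) (j + 1) - R (i + 1) j))
  have := norm_sub_le (mixedDiff r i j) (k i j * mixedDiff R i j)
  linarith

end Differences

/-! ### Estimates of subordinate operators through the principal part -/

section Estimates

variable {l : ℕ} {T : Fin l → DiffOp}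

/-- `S f = g` in the sense of distributions. -/
def MapsCT (S : DiffOp) (f g : CT) : Prop :=
  ∀ n : Fin 2 → ℤ, coeff n g = S.charPoly (n 0) (n 1) * coeff n f

/-- A uniform power gain for a strictly subordinate operator. -/
theorem exists_uniform_gain {R r : DiffOp}
    (hsupp : ∀ α, α ∈ R.support ↔ toPoint α ∈ points T ∩ core T)
    (hr : IsStrictlySubordinate T r) :
    ∃ δ : ℝ, 0 < δ ∧ δ < 1 ∧ ∀ α ∈ r.support, ∀ x y : ℝ, 1 ≤ x → 1 ≤ y →
      x ^ α 0 * y ^ α 1 * (x * y) ^ δ ≤ ∑ β ∈ R.support, x ^ β 0 * y ^ β 1 := by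
  have h1 : ∀ α : Fin 2 →₀ ℕ, ∃ δ : ℝ, 0 < δ ∧ (α ∈ r.support → ∀ x y : ℝ, 1 ≤ x → 1 ≤ y →
      x ^ α 0 * y ^ α 1 * (x * y) ^ δ ≤ ∑ β ∈ R.support, x ^ β 0 * y ^ β 1) := by
    intro α
    by_cases hα : α ∈ r.support
    · obtain ⟨q, hq, hle⟩ := (hr.1 α hα).2
      obtain ⟨δ, hδ, h⟩ := exists_power_gain (hr.1 α hα).1 ⟨q, hq, hle⟩ (hr.2 α hα).1 (hr.2 α hα).2
      refine ⟨δ, hδ, fun _ x y hx hy => ?_⟩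
      obtain ⟨p, ⟨⟨j, β, hβ, rfl⟩, hp⟩, hle⟩ := h x y hx hy
      simp only [toPoint, Real.rpow_natCast] at hle
      refine hle.trans ?_
      refine Finset.single_le_sum (f := fun β : Fin 2 →₀ ℕ => x ^ β 0 * y ^ β 1)
        (fun β _ => by positivity) ((hsupp β).2 ⟨⟨j, β, hβ, rfl⟩, hp⟩)
    · exact ⟨1, one_pos, fun h => absurd h hα⟩
  choose δ hδ h using h1
  rcases r.support.eq_empty_or_nonempty with he | hne
  · exact ⟨1 / 2, by norm_num, by norm_num, fun α hα => by simp [he] at hα⟩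
  · obtain ⟨α₀, hα₀, hmin⟩ := Finset.exists_min_image _ δ hne
    refine ⟨min (δ α₀) (1 / 2), lt_min (hδ _) (by norm_num),
      (min_le_right _ _).trans_lt (by norm_num), fun α hα x y hx hy => ?_⟩
    refine le_trans ?_ (h α hα x y hx hy)
    have hxy : 1 ≤ x * y := one_le_mul_of_one_le_of_one_le hx hy
    refine mul_le_mul_of_nonneg_left ?_ (by positivity)
    exact Real.rpow_le_rpow_of_exponent_le hxy ((min_le_left _ _).trans (hmin α hα))

/-- The multiplier with symbol `r / R` on one quadrant. -/
theorem exists_quotient_mult_quadrant {R r : DiffOp}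
    (hsupp : ∀ α, α ∈ R.support ↔ toPoint α ∈ points T ∩ core T) (hne : R.support.Nonempty)
    {c K : ℝ} (hc : 0 < c) (hlow : ∀ x y : ℝ, 1 ≤ |x| → 1 ≤ |y| → (K ≤ |x| ∨ K ≤ |y|) →
      c * ∑ α ∈ R.support, |x| ^ α 0 * |y| ^ α 1 ≤ ‖R.charPoly x y‖)
    (hr : IsStrictlySubordinate T r) {σ τ : ℤ} (hσ : σ = 1 ∨ σ = -1) (hτ : τ = 1 ∨ τ = -1) :
    ∃ U : CT →L[ℂ] CT, (∀ n g, coeff n (U g) = (if 0 < σ * n 0 ∧ 0 < τ * n 1 then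
        r.charPoly (n 0) (n 1) / R.charPoly (n 0) (n 1) else 0) * coeff n g) ∧
      ∀ ε : ℝ, 0 < ε → ∃ M : ℕ, ∀ g, (∀ n : Fin 2 → ℤ, |n 0| ≤ M ∧ |n 1| ≤ M → coeff n g = 0) →
        ‖U g‖ ≤ ε * ‖g‖ := by
  obtain ⟨δ, hδ0, hδ1, hgain⟩ := exists_uniform_gain hsupp hr
  obtain ⟨C₁, hC₁, hdr⟩ := exists_difference_bounds r σ τ
  obtain ⟨C₂, hC₂, hdR⟩ := exists_difference_bounds R σ τ
  set C := C₁ * (r.support.card + 1) + C₂ with hCdef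
  have hC : 0 < C := by positivity
  have habs : ∀ {s : ℤ}, (s = 1 ∨ s = -1) → ∀ i : ℕ, |(s : ℝ) * ((i : ℝ) + 1)| = (i : ℝ) + 1 := by
    intro s hs i
    have h0 : (0 : ℝ) ≤ (i : ℝ) + 1 := by positivity
    rw [abs_mul, abs_of_nonneg h0]
    rcases hs with rfl | rfl <;> simp
  have hge1 : ∀ i : ℕ, (1 : ℝ) ≤ (i : ℝ) + 1 := fun i => by
    linarith [(Nat.cast_nonneg i : (0 : ℝ) ≤ i)]
  have hlow' : ∀ i j : ℕ, ⌈K⌉₊ ≤ i ∨ ⌈K⌉₊ ≤ j →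
      c * monSum R i j ≤ ‖latticeVal R σ τ i j‖ := by
    intro i j hij
    have h := hlow ((σ : ℝ) * ((i : ℝ) + 1)) ((τ : ℝ) * ((j : ℝ) + 1))
      (by rw [habs hσ]; exact hge1 i) (by rw [habs hτ]; exact hge1 j) (by
        rw [habs hσ, habs hτ]
        rcases hij with h | h
        · left; have := Nat.ceil_le.1 h; linarith
        · right; have := Nat.ceil_le.1 h; linarith)
    rwa [habs hσ, habs hτ] at h
  have hNpos : ∀ i j, 0 < monSum R i j := fun i j =>
    Finset.sum_pos (fun α _ => by positivity) hne
  -- The gain of the monomials of `R` over those of `r`.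
  set w : ℕ → ℕ → ℝ := fun i j => (((i : ℝ) + 1) * (j + 1)) ^ (-δ) with hw
  have hrN : ∀ i j, monSum r i j ≤ r.support.card * (w i j * monSum R i j) := by
    intro i j
    rw [monSum, ← nsmul_eq_mul, ← Finset.sum_const]
    refine Finset.sum_le_sum fun α hα => ?_
    have h := hgain α hα _ _ (hge1 i) (hge1 j)
    have hpos : 0 < (((i : ℝ) + 1) * ((j : ℝ) + 1)) ^ δ := by positivity
    rw [← le_div_iff₀ hpos] at h
    refine h.trans_eq ?_
    simp only [hw, monSum]
    rw [Real.rpow_neg (by positivity), div_eq_inv_mul]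
  have hCr : ∀ i j, C₁ * monSum r i j ≤ C * (w i j * monSum R i j) := by
    intro i j
    have h0 : 0 ≤ w i j * monSum R i j := mul_nonneg (by positivity) (hNpos i j).le
    have h1 := mul_le_mul_of_nonneg_left (hrN i j) hC₁.le
    have h2 := mul_nonneg hC₁.le h0
    have h3 := mul_nonneg hC₂.le h0
    rw [hCdef]
    linarith
  have hCR : ∀ i j, C₂ * monSum R i j ≤ C * monSum R i j := fun i j => by
    refine mul_le_mul_of_nonneg_right ?_ (hNpos i j).le
    rw [hCdef]
    have : 0 ≤ C₁ * (r.support.card + 1) := by positivity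
    linarith
  -- The scale `N = monSum R i j` is kept fixed; since `monSum` is monotone, it also bounds `R` from
  -- below at the three neighbouring points.
  have hmain : ∀ i j : ℕ, ⌈K⌉₊ ≤ i ∨ ⌈K⌉₊ ≤ j → _ := fun i j hij =>
    norm_mixedDiff_div_le (k := fun i j => latticeVal r σ τ i j / latticeVal R σ τ i j)
      (r := latticeVal r σ τ) (R := latticeVal R σ τ) (C := C) (c := c) (N := monSum R i j)
      (w := w i j) (A := ((i : ℝ) + 1)⁻¹) (B := ((j : ℝ) + 1)⁻¹) (i := i) (j := j)
      hC hc (hNpos i j) (by positivity) (by positivity) (inv_le_one_of_one_le₀ (hge1 i))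
      (by positivity) (inv_le_one_of_one_le₀ (hge1 j)) (fun _ _ => rfl)
      (hlow' i j hij)
      ((mul_le_mul_of_nonneg_left (monSum_mono R (Nat.le_succ i) le_rfl) hc.le).trans
        (hlow' _ _ (by omega)))
      ((mul_le_mul_of_nonneg_left (monSum_mono R le_rfl (Nat.le_succ j)) hc.le).trans
        (hlow' _ _ (by omega)))
      ((mul_le_mul_of_nonneg_left (monSum_mono R (Nat.le_succ i) (Nat.le_succ j)) hc.le).trans
        (hlow' _ _ (by omega)))
      ((hdr i j).1.trans (hCr i j))
      ((hdr i j).2.1.trans (mul_le_mul_of_nonneg_right (hCr i j) (by positivity)))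
      ((hdr i j).2.2.1.trans (mul_le_mul_of_nonneg_right (hCr i j) (by positivity)))
      ((hdr i j).2.2.2.trans (mul_le_mul_of_nonneg_right (hCr i j) (by positivity)))
      ((hdR i j).2.1.trans (mul_le_mul_of_nonneg_right (hCR i j) (by positivity)))
      ((hdR i j).2.2.1.trans (mul_le_mul_of_nonneg_right (hCR i j) (by positivity)))
      ((hdR i j).2.2.2.trans (mul_le_mul_of_nonneg_right (hCR i j) (by positivity)))
  set C' := C / c + (C + C / c * C + 4 * C * ((C + C / c * C) / c)) / c with hC'
  obtain ⟨U, hU, hsmall⟩ := exists_quadrant_mult hσ hτ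
    (fun i j => latticeVal r σ τ i j / latticeVal R σ τ i j) (δ := δ) (C := C') hδ0 hδ1 ⌈K⌉₊
    (fun i j hij => (hmain i j hij).1.trans (mul_le_mul_of_nonneg_right
      (le_add_of_nonneg_right (by positivity)) (by positivity)))
    (fun i j hij => (hmain i j hij).2.trans (by
      have e : w i j * (((i : ℝ) + 1)⁻¹ * ((j : ℝ) + 1)⁻¹)
          = (((i : ℝ) + 1) * (j + 1)) ^ (-1 - δ) := by
        rw [← mul_inv, ← Real.rpow_neg_one, ← Real.rpow_add (by positivity)]
        congr 1
        ring
      rw [e]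
      exact mul_le_mul_of_nonneg_right (le_add_of_nonneg_left (by positivity)) (by positivity)))
  refine ⟨U, fun n g => ?_, hsmall⟩
  rw [hU]
  congr 1
  split_ifs with h
  · have cast : ∀ {s : ℤ}, (s = 1 ∨ s = -1) → ∀ m : ℤ, 0 < s * m →
        (s : ℝ) * (((s * m - 1).toNat : ℕ) + 1 : ℝ) = m := by
      intro s hs m hm
      have h3 : ((s * m - 1).toNat : ℤ) = s * m - 1 := by omega
      have h4 : (((s * m - 1).toNat : ℕ) : ℝ) = s * m - 1 := by exact_mod_cast h3
      rw [h4, sub_add_cancel, ← mul_assoc]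
      rcases hs with rfl | rfl <;> norm_num
    simp only [latticeVal, cast hσ _ h.1, cast hτ _ h.2]
  · rfl

/-- The multiplier with symbol `r / R` for a strictly subordinate operator `r`. -/
theorem exists_quotient_mult (hline : ∃ a b, IsAdmissible T a b) {R r : DiffOp}
    (hsupp : ∀ α, α ∈ R.support ↔ toPoint α ∈ points T ∩ core T)
    (hell : ∀ a b : ℝ, IsAdmissible T a b → ∀ x y : ℝ, x ≠ 0 → y ≠ 0 →
      (seniorPart a b R).charPoly x y ≠ 0)
    (hr : IsStrictlySubordinate T r) :
    ∃ U : CT →L[ℂ] CT, (∀ n g, coeff n (U g) = (if n 0 ≠ 0 ∧ n 1 ≠ 0 then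
        r.charPoly (n 0) (n 1) / R.charPoly (n 0) (n 1) else 0) * coeff n g) ∧
      ∀ ε : ℝ, 0 < ε → ∃ M : ℕ, ∀ g, (∀ n : Fin 2 → ℤ, |n 0| ≤ M ∧ |n 1| ≤ M → coeff n g = 0) →
        ‖U g‖ ≤ ε * ‖g‖ := by
  obtain ⟨c, hc, K, hlow⟩ := exists_lower_bound hline hsupp hell
  have hne := support_nonempty hline hsupp
  have hQ := fun {σ τ : ℤ} (hσ : σ = 1 ∨ σ = -1) (hτ : τ = 1 ∨ τ = -1) =>
    exists_quotient_mult_quadrant hsupp hne hc hlow hr hσ hτ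
  obtain ⟨U₁, h₁, s₁⟩ := hQ (Or.inl rfl) (Or.inl rfl)
  obtain ⟨U₂, h₂, s₂⟩ := hQ (Or.inl rfl) (Or.inr rfl)
  obtain ⟨U₃, h₃, s₃⟩ := hQ (Or.inr rfl) (Or.inl rfl)
  obtain ⟨U₄, h₄, s₄⟩ := hQ (Or.inr rfl) (Or.inr rfl)
  refine ⟨U₁ + U₂ + (U₃ + U₄), fun n g => ?_, fun ε hε => ?_⟩
  · simp only [_root_.add_apply, map_add, h₁, h₂, h₃, h₄, ← add_mul]
    congr 1
    rcases lt_trichotomy (n 0) 0 with h | h | h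
    · rcases lt_trichotomy (n 1) 0 with h' | h' | h'
      · simp [h, h', h.ne, h'.ne, h.not_gt, h'.not_gt]
      · simp [h']
      · simp [h, h', h.ne, h'.ne', h.not_gt, h'.not_gt]
    · simp [h]
    · rcases lt_trichotomy (n 1) 0 with h' | h' | h'
      · simp [h, h', h.ne', h'.ne, h.not_gt, h'.not_gt]
      · simp [h']
      · simp [h, h', h.ne', h'.ne', h.not_gt, h'.not_gt]
  · have hε4 : 0 < ε / 4 := by linarith
    obtain ⟨M₁, m₁⟩ := s₁ _ hε4
    obtain ⟨M₂, m₂⟩ := s₂ _ hε4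
    obtain ⟨M₃, m₃⟩ := s₃ _ hε4
    obtain ⟨M₄, m₄⟩ := s₄ _ hε4
    refine ⟨M₁ + M₂ + M₃ + M₄, fun g hg => ?_⟩
    have a₁ := m₁ g fun n hn => hg n ⟨by push_cast; linarith [hn.1], by push_cast; linarith [hn.2]⟩
    have a₂ := m₂ g fun n hn => hg n ⟨by push_cast; linarith [hn.1], by push_cast; linarith [hn.2]⟩
    have a₃ := m₃ g fun n hn => hg n ⟨by push_cast; linarith [hn.1], by push_cast; linarith [hn.2]⟩
    have a₄ := m₄ g fun n hn => hg n ⟨by push_cast; linarith [hn.1], by push_cast; linarith [hn.2]⟩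
    simp only [_root_.add_apply]
    have b₁ := norm_add_le (U₁ g + U₂ g) (U₃ g + U₄ g)
    have b₂ := norm_add_le (U₁ g) (U₂ g)
    have b₃ := norm_add_le (U₃ g) (U₄ g)
    linarith

end Estimates

/-! ### Consequences of the multiplier bounds for subordinate operators -/

section Subordinate

variable {l : ℕ} {T : Fin l → DiffOp}

/-- The principal part does not vanish at high frequencies. -/
theorem exists_charPoly_ne_zero (hline : ∃ a b, IsAdmissible T a b) {R : DiffOp}
    (hsupp : ∀ α, α ∈ R.support ↔ toPoint α ∈ points T ∩ core T)
    (hell : ∀ a b : ℝ, IsAdmissible T a b → ∀ x y : ℝ, x ≠ 0 → y ≠ 0 →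
      (seniorPart a b R).charPoly x y ≠ 0) :
    ∃ M : ℕ, ∀ n : Fin 2 → ℤ, n 0 ≠ 0 → n 1 ≠ 0 → (M < |n 0| ∨ M < |n 1|) →
      R.charPoly (n 0) (n 1) ≠ 0 := by
  obtain ⟨c, hc, K, hlow⟩ := exists_lower_bound hline hsupp hell
  have hne := support_nonempty hline hsupp
  refine ⟨⌈K⌉₊, fun n h0 h1 hn hzero => ?_⟩
  have one_le : ∀ m : ℤ, m ≠ 0 → (1 : ℝ) ≤ |(m : ℝ)| := fun m hm => by
    exact_mod_cast Int.one_le_abs hm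
  have hK : ∀ m : ℤ, (⌈K⌉₊ : ℤ) < |m| → K ≤ |(m : ℝ)| := fun m hm => by
    have : ((⌈K⌉₊ : ℤ) : ℝ) < ((|m| : ℤ) : ℝ) := by exact_mod_cast hm
    push_cast at this
    exact (Nat.le_ceil K).trans this.le
  have h := hlow (n 0) (n 1) (one_le _ h0) (one_le _ h1) (hn.imp (hK _) (hK _))
  rw [hzero, norm_zero] at h
  have hpos : 0 < ∑ α ∈ R.support, |(n 0 : ℝ)| ^ α 0 * |(n 1 : ℝ)| ^ α 1 := by
    refine Finset.sum_pos (fun α _ => ?_) hne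
    have := one_le _ h0
    have := one_le _ h1
    positivity
  nlinarith

/-- The estimate for strictly subordinate operators. -/
theorem strictly_subordinate_estimate (hline : ∃ a b, IsAdmissible T a b) {R r : DiffOp}
    (hsupp : ∀ α, α ∈ R.support ↔ toPoint α ∈ points T ∩ core T)
    (hell : ∀ a b : ℝ, IsAdmissible T a b → ∀ x y : ℝ, x ≠ 0 → y ≠ 0 →
      (seniorPart a b R).charPoly x y ≠ 0)
    (hr : IsStrictlySubordinate T r) {ε : ℝ} (hε : 0 < ε) :
    ∃ M : ℕ, ∀ f g : CT, (∀ n : Fin 2 → ℤ, n 0 = 0 ∨ n 1 = 0 → coeff n f = 0) →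
      (∀ n : Fin 2 → ℤ, |n 0| ≤ M ∧ |n 1| ≤ M → coeff n f = 0) → MapsCT R f g →
      ∃ h : CT, MapsCT r f h ∧ ‖h‖ ≤ ε * ‖g‖ := by
  obtain ⟨U, hU, hsmall⟩ := exists_quotient_mult hline hsupp hell hr
  obtain ⟨M₁, hM₁⟩ := exists_charPoly_ne_zero hline hsupp hell
  obtain ⟨M₂, hM₂⟩ := hsmall ε hε
  -- `M₁` ensures that `R` does not vanish on the spectrum of `f`, so that `r / R` times `R` is `r`
  -- there; `M₂` provides the small norm.
  refine ⟨max M₁ M₂, fun f g hf hM hg => ⟨U g, fun n => ?_, hM₂ g fun n hn => ?_⟩⟩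
  · rw [hU, hg n]
    by_cases hz : coeff n f = 0
    · simp [hz]
    · have h1 : n 0 ≠ 0 ∧ n 1 ≠ 0 := not_or.1 fun h => hz (hf n h)
      have h2 : ¬(|n 0| ≤ (max M₁ M₂ : ℕ) ∧ |n 1| ≤ (max M₁ M₂ : ℕ)) := fun h => hz (hM n h)
      have h3 := hM₁ n h1.1 h1.2 (by
        push_cast at h2
        by_contra! hc
        exact h2 ⟨hc.1.trans (le_max_left _ _), hc.2.trans (le_max_left _ _)⟩)
      rw [if_pos h1, ← mul_assoc, div_mul_cancel₀ _ h3]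
  · rw [hg n, hM n ⟨hn.1.trans (by exact_mod_cast le_max_right _ _),
      hn.2.trans (by exact_mod_cast le_max_right _ _)⟩, mul_zero]

/-- `r` is dominated by `R` with arbitrarily small constants on functions with the spectrum in
`{|m| > M, |n| > M}`. -/
def IsSmall (R r : DiffOp) : Prop :=
  ∀ ε : ℝ, 0 < ε → ∃ M : ℕ, ∀ f g : CT,
    (∀ n : Fin 2 → ℤ, |n 0| ≤ M ∨ |n 1| ≤ M → coeff n f = 0) → MapsCT R f g →
      ∃ h : CT, MapsCT r f h ∧ ‖h‖ ≤ ε * ‖g‖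

theorem IsSmall.add {R r r' : DiffOp} (h : IsSmall R r) (h' : IsSmall R r') :
    IsSmall R (r + r') := by
  intro ε hε
  obtain ⟨M, hM⟩ := h (ε / 2) (half_pos hε)
  obtain ⟨M', hM'⟩ := h' (ε / 2) (half_pos hε)
  refine ⟨max M M', fun f g hf hg => ?_⟩
  obtain ⟨k, hk, hk'⟩ := hM f g (fun n hn => hf n (hn.imp
    (fun h => h.trans (by exact_mod_cast le_max_left _ _))
    (fun h => h.trans (by exact_mod_cast le_max_left _ _)))) hg
  obtain ⟨k', hk2, hk2'⟩ := hM' f g (fun n hn => hf n (hn.imp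
    (fun h => h.trans (by exact_mod_cast le_max_right _ _))
    (fun h => h.trans (by exact_mod_cast le_max_right _ _)))) hg
  refine ⟨k + k', fun n => ?_, (norm_add_le _ _).trans (by linarith)⟩
  rw [map_add, hk, hk2, charPoly_add, add_mul]

theorem IsSmall.smul {R r : DiffOp} (c : ℂ) (h : IsSmall R r) : IsSmall R (c • r) := by
  intro ε hε
  obtain ⟨M, hM⟩ := h (ε / (‖c‖ + 1)) (by positivity)
  refine ⟨M, fun f g hf hg => ?_⟩
  obtain ⟨k, hk, hk'⟩ := hM f g hf hg
  refine ⟨c • k, fun n => ?_, ?_⟩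
  · rw [map_smul, hk, charPoly_smul, smul_eq_mul, mul_assoc]
  · rw [norm_smul]
    refine (mul_le_mul_of_nonneg_left hk' (norm_nonneg c)).trans ?_
    rw [← mul_assoc]
    refine mul_le_mul_of_nonneg_right ?_ (norm_nonneg g)
    rw [mul_div_assoc', div_le_iff₀ (by positivity)]
    nlinarith [norm_nonneg c]

theorem isSmall_zero (R : DiffOp) : IsSmall R 0 := fun ε hε =>
  ⟨0, fun f g _ _ => ⟨0, fun n => by simp [DiffOp.charPoly],
    by rw [norm_zero]; exact mul_nonneg hε.le (norm_nonneg g)⟩⟩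

theorem isSmall_sum {ι : Type*} {R : DiffOp} {s : Finset ι} {r : ι → DiffOp}
    (h : ∀ i ∈ s, IsSmall R (r i)) : IsSmall R (∑ i ∈ s, r i) :=
  Finset.sum_induction r (IsSmall R) (fun _ _ => IsSmall.add) (isSmall_zero R) h

theorem monomial_eq_smul (α : Fin 2 →₀ ℕ) (c : ℂ) :
    (MvPolynomial.monomial α c : DiffOp) = c • MvPolynomial.monomial α 1 := by
  rw [MvPolynomial.smul_monomial, smul_eq_mul, mul_one]

theorem isSmall_of_strict (hline : ∃ a b, IsAdmissible T a b) {R r : DiffOp}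
    (hsupp : ∀ α, α ∈ R.support ↔ toPoint α ∈ points T ∩ core T)
    (hell : ∀ a b : ℝ, IsAdmissible T a b → ∀ x y : ℝ, x ≠ 0 → y ≠ 0 →
      (seniorPart a b R).charPoly x y ≠ 0)
    (hr : IsStrictlySubordinate T r) : IsSmall R r := by
  intro ε hε
  obtain ⟨M, hM⟩ := strictly_subordinate_estimate hline hsupp hell hr hε
  refine ⟨M, fun f g hf hg => hM f g (fun n hn => hf n ?_) (fun n hn => hf n (Or.inl hn.1)) hg⟩
  rcases hn with h | h
  · left; rw [h]; simp
  · right; rw [h]; simp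

theorem isStrictlySubordinate_monomial {α : Fin 2 →₀ ℕ} (h0 : toPoint α ∉ core T)
    (h : ∃ q ∈ core T, toPoint α ≤ q) (h1 : ∃ q ∈ core T, (toPoint α).1 < q.1)
    (h2 : ∃ q ∈ core T, (toPoint α).2 < q.2) (c : ℂ) :
    IsStrictlySubordinate T (MvPolynomial.monomial α c) := by
  classical
  have hs : ∀ β ∈ (MvPolynomial.monomial α c : DiffOp).support, β = α := fun β hβ => by
    have := MvPolynomial.support_monomial_subset hβ
    simpa using this
  obtain ⟨q, hq, hle⟩ := h
  refine ⟨fun β hβ => ?_, fun β hβ => ?_⟩ <;> rw [hs β hβ]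
  · exact ⟨h0, q, hq, hle⟩
  · exact ⟨h1, h2⟩

theorem toPoint_le {α β : Fin 2 →₀ ℕ} : toPoint α ≤ toPoint β ↔ α ≤ β := by
  rw [Prod.le_def, Finsupp.le_def, Fin.forall_fin_two]
  simp [toPoint]

theorem charMon_add (α β : Fin 2 →₀ ℕ) (x y : ℝ) :
    charMon (α + β) x y = charMon α x y * charMon β x y := by
  simp only [charMon, Finsupp.add_apply, pow_add]
  ring

theorem charMon_single (j : Fin 2) (c : ℕ) (n : Fin 2 → ℤ) :
    charMon (Finsupp.single j c) (n 0) (n 1) = (2 * Real.pi * Complex.I * n j) ^ c := by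
  fin_cases j <;> simp [charMon]

/-- A multiindex that lies below a vertex of the core which is extremal in the `i`-th
coordinate. -/
theorem isSmall_of_extremal {R : DiffOp} {i j : Fin 2} (hij : i ≠ j)
    (hsupp : ∀ α, α ∈ R.support ↔ toPoint α ∈ points T ∩ core T)
    (hstrict : ∀ (α : Fin 2 →₀ ℕ) (c : ℂ), toPoint α ∉ core T → (∃ β ∈ R.support, α ≤ β) →
      (∃ β ∈ R.support, α i < β i) → (∃ β ∈ R.support, α j < β j) →
      IsSmall R (MvPolynomial.monomial α c))
    {α q : Fin 2 →₀ ℕ} (hα : toPoint α ∉ core T) (hq : q ∈ R.support) (hαq : α ≤ q)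
    (hi : α i = q i) (hmax : ∀ p ∈ R.support, p i ≤ q i) :
    IsSmall R (MvPolynomial.monomial α 1) := by
  classical
  have hall : ∀ {β γ : Fin 2 →₀ ℕ}, β i ≤ γ i → β j ≤ γ j → β ≤ γ := by
    intro β γ h1 h2
    rw [Finsupp.le_def]
    intro s
    have : s = i ∨ s = j := by omega
    rcases this with rfl | rfl
    exacts [h1, h2]
  have hj : α j < q j := by
    refine lt_of_le_of_ne (hαq j) fun h => hα ?_
    have : α = q := le_antisymm hαq (hall hi.ge h.ge)
    rw [this]
    exact ((hsupp q).1 hq).2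
  obtain ⟨c, hc⟩ : ∃ c, q j = α j + (c + 1) := ⟨q j - α j - 1, by omega⟩
  have hqα : q = α + Finsupp.single j (c + 1) := by
    refine le_antisymm (hall ?_ ?_) (hall ?_ ?_) <;> simp [hij, hi, hc]
  have hp : ∀ p ∈ R.support.erase q, p i < q i ∧ q j < p j := by
    intro p hp
    obtain ⟨hne, hp⟩ := Finset.mem_erase.1 hp
    have c1 := ((hsupp p).1 hp).2
    have c2 := ((hsupp q).1 hq).2
    have n1 := not_le_of_core c1 c2 fun h => hne (toPoint_injective h)
    have n2 := not_le_of_core c2 c1 fun h => hne (toPoint_injective h).symm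
    rw [toPoint_le] at n1 n2
    have h1 := hmax p hp
    have h2 : q j < p j := by
      by_contra! h
      exact n1 (hall h1 h)
    exact ⟨lt_of_le_of_ne h1 fun h => n2 (hall h.ge h2.le), h2⟩
  have hsub : ∀ p ∈ R.support.erase q,
      p - Finsupp.single j (c + 1) + Finsupp.single j (c + 1) = p := by
    intro p hpe
    refine tsub_add_cancel_of_le (hall ?_ ?_)
    · simp [hij]
    · have := (hp p hpe).2
      simp only [Finsupp.single_eq_same]
      omega
  -- Lowering the `j`-th exponents moves the other monomials strictly below the core; they stay
  -- strictly to the inner side of `q` in the `i`-th coordinate, so `rest` is strictly subordinate.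
  set rest : DiffOp := ∑ p ∈ R.support.erase q,
    MvPolynomial.monomial (p - Finsupp.single j (c + 1)) (R.coeff p) with hrest
  have hrest_small : IsSmall R rest := by
    refine isSmall_sum fun p hpe => ?_
    have hpR := Finset.mem_of_mem_erase hpe
    obtain ⟨h1, h2⟩ := hp p hpe
    have hlt : (p - Finsupp.single j (c + 1)) j < p j := by
      simp only [Finsupp.tsub_apply, Finsupp.single_eq_same]
      omega
    refine hstrict _ _ ?_ ⟨p, hpR, tsub_le_self⟩ ⟨q, hq, ?_⟩ ⟨p, hpR, hlt⟩
    · refine core_lt_of_lt ((hsupp p).1 hpR).2 (toPoint_le.2 tsub_le_self) fun h => ?_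
      rw [toPoint_injective h] at hlt
      exact lt_irrefl _ hlt
    · simpa [hij] using h1
  have hcq : R.coeff q ≠ 0 := MvPolynomial.mem_support_iff.1 hq
  have hR : ∀ n : Fin 2 → ℤ, R.charPoly (n 0) (n 1) = (2 * Real.pi * Complex.I * n j) ^ (c + 1)
      * (R.coeff q * charMon α (n 0) (n 1) + rest.charPoly (n 0) (n 1)) := by
    intro n
    have e1 : rest.charPoly (n 0) (n 1) = ∑ p ∈ R.support.erase q,
        R.coeff p * charMon (p - Finsupp.single j (c + 1)) (n 0) (n 1) := by
      rw [hrest, DiffOp.charPoly, map_sum]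
      refine Finset.sum_congr rfl fun p _ => ?_
      exact charPoly_monomial _ _ _ _
    rw [e1, charPoly_eq_sum, ← Finset.add_sum_erase _ _ hq, mul_add, Finset.mul_sum]
    congr 1
    · conv_lhs => rw [hqα]
      rw [charMon_add, charMon_single, ← hqα]
      ring
    · refine Finset.sum_congr rfl fun p hpe => ?_
      conv_lhs => rw [← hsub p hpe]
      rw [charMon_add, charMon_single, hsub p hpe]
      ring
  obtain ⟨V, hV, hVsmall⟩ := exists_integration_pow j c
  have hcpos : 0 < ‖R.coeff q‖ := norm_pos_iff.2 hcq
  intro ε hε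
  obtain ⟨M₁, hM₁⟩ := hVsmall (‖R.coeff q‖ * (ε / 2)) (by positivity)
  obtain ⟨M₂, hM₂⟩ := hrest_small (‖R.coeff q‖ * (ε / 2)) (by positivity)
  refine ⟨max M₁ M₂, fun f g hf hg => ?_⟩
  have hfor : ∀ n : Fin 2 → ℤ, |n j| ≤ (max M₁ M₂ : ℕ) → coeff n f = 0 := by
    intro n hn
    refine hf n ?_
    have : j = 0 ∨ j = 1 := by omega
    rcases this with rfl | rfl
    exacts [Or.inl hn, Or.inr hn]
  have hg1 := hM₁ g fun n hn => by
    rw [hg n, hfor n (hn.trans (by exact_mod_cast le_max_left _ _)), mul_zero]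
  obtain ⟨k, hk, hk'⟩ := hM₂ f g (fun n hn => hf n (hn.imp
    (fun h => h.trans (by exact_mod_cast le_max_right _ _))
    (fun h => h.trans (by exact_mod_cast le_max_right _ _)))) hg
  -- Solve `R = ∂_j^(c+1) (a_q ∂^α + rest)` for `∂^α f`: `V` inverts the power of `∂_j`, and `k`
  -- stands for `rest f`.
  refine ⟨(R.coeff q)⁻¹ • (V g - k), fun n => ?_, ?_⟩
  · rw [map_smul, map_sub, hV, hg n, hk n, hR n, charPoly_monomial, one_mul, smul_eq_mul]
    by_cases hz : coeff n f = 0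
    · simp [hz]
    · have hn : n j ≠ 0 := fun h => hz (hfor n (by rw [h]; simp))
      have hne : (2 * Real.pi * Complex.I * n j : ℂ) ≠ 0 := by
        simp [Real.pi_ne_zero, hn]
      field_simp
      ring
  · rw [norm_smul, norm_inv, inv_mul_le_iff₀ hcpos]
    refine (norm_sub_le _ _).trans ?_
    linarith

/-- On the link containing `p` the first coordinate is maximal at a multiindex, whose first
coordinate must equal that of `p`. The antichain property then identifies the two points. -/
theorem extremal_fst_mem_points {p : ℝ × ℝ} (hp : p ∈ core T) (hmax : ∀ q ∈ core T, q.1 ≤ p.1) :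
    p ∈ points T := by
  obtain ⟨a, b, hab, hh⟩ := hp
  obtain ⟨q, hq, hle⟩ := exists_ge_of_mem_convexHull
    ((finite_points T).subset Set.inter_subset_left) hh 1 0
  have h1 := hmax q (mem_core_of_mem_line hab hq.1 hq.2)
  have h2 : q.1 = p.1 := by linarith
  have h3 := not_le_of_core (mem_core_of_mem_line hab hq.1 hq.2) ⟨a, b, hab, hh⟩
  have h4 := not_le_of_core ⟨a, b, hab, hh⟩ (mem_core_of_mem_line hab hq.1 hq.2)
  by_contra hc
  have hne : q ≠ p := by rintro rfl; exact hc hq.1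
  rcases le_total q.2 p.2 with h | h
  · exact h3 hne ⟨h2.le, h⟩
  · exact h4 hne.symm ⟨h2.ge, h⟩

theorem extremal_snd_mem_points {p : ℝ × ℝ} (hp : p ∈ core T) (hmax : ∀ q ∈ core T, q.2 ≤ p.2) :
    p ∈ points T := by
  obtain ⟨a, b, hab, hh⟩ := hp
  obtain ⟨q, hq, hle⟩ := exists_ge_of_mem_convexHull
    ((finite_points T).subset Set.inter_subset_left) hh 0 1
  have h1 := hmax q (mem_core_of_mem_line hab hq.1 hq.2)
  have h2 : q.2 = p.2 := by linarith
  have h3 := not_le_of_core (mem_core_of_mem_line hab hq.1 hq.2) ⟨a, b, hab, hh⟩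
  have h4 := not_le_of_core ⟨a, b, hab, hh⟩ (mem_core_of_mem_line hab hq.1 hq.2)
  by_contra hc
  have hne : q ≠ p := by rintro rfl; exact hc hq.1
  rcases le_total q.1 p.1 with h | h
  · exact h3 hne ⟨h, h2.le⟩
  · exact h4 hne.symm ⟨h, h2.ge⟩

/-- The estimate for subordinate operators. -/
theorem isSmall_of_subordinate (hline : ∃ a b, IsAdmissible T a b) {R r : DiffOp}
    (hsupp : ∀ α, α ∈ R.support ↔ toPoint α ∈ points T ∩ core T)
    (hell : ∀ a b : ℝ, IsAdmissible T a b → ∀ x y : ℝ, x ≠ 0 → y ≠ 0 →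
      (seniorPart a b R).charPoly x y ≠ 0)
    (hr : IsSubordinate T r) : IsSmall R r := by
  rw [r.as_sum]
  refine isSmall_sum fun α hα => ?_
  rw [monomial_eq_smul]
  refine IsSmall.smul _ ?_
  obtain ⟨hα0, q, hq, hle1, hle2⟩ := hr α hα
  have lift1 : ∀ {β : Fin 2 →₀ ℕ} {n : ℕ}, β ∈ R.support → n < β 0 →
      ∃ q ∈ core T, (n : ℝ) < q.1 := fun {β n} hβ h =>
    ⟨toPoint β, ((hsupp β).1 hβ).2, by simpa [toPoint] using h⟩
  have lift2 : ∀ {β : Fin 2 →₀ ℕ} {n : ℕ}, β ∈ R.support → n < β 1 →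
      ∃ q ∈ core T, (n : ℝ) < q.2 := fun {β n} hβ h =>
    ⟨toPoint β, ((hsupp β).1 hβ).2, by simpa [toPoint] using h⟩
  by_cases h1 : ∃ q ∈ core T, (toPoint α).1 < q.1
  · by_cases h2 : ∃ q ∈ core T, (toPoint α).2 < q.2
    · exact isSmall_of_strict hline hsupp hell
        (isStrictlySubordinate_monomial hα0 ⟨q, hq, hle1, hle2⟩ h1 h2 1)
    -- Here the exponent lies on the horizontal boundary segment, and `q` has the largest second
    -- coordinate on the core, so it is a multiindex and the extremal case applies.
    · push Not at h2
      obtain ⟨j, β, hβ, rfl⟩ := extremal_snd_mem_points hq fun z hz => (h2 z hz).trans hle2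
      have hβR : β ∈ R.support := (hsupp β).2 ⟨⟨j, β, hβ, rfl⟩, hq⟩
      refine isSmall_of_extremal (i := 1) (j := 0) (by decide) hsupp ?_ hα0 hβR
        (toPoint_le.1 ⟨hle1, hle2⟩) ?_ ?_
      · rintro γ c h0 ⟨β', hβ', h⟩ ⟨β1, hβ1, g1⟩ ⟨β2, hβ2, g2⟩
        exact isSmall_of_strict hline hsupp hell (isStrictlySubordinate_monomial h0
          ⟨_, ((hsupp β').1 hβ').2, toPoint_le.2 h⟩ (lift1 hβ2 g2) (lift2 hβ1 g1) c)
      · have := le_antisymm hle2 (h2 _ hq)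
        simpa [toPoint] using this
      · intro p hp
        have := (h2 _ ((hsupp p).1 hp).2).trans hle2
        simpa [toPoint] using this
  · push Not at h1
    obtain ⟨j, β, hβ, rfl⟩ := extremal_fst_mem_points hq fun z hz => (h1 z hz).trans hle1
    have hβR : β ∈ R.support := (hsupp β).2 ⟨⟨j, β, hβ, rfl⟩, hq⟩
    refine isSmall_of_extremal (i := 0) (j := 1) (by decide) hsupp ?_ hα0 hβR
      (toPoint_le.1 ⟨hle1, hle2⟩) ?_ ?_
    · rintro γ c h0 ⟨β', hβ', h⟩ ⟨β1, hβ1, g1⟩ ⟨β2, hβ2, g2⟩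
      exact isSmall_of_strict hline hsupp hell (isStrictlySubordinate_monomial h0
        ⟨_, ((hsupp β').1 hβ').2, toPoint_le.2 h⟩ (lift1 hβ1 g1) (lift2 hβ2 g2) c)
    · have := le_antisymm hle1 (h1 _ hq)
      simpa [toPoint] using this
    · intro p hp
      have := (h1 _ ((hsupp p).1 hp).2).trans hle1
      simpa [toPoint] using this

end Subordinate

/-! ### Diagonal operators on trigonometric polynomials -/

section Diagonal

theorem trig_induction {p : CT → Prop} (h0 : p 0) (hadd : ∀ f g, p f → p g → p (f + g))
    (hsmul : ∀ (c : ℂ) f, p f → p (c • f)) (hexpo : ∀ k, p (expo k)) {f : CT} (hf : f ∈ trig) :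
    p f := by
  have hf' : f ∈ Submodule.span ℂ (Set.range expo) := hf
  induction hf' using Submodule.span_induction with
  | mem f hf' => obtain ⟨k, rfl⟩ := hf'; exact hexpo k
  | zero => exact h0
  | add f g hf1 hg1 h1 h2 => exact hadd f g (h1 hf1) (h2 hg1)
  | smul c f hf1 h1 => exact hsmul c f (h1 hf1)

theorem exists_diag (σ : (Fin 2 → ℤ) → ℂ) {f : CT} (hf : f ∈ trig) :
    ∃ g ∈ trig, ∀ n, coeff n g = σ n * coeff n f := by
  refine trig_induction (p := fun f => ∃ g ∈ trig, ∀ n, coeff n g = σ n * coeff n f)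
    ⟨0, trig.zero_mem, fun n => by simp⟩ ?_ ?_ ?_ hf
  · rintro f g ⟨f', hf', hf⟩ ⟨g', hg', hg⟩
    exact ⟨f' + g', trig.add_mem hf' hg', fun n => by rw [map_add, hf, hg, map_add, mul_add]⟩
  · rintro c f ⟨f', hf', hf⟩
    exact ⟨c • f', trig.smul_mem c hf', fun n => by
      rw [map_smul, map_smul, hf, smul_eq_mul, smul_eq_mul, mul_left_comm]⟩
  · intro k
    refine ⟨σ k • expo k, trig.smul_mem _ (expo_mem k), fun n => ?_⟩
    rw [map_smul, coeff_expo, smul_eq_mul]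
    split_ifs with h
    · rw [h]
    · simp

/-- The diagonal operator with symbol `σ` on trigonometric polynomials. -/
def diag (σ : (Fin 2 → ℤ) → ℂ) : trig →ₗ[ℂ] trig where
  toFun f := ⟨(exists_diag σ f.2).choose, (exists_diag σ f.2).choose_spec.1⟩
  map_add' f g := by
    apply Subtype.ext
    apply eq_of_coeff_eq
    intro n
    refine ((exists_diag σ (f + g).2).choose_spec.2 n).trans ?_
    simp only [Submodule.coe_add, map_add, (exists_diag σ f.2).choose_spec.2,
      (exists_diag σ g.2).choose_spec.2]
    ring
  map_smul' c f := by
    apply Subtype.ext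
    apply eq_of_coeff_eq
    intro n
    refine ((exists_diag σ (c • f).2).choose_spec.2 n).trans ?_
    simp only [Submodule.coe_smul, map_smul, (exists_diag σ f.2).choose_spec.2,
      RingHom.id_apply, smul_eq_mul]
    ring

theorem coeff_diag (σ : (Fin 2 → ℤ) → ℂ) (f : trig) (n : Fin 2 → ℤ) :
    coeff n (diag σ f : CT) = σ n * coeff n (f : CT) :=
  (exists_diag σ f.2).choose_spec.2 n

theorem trig_ext {f g : trig} (h : ∀ n, coeff n (f : CT) = coeff n (g : CT)) : f = g :=
  Subtype.ext (eq_of_coeff_eq h)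

theorem diag_congr {σ τ : (Fin 2 → ℤ) → ℂ} {f : trig} {S : Set (Fin 2 → ℤ)}
    (hf : (f : CT) ∈ spectralSpace S) (h : ∀ n ∈ S, σ n = τ n) : diag σ f = diag τ f := by
  apply trig_ext
  intro n
  rw [coeff_diag, coeff_diag]
  by_cases hn : n ∈ S
  · rw [h n hn]
  · rw [mem_spectralSpace.1 hf n hn, mul_zero, mul_zero]

theorem diag_add (σ τ : (Fin 2 → ℤ) → ℂ) (f : trig) :
    diag (σ + τ) f = diag σ f + diag τ f := by
  apply trig_ext
  intro n
  rw [Submodule.coe_add, map_add, coeff_diag, coeff_diag, coeff_diag, Pi.add_apply, add_mul]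

theorem diag_smul (c : ℂ) (σ : (Fin 2 → ℤ) → ℂ) (f : trig) :
    diag (c • σ) f = c • diag σ f := by
  apply trig_ext
  intro n
  rw [Submodule.coe_smul, map_smul, coeff_diag, coeff_diag, Pi.smul_apply, smul_eq_mul,
    smul_eq_mul, mul_assoc]

theorem diag_zero (f : trig) : diag 0 f = 0 := by
  apply trig_ext
  intro n
  rw [coeff_diag]
  simp

theorem diag_mem_spectralSpace {σ : (Fin 2 → ℤ) → ℂ} {f : trig} {S : Set (Fin 2 → ℤ)}
    (hf : (f : CT) ∈ spectralSpace S) : (diag σ f : CT) ∈ spectralSpace S := by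
  rw [mem_spectralSpace]
  intro n hn
  rw [coeff_diag, mem_spectralSpace.1 hf n hn, mul_zero]

open Classical in
/-- The restriction of the spectrum of a trigonometric polynomial to `S`. -/
def cut (S : Set (Fin 2 → ℤ)) : trig →ₗ[ℂ] trig := diag (fun n => if n ∈ S then 1 else 0)

open Classical in
theorem coeff_cut (S : Set (Fin 2 → ℤ)) (f : trig) (n : Fin 2 → ℤ) :
    coeff n (cut S f : CT) = if n ∈ S then coeff n (f : CT) else 0 := by
  rw [cut, coeff_diag]
  split_ifs <;> simp

theorem cut_mem (S : Set (Fin 2 → ℤ)) (f : trig) : (cut S f : CT) ∈ spectralSpace S := by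
  rw [mem_spectralSpace]
  intro n hn
  rw [coeff_cut, if_neg hn]

theorem cut_add_cut_compl (S : Set (Fin 2 → ℤ)) (f : trig) : cut S f + cut Sᶜ f = f := by
  apply trig_ext
  intro n
  rw [Submodule.coe_add, map_add, coeff_cut, coeff_cut]
  by_cases hn : n ∈ S <;> simp [hn]

theorem cut_mem_of_mem {S S' : Set (Fin 2 → ℤ)} {f : trig} (hf : (f : CT) ∈ spectralSpace S') :
    (cut S f : CT) ∈ spectralSpace (S' ∩ S) := by
  rw [mem_spectralSpace]
  intro n hn
  rw [coeff_cut]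
  split_ifs with h
  · exact mem_spectralSpace.1 hf n fun h' => hn ⟨h', h⟩
  · rfl

theorem IsBddSet.diag_cut {S : Set (Fin 2 → ℤ)} (h : IsBddSet S) (σ : (Fin 2 → ℤ) → ℂ)
    (f : trig) : (diag σ (cut S f) : CT) = h.proj (diag σ f : CT) := by
  apply eq_of_coeff_eq
  intro n
  rw [coeff_diag, coeff_cut, h.coeff_proj, coeff_diag]
  split_ifs <;> simp

theorem IsBddSet.norm_diag_cut_le {S : Set (Fin 2 → ℤ)} (h : IsBddSet S) (σ : (Fin 2 → ℤ) → ℂ)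
    (f : trig) : ‖diag σ (cut S f)‖ ≤ ‖h.proj‖ * ‖diag σ f‖ := by
  have := h.proj.le_opNorm (diag σ f : CT)
  rw [← h.diag_cut σ f] at this
  exact this

end Diagonal

/-! ### Two families of symbols that define equivalent seminorms -/

section Equivalence

variable {ι : Type*}

/-- On trigonometric polynomials with spectrum in `S`, the norm `‖q f‖` is equivalent to
`max_j ‖p_j f‖`. -/
def EquivOn (p : ι → (Fin 2 → ℤ) → ℂ) (S : Set (Fin 2 → ℤ)) (q : (Fin 2 → ℤ) → ℂ) : Prop :=
  ∃ C : ℝ, 0 ≤ C ∧ ∀ f : trig, (f : CT) ∈ spectralSpace S →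
    (∀ j, ‖diag (p j) f‖ ≤ C * ‖diag q f‖) ∧
    ∀ B : ℝ, (∀ j, ‖diag (p j) f‖ ≤ B) → ‖diag q f‖ ≤ C * B

variable {p : ι → (Fin 2 → ℤ) → ℂ} {S S' : Set (Fin 2 → ℤ)} {q q' : (Fin 2 → ℤ) → ℂ}

theorem spectralSpace_mono (h : S ⊆ S') : spectralSpace S ≤ spectralSpace S' := fun f hf => by
  rw [mem_spectralSpace] at hf ⊢
  exact fun n hn => hf n fun h' => hn (h h')

theorem EquivOn.mono (h : EquivOn p S' q) (hS : S ⊆ S') : EquivOn p S q := by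
  obtain ⟨C, hC, h⟩ := h
  exact ⟨C, hC, fun f hf => h f (spectralSpace_mono hS hf)⟩

theorem EquivOn.congr (h : EquivOn p S q) (hq : ∀ n ∈ S, q n = q' n) : EquivOn p S q' := by
  obtain ⟨C, hC, h⟩ := h
  refine ⟨C, hC, fun f hf => ?_⟩
  rw [← diag_congr hf hq]
  exact h f hf

-- Cutting the spectrum by `S` costs only the norms of two projections, so the symbols may be chosen
-- independently on `S` and on `S' \ S`.
open Classical in
theorem EquivOn.glue [Nonempty ι] (h : EquivOn p S q) (h' : EquivOn p S' q') (hS : IsBddSet S) :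
    EquivOn p (S ∪ S') (fun n => if n ∈ S then q n else q' n) := by
  set Q : (Fin 2 → ℤ) → ℂ := fun n => if n ∈ S then q n else q' n with hQ
  obtain ⟨C, hC, h⟩ := h.congr (q' := Q) fun n hn => by simp [hQ, hn]
  obtain ⟨C', hC', h'⟩ := (h'.mono (Set.sdiff_subset (s := S') (t := S))).congr (q' := Q)
    fun n hn => by simp [hQ, hn.2]
  set K := ‖hS.proj‖
  set K' := ‖hS.compl.proj‖
  have hK : 0 ≤ K := norm_nonneg _
  have hK' : 0 ≤ K' := norm_nonneg _
  refine ⟨C * K + C' * K', by positivity, fun f hf => ?_⟩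
  have m1 := cut_mem S f
  have m2 : (cut Sᶜ f : CT) ∈ spectralSpace (S' \ S) :=
    spectralSpace_mono (S := (S ∪ S') ∩ Sᶜ) (S' := S' \ S) (fun n hn => ⟨hn.1.resolve_left hn.2, hn.2⟩)
      (cut_mem_of_mem (S := Sᶜ) hf)
  have hsplit : ∀ σ, ‖diag σ f‖ ≤ ‖diag σ (cut S f)‖ + ‖diag σ (cut Sᶜ f)‖ := fun σ => by
    conv_lhs => rw [← cut_add_cut_compl S f, map_add]
    exact norm_add_le _ _
  have n1 := fun σ => hS.norm_diag_cut_le σ f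
  have n2 := fun σ => hS.compl.norm_diag_cut_le σ f
  constructor
  · intro j
    have a1 := (h _ m1).1 j
    have a2 := (h' _ m2).1 j
    have b1 := mul_le_mul_of_nonneg_left (n1 Q) hC
    have b2 := mul_le_mul_of_nonneg_left (n2 Q) hC'
    have := hsplit (p j)
    nlinarith
  · intro B hB
    have a1 := (h _ m1).2 (K * B) fun j => (n1 _).trans (mul_le_mul_of_nonneg_left (hB j) hK)
    have a2 := (h' _ m2).2 (K' * B) fun j => (n2 _).trans (mul_le_mul_of_nonneg_left (hB j) hK')
    have := hsplit Q
    nlinarith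

/-- A symbol `q` that is comparable with a family of symbols up to small perturbations. -/
theorem equivOn_of_small [Finite ι] (c : ι → ℂ) (j₀ : ι) (hc : c j₀ ≠ 0)
    (h : ∀ j, ∀ f : trig, (f : CT) ∈ spectralSpace S →
      ‖diag (p j - c j • q) f‖ ≤ ‖c j₀‖ / 2 * ‖diag q f‖) : EquivOn p S q := by
  cases nonempty_fintype ι
  have hpos : 0 < ‖c j₀‖ := norm_pos_iff.2 hc
  have hsum : ∀ j, ‖c j‖ ≤ ∑ i, ‖c i‖ := fun j =>
    Finset.single_le_sum (f := fun i => ‖c i‖) (fun i _ => norm_nonneg _) (Finset.mem_univ j)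
  have hs0 : 0 ≤ ∑ i, ‖c i‖ := Finset.sum_nonneg fun i _ => norm_nonneg _
  refine ⟨∑ i, ‖c i‖ + ‖c j₀‖ / 2 + 2 / ‖c j₀‖, by positivity, fun f hf => ?_⟩
  have key : ∀ j, diag (p j - c j • q) f = diag (p j) f - c j • diag q f := fun j => by
    apply trig_ext
    intro n
    rw [AddSubgroupClass.coe_sub, map_sub, coeff_diag, coeff_diag, Submodule.coe_smul, map_smul,
      coeff_diag]
    simp only [Pi.sub_apply, Pi.smul_apply, smul_eq_mul]
    ring
  have hq0 := norm_nonneg (diag q f)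
  have h2 : 0 < 2 / ‖c j₀‖ := by positivity
  constructor
  · intro j
    have h1 := h j f hf
    rw [key] at h1
    have h3 := norm_sub_norm_le (diag (p j) f) (c j • diag q f)
    rw [norm_smul] at h3
    have h4 := mul_le_mul_of_nonneg_right (hsum j) hq0
    have h5 := mul_nonneg h2.le hq0
    linarith [add_mul (∑ i, ‖c i‖ + ‖c j₀‖ / 2) (2 / ‖c j₀‖) ‖diag q f‖,
      add_mul (∑ i, ‖c i‖) (‖c j₀‖ / 2) ‖diag q f‖]
  · intro B hB
    have h1 := h j₀ f hf
    rw [key] at h1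
    have h3 := norm_sub_norm_le (c j₀ • diag q f) (diag (p j₀) f)
    rw [norm_smul, norm_sub_rev] at h3
    have hB0 : 0 ≤ B := (norm_nonneg _).trans (hB j₀)
    have h4 : ‖diag q f‖ ≤ 2 / ‖c j₀‖ * B := by
      rw [div_mul_eq_mul_div, le_div_iff₀ hpos]
      linarith [hB j₀]
    have h5 : 0 ≤ (∑ i, ‖c i‖ + ‖c j₀‖ / 2) * B := by positivity
    linarith [add_mul (∑ i, ‖c i‖ + ‖c j₀‖ / 2) (2 / ‖c j₀‖) B]

/-- There is a symbol that defines an equivalent norm on `S` and whose support in `S` is bounded. -/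
def HasEquiv (p : ι → (Fin 2 → ℤ) → ℂ) (S : Set (Fin 2 → ℤ)) : Prop :=
  IsBddSet S ∧ ∃ q, EquivOn p S q ∧ IsBddSet (S ∩ {n | q n ≠ 0})

theorem HasEquiv.union [Nonempty ι] (h : HasEquiv p S) (h' : HasEquiv p S') :
    HasEquiv p (S ∪ S') := by
  classical
  obtain ⟨hb, q, hq, hqb⟩ := h
  obtain ⟨hb', q', hq', hqb'⟩ := h'
  refine ⟨hb.union hb', _, hq.glue hq' hb, ?_⟩
  convert hqb.union (hqb'.diff hb) using 1
  ext n
  by_cases hn : n ∈ S <;> simp [hn]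

theorem HasEquiv.empty : HasEquiv p ∅ := by
  refine ⟨IsBddSet.empty, 0, ⟨0, le_rfl, fun f hf => ?_⟩, by simpa using IsBddSet.empty⟩
  have : f = 0 := trig_ext fun n => by simpa using mem_spectralSpace.1 hf n (Set.notMem_empty n)
  subst this
  simp

theorem HasEquiv.biUnion [Nonempty ι] {κ : Type*} {s : Set κ} (hs : s.Finite)
    {f : κ → Set (Fin 2 → ℤ)} (h : ∀ i ∈ s, HasEquiv p (f i)) : HasEquiv p (⋃ i ∈ s, f i) := by
  induction s, hs using Set.Finite.induction_on with
  | empty => simpa using HasEquiv.empty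
  | @insert a s _ _ ih =>
    rw [Set.biUnion_insert]
    exact (h a (Set.mem_insert _ _)).union (ih fun i hi => h i (Set.mem_insert_of_mem _ hi))

/-- At one frequency all operators are scalars: `1` serves as the symbol if some `p j` is nonzero
there, and `0` otherwise. -/
theorem HasEquiv.singleton [Finite ι] (n : Fin 2 → ℤ) : HasEquiv p {n} := by
  classical
  cases nonempty_fintype ι
  have hdiag : ∀ σ : (Fin 2 → ℤ) → ℂ, ∀ f : trig, (f : CT) ∈ spectralSpace {n} →
      diag σ f = σ n • f := fun σ f hf => by
    apply trig_ext
    intro k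
    rw [coeff_diag, Submodule.coe_smul, map_smul, smul_eq_mul]
    by_cases hk : k = n
    · rw [hk]
    · rw [mem_spectralSpace.1 hf k hk, mul_zero, mul_zero]
  refine ⟨IsBddSet.singleton n, ?_⟩
  by_cases hex : ∃ j₀, p j₀ n ≠ 0
  · obtain ⟨j₀, hj₀⟩ := hex
    refine ⟨fun _ => 1, equivOn_of_small (fun j => p j n) j₀ hj₀ fun j f hf => ?_,
      (IsBddSet.finite ((Set.finite_singleton n).subset Set.inter_subset_left))⟩
    rw [hdiag _ f hf]
    simp only [Pi.sub_apply, Pi.smul_apply, smul_eq_mul, mul_one, sub_self, zero_smul, norm_zero]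
    positivity
  · push Not at hex
    refine ⟨0, ⟨0, le_rfl, fun f hf => ⟨fun j => ?_, fun B _ => ?_⟩⟩, by simpa using IsBddSet.empty⟩
    · rw [hdiag _ f hf, hex j]; simp
    · rw [diag_zero]; simp

theorem HasEquiv.of_finite [Finite ι] [Nonempty ι] (hS : S.Finite) : HasEquiv p S := by
  have : S = ⋃ k ∈ S, {k} := by simp
  rw [this]
  exact HasEquiv.biUnion hS fun k _ => HasEquiv.singleton k

end Equivalence

/-! ### Equivalent seminorms on lines -/

section Line

variable {ι : Type*}

theorem setOf_lt_abs_subset (k : Fin 2) {M M' : ℕ} (h : M ≤ M') :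
    {n : Fin 2 → ℤ | (M' : ℤ) < |n k|} ⊆ {n | (M : ℤ) < |n k|} := fun n hn => by
  have h1 : (M : ℤ) ≤ M' := Int.ofNat_le.2 h
  have h2 : (M' : ℤ) < |n k| := hn
  exact h1.trans_lt h2

/-- The symbol `σ` is small with respect to `∂_k^d` at high frequencies in the `k`-th variable. -/
def IsSmallSymbol (k : Fin 2) (d : ℕ) (σ : (Fin 2 → ℤ) → ℂ) : Prop :=
  ∀ ε : ℝ, 0 < ε → ∃ M : ℕ, ∀ f : trig, (f : CT) ∈ spectralSpace {n | M < |n k|} →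
    ‖diag σ f‖ ≤ ε * ‖diag (fun n => (2 * Real.pi * Complex.I * n k) ^ d) f‖

theorem isSmallSymbol_zero (k : Fin 2) (d : ℕ) : IsSmallSymbol k d 0 := by
  intro ε hε
  refine ⟨0, fun f _ => ?_⟩
  rw [diag_zero, norm_zero]
  exact mul_nonneg hε.le (norm_nonneg _)

theorem IsSmallSymbol.add {k : Fin 2} {d : ℕ} {σ τ : (Fin 2 → ℤ) → ℂ}
    (hσ : IsSmallSymbol k d σ) (hτ : IsSmallSymbol k d τ) : IsSmallSymbol k d (σ + τ) := by
  intro ε hε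
  obtain ⟨M, hM⟩ := hσ (ε / 2) (half_pos hε)
  obtain ⟨M', hM'⟩ := hτ (ε / 2) (half_pos hε)
  refine ⟨max M M', fun f hf => ?_⟩
  have h1 := hM f (spectralSpace_mono (setOf_lt_abs_subset k (le_max_left M M')) hf)
  have h2 := hM' f (spectralSpace_mono (setOf_lt_abs_subset k (le_max_right M M')) hf)
  rw [diag_add]
  exact (norm_add_le _ _).trans (by linarith)

theorem IsSmallSymbol.smul {k : Fin 2} {d : ℕ} {σ : (Fin 2 → ℤ) → ℂ} (c : ℂ)
    (hσ : IsSmallSymbol k d σ) : IsSmallSymbol k d (c • σ) := by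
  intro ε hε
  obtain ⟨M, hM⟩ := hσ (ε / (‖c‖ + 1)) (by positivity)
  refine ⟨M, fun f hf => ?_⟩
  rw [diag_smul, norm_smul]
  refine (mul_le_mul_of_nonneg_left (hM f hf) (norm_nonneg c)).trans ?_
  rw [← mul_assoc]
  refine mul_le_mul_of_nonneg_right ?_ (norm_nonneg _)
  rw [mul_div_assoc', div_le_iff₀ (by positivity)]
  nlinarith

/-- A lower power is the higher one followed by an iterated integration, which has small norm at
high frequencies. -/
theorem isSmallSymbol_pow (k : Fin 2) {a d : ℕ} (h : a < d) :
    IsSmallSymbol k d fun n => (2 * Real.pi * Complex.I * n k : ℂ) ^ a := by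
  intro ε hε
  obtain ⟨c, rfl⟩ := Nat.exists_eq_add_of_lt h
  obtain ⟨U, hU, hU'⟩ := exists_integration_pow k c
  obtain ⟨M, hM⟩ := hU' ε hε
  refine ⟨M, fun f hf => ?_⟩
  set g := diag (fun n => (2 * Real.pi * Complex.I * n k : ℂ) ^ (a + c + 1)) f with hg
  have h1 : (diag (fun n => (2 * Real.pi * Complex.I * n k : ℂ) ^ a) f : CT) = U (g : CT) := by
    apply eq_of_coeff_eq
    intro n
    rw [hU, hg, coeff_diag, coeff_diag, ← mul_assoc]
    by_cases hn : n k = 0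
    · have : coeff n (f : CT) = 0 := mem_spectralSpace.1 hf n (by simp [hn])
      rw [this, mul_zero, mul_zero]
    · congr 1
      have : (2 * Real.pi * Complex.I * n k : ℂ) ≠ 0 := by simp [Real.pi_ne_zero, hn]
      rw [add_assoc, pow_add _ a, mul_comm (_ ^ a), inv_mul_cancel_left₀ (pow_ne_zero _ this)]
  have h2 := hM (g : CT) fun n hn =>
    mem_spectralSpace.1 (diag_mem_spectralSpace hf) n (by simpa using hn)
  rw [← h1] at h2
  exact h2

theorem isSmallSymbol_eval (k : Fin 2) {d : ℕ} {A : Polynomial ℂ} (h : A.degree < d) :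
    IsSmallSymbol k d fun n => A.eval (2 * Real.pi * Complex.I * n k : ℂ) := by
  rcases Nat.eq_zero_or_pos d with rfl | hd
  · have : A = 0 := Polynomial.degree_eq_bot.1 (by simpa using h)
    subst this
    simp only [Polynomial.eval_zero]
    exact isSmallSymbol_zero k 0
  have hA : A.natDegree < d := by
    by_cases h0 : A = 0
    · simpa [h0] using hd
    · exact (Polynomial.natDegree_lt_iff_degree_lt h0).2 h
  have : (fun n : Fin 2 → ℤ => A.eval (2 * Real.pi * Complex.I * n k : ℂ))
      = ∑ a ∈ Finset.range d, A.coeff a •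
        (fun n : Fin 2 → ℤ => (2 * Real.pi * Complex.I * n k : ℂ) ^ a) := by
    ext n
    rw [Polynomial.eval_eq_sum_range' hA]
    simp
  rw [this]
  exact Finset.sum_induction _ _ (fun _ _ => IsSmallSymbol.add) (isSmallSymbol_zero k d)
    fun a ha => (isSmallSymbol_pow k (Finset.mem_range.1 ha)).smul _

/-- Let `d` be the largest degree of the polynomials `A j`. Far out on the line each symbol is its
coefficient of order `d` times the `d`-th power plus a small perturbation, so this power serves as
the symbol `q`. The remaining frequencies are finite in number. -/
theorem hasEquiv_line [Finite ι] [Nonempty ι] {p : ι → (Fin 2 → ℤ) → ℂ} {i k : Fin 2} (hik : i ≠ k)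
    (m : ℤ) (A : ι → Polynomial ℂ)
    (hp : ∀ j n, n i = m → p j n = (A j).eval (2 * Real.pi * Complex.I * n k : ℂ)) :
    HasEquiv p {n | n i = m} := by
  cases nonempty_fintype ι
  by_cases hA : ∀ j, A j = 0
  · refine ⟨IsBddSet.coord_eq i m, 0, ⟨0, le_rfl, fun f hf => ⟨fun j => ?_, fun B _ => ?_⟩⟩,
      by simpa using IsBddSet.empty⟩
    · rw [diag_congr (τ := 0) hf fun n hn => by rw [hp j n hn, hA]; simp, diag_zero]
      simp
    · rw [diag_zero]; simp
  push Not at hA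
  classical
  obtain ⟨j₁, hj₁⟩ := hA
  obtain ⟨j₀, hj₀, hmax⟩ := Finset.exists_max_image (Finset.univ.filter fun j => A j ≠ 0)
    (fun j => (A j).natDegree) ⟨j₁, by simpa using hj₁⟩
  simp only [Finset.mem_filter, Finset.mem_univ, true_and] at hj₀ hmax
  set d := (A j₀).natDegree with hd
  have hdeg : ∀ j, (A j).natDegree ≤ d := fun j => by
    by_cases h : A j = 0
    · simp [h]
    · exact hmax j h
  have hlc : (A j₀).coeff d ≠ 0 := by
    rw [hd, Polynomial.coeff_natDegree]
    exact Polynomial.leadingCoeff_ne_zero.2 hj₀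
  have hsm : ∀ j, IsSmallSymbol k d fun n =>
      (A j - Polynomial.C ((A j).coeff d) * Polynomial.X ^ d).eval
        (2 * Real.pi * Complex.I * n k : ℂ) := fun j => by
    apply isSmallSymbol_eval
    rw [Polynomial.degree_lt_iff_coeff_zero]
    intro a ha
    rw [Polynomial.coeff_sub, Polynomial.coeff_C_mul, Polynomial.coeff_X_pow]
    rcases ha.eq_or_lt with rfl | ha
    · simp
    · rw [if_neg ha.ne', Polynomial.coeff_eq_zero_of_natDegree_lt ((hdeg j).trans_lt ha)]
      simp
  choose M hM using fun j => hsm j (‖(A j₀).coeff d‖ / 2)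
    (half_pos (norm_pos_iff.2 hlc))
  set K := Finset.univ.sup M with hK
  have hset : {n : Fin 2 → ℤ | n i = m}
      = ({n | n i = m} ∩ {n : Fin 2 → ℤ | |n k| ≤ K}ᶜ)
        ∪ ({n | n i = m} ∩ {n : Fin 2 → ℤ | |n k| ≤ K}) := by
    rw [Set.union_comm, Set.inter_union_compl]
  have hb := (IsBddSet.coord_eq i m).inter (IsBddSet.coord_abs_le k K).compl
  rw [hset]
  refine HasEquiv.union ⟨hb, fun n => (2 * Real.pi * Complex.I * n k : ℂ) ^ d, ?_, ?_⟩
    (HasEquiv.of_finite ?_)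
  · refine equivOn_of_small (fun j => (A j).coeff d) j₀ hlc fun j f hf => ?_
    rw [diag_congr (τ := fun n => (A j - Polynomial.C ((A j).coeff d) * Polynomial.X ^ d).eval
      (2 * Real.pi * Complex.I * n k : ℂ)) hf fun n hn => ?_]
    · refine hM j f (spectralSpace_mono (fun n hn => ?_) hf)
      have h1 : (M j : ℤ) ≤ K := by exact_mod_cast Finset.le_sup (f := M) (Finset.mem_univ j)
      have h2 : ¬ |n k| ≤ (K : ℤ) := hn.2
      exact lt_of_le_of_lt h1 (not_le.1 h2)
    · simp [hp j n hn.1]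
  · convert hb using 1
    rw [Set.inter_eq_left]
    intro n hn
    have h2 : ¬ |n k| ≤ (K : ℤ) := hn.2
    have : n k ≠ 0 := fun h => h2 (by simp [h])
    simp [Real.pi_ne_zero, this]
  · have hfin : (Set.univ.pi fun _ : Fin 2 => Set.Icc (-(max K m.natAbs : ℤ)) (max K m.natAbs)).Finite :=
      Set.Finite.pi fun _ => Set.finite_Icc _ _
    refine hfin.subset fun n hn t _ => ?_
    have hn1 : n i = m := hn.1
    have hn2 : |n k| ≤ (K : ℤ) := hn.2
    have ht : t = i ∨ t = k := by
      have h1 := t.isLt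
      have h2 := i.isLt
      have h3 := k.isLt
      rw [Ne, Fin.ext_iff] at hik
      rw [Fin.ext_iff, Fin.ext_iff]
      omega
    rw [Set.mem_Icc, ← abs_le]
    rcases ht with rfl | rfl
    · rw [hn1, Int.abs_eq_natAbs]; exact le_max_right _ _
    · exact hn2.trans (le_max_left _ _)

end Line

/-! ### The action of differential operators on trigonometric polynomials -/

section Action

theorem coeff_pderiv (j : Fin 2) (f : trigPoly) (n : Fin 2 → ℤ) :
    coeff n (pderiv j f : C(Torus, ℂ))
      = 2 * Real.pi * Complex.I * n j * coeff n (f : C(Torus, ℂ)) := by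
  obtain ⟨f, hf⟩ := f
  induction hf using Submodule.span_induction with
  | mem f hf' =>
    obtain ⟨k, rfl⟩ := hf'
    have h1 : (pderiv j ⟨UnitAddTorus.mFourier k, Submodule.subset_span ⟨k, rfl⟩⟩ : C(Torus, ℂ))
        = ((2 * Real.pi * Complex.I * k j) • expo k : CT) := by
      apply ContinuousMap.ext
      intro x
      refine ((exists_partialDeriv ⟨UnitAddTorus.mFourier k, Submodule.subset_span ⟨k, rfl⟩⟩
        j).choose_spec x).trans ?_
      exact (hasDerivAt_mFourier j k x).deriv
    rw [h1, map_smul]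
    change _ = _ * coeff n (expo k)
    rw [coeff_expo, smul_eq_mul]
    split_ifs with h
    · rw [h]
    · simp
  | zero =>
    change coeff n (pderiv j (0 : trigPoly) : C(Torus, ℂ)) = _ * coeff n (0 : CT)
    rw [map_zero, map_zero, mul_zero]
    exact map_zero (coeff n)
  | add f g hf hg h1 h2 =>
    have h3 : pderiv j ⟨f + g, Submodule.add_mem _ hf hg⟩
      = pderiv j ⟨f, hf⟩ + pderiv j ⟨g, hg⟩ := map_add (pderiv j) ⟨f, hf⟩ ⟨g, hg⟩
    rw [h3]
    refine (map_add (coeff n) _ _).trans ?_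
    rw [h1, h2, ← mul_add]
    congr 1
    exact (map_add (coeff n) _ _).symm
  | smul c f hf h1 =>
    have h3 : pderiv j ⟨c • f, Submodule.smul_mem _ c hf⟩
      = c • pderiv j ⟨f, hf⟩ := map_smul (pderiv j) c ⟨f, hf⟩
    rw [h3]
    refine (map_smul (coeff n) c _).trans ?_
    rw [h1, smul_eq_mul, mul_left_comm]
    congr 1
    exact (map_smul (coeff n) c _).symm

theorem coeff_pderiv_pow (j : Fin 2) (a : ℕ) (f : trigPoly) (n : Fin 2 → ℤ) :
    coeff n ((pderiv j ^ a) f : C(Torus, ℂ))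
      = (2 * Real.pi * Complex.I * n j) ^ a * coeff n (f : C(Torus, ℂ)) := by
  induction a generalizing f with
  | zero => simp
  | succ a ih =>
    rw [pow_succ, Module.End.mul_apply, ih, coeff_pderiv, pow_succ, mul_assoc (_ ^ a)]

theorem coeff_act (S : DiffOp) (f : trigPoly) (n : Fin 2 → ℤ) :
    coeff n (S.act f : C(Torus, ℂ)) = S.charPoly (n 0) (n 1) * coeff n (f : C(Torus, ℂ)) := by
  have h1 : ∀ s : Finset (Fin 2 →₀ ℕ),
      coeff n ((∑ α ∈ s, S.coeff α • (pderiv 0 ^ α 0 * pderiv 1 ^ α 1)) f : C(Torus, ℂ))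
        = (∑ α ∈ s, S.coeff α * charMon α (n 0) (n 1)) * coeff n (f : C(Torus, ℂ)) := by
    classical
    intro s
    induction s using Finset.induction_on with
    | empty =>
      rw [Finset.sum_empty, Finset.sum_empty, zero_mul]
      exact map_zero (coeff n)
    | insert α s hα ih =>
      rw [Finset.sum_insert hα, Finset.sum_insert hα, LinearMap.add_apply, add_mul, ← ih]
      refine (map_add (coeff n) _ _).trans ?_
      congr 1
      refine (map_smul (coeff n) (S.coeff α) _).trans ?_
      rw [smul_eq_mul, mul_assoc]
      congr 1
      rw [Module.End.mul_apply, coeff_pderiv_pow, coeff_pderiv_pow, ← mul_assoc]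
      simp [charMon]
  rw [charPoly_eq_sum]
  exact h1 S.support

/-- The symbol of a differential operator. -/
def symbol (S : DiffOp) (n : Fin 2 → ℤ) : ℂ := S.charPoly (n 0) (n 1)

theorem act_eq_diag (S : DiffOp) (f : trigPoly) : S.act f = diag (symbol S) (f : trig) :=
  trig_ext fun n => (coeff_act S f n).trans (coeff_diag (symbol S) f n).symm

end Action

/-! ### The space of smooth functions as a spectral subspace -/

section Reduction

variable {l : ℕ} {T : Fin l → DiffOp}

theorem symbol_add (S S' : DiffOp) : symbol (S + S') = symbol S + symbol S' :=
  funext fun _ => charPoly_add _ _ _ _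

theorem symbol_smul (c : ℂ) (S : DiffOp) : symbol (c • S) = c • symbol S :=
  funext fun _ => charPoly_smul _ _ _ _

theorem norm_act_le_of_mem_span {S : DiffOp} (hS : S ∈ Submodule.span ℂ (Set.range T)) :
    ∃ C : ℝ, 0 ≤ C ∧ ∀ (f : trig) (B : ℝ), 0 ≤ B → (∀ j, ‖diag (symbol (T j)) f‖ ≤ B) →
      ‖diag (symbol S) f‖ ≤ C * B := by
  induction hS using Submodule.span_induction with
  | mem S hS =>
    obtain ⟨j, rfl⟩ := hS
    exact ⟨1, zero_le_one, fun f B _ hB => (hB j).trans_eq (one_mul B).symm⟩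
  | zero =>
    refine ⟨0, le_rfl, fun f B _ _ => ?_⟩
    have : symbol 0 = 0 := funext fun n => by simp [symbol, DiffOp.charPoly]
    rw [this, diag_zero]
    simp
  | add S S' _ _ h h' =>
    obtain ⟨C, hC, h⟩ := h
    obtain ⟨C', hC', h'⟩ := h'
    refine ⟨C + C', add_nonneg hC hC', fun f B h0 hB => ?_⟩
    rw [symbol_add, diag_add, add_mul]
    exact (norm_add_le _ _).trans (add_le_add (h f B h0 hB) (h' f B h0 hB))
  | smul c S _ h =>
    obtain ⟨C, hC, h⟩ := h
    refine ⟨‖c‖ * C, mul_nonneg (norm_nonneg c) hC, fun f B h0 hB => ?_⟩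
    rw [symbol_smul, diag_smul, norm_smul, mul_assoc]
    exact mul_le_mul_of_nonneg_left (h f B h0 hB) (norm_nonneg c)

theorem exists_polynomial_of_line (S : DiffOp) (i k : Fin 2) (hik : i ≠ k) (m : ℤ) :
    ∃ A : Polynomial ℂ, ∀ n : Fin 2 → ℤ, n i = m →
      symbol S n = A.eval (2 * Real.pi * Complex.I * n k : ℂ) := by
  refine ⟨MvPolynomial.aeval (fun t : Fin 2 => if t = i then
    Polynomial.C (2 * Real.pi * Complex.I * m : ℂ) else Polynomial.X) S, fun n hn => ?_⟩
  rw [symbol, DiffOp.charPoly, ← Polynomial.coe_evalRingHom, MvPolynomial.aeval_def,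
    MvPolynomial.hom_eval₂, MvPolynomial.eval, MvPolynomial.coe_eval₂Hom]
  congr 1
  · ext; simp
  · funext t
    have h0 : (![2 * Real.pi * Complex.I * (n 0 : ℝ), 2 * Real.pi * Complex.I * (n 1 : ℝ)] :
        Fin 2 → ℂ) t = 2 * Real.pi * Complex.I * n t := by
      fin_cases t <;> simp
    rw [h0]
    by_cases ht : t = i
    · rw [if_pos ht, ht, hn]; simp
    · have : t = k := by
        have h1 := t.isLt
        have h2 := i.isLt
        have h3 := k.isLt
        rw [Ne, Fin.ext_iff] at hik
        rw [Fin.ext_iff] at ht ⊢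
        omega
      rw [if_neg ht, this]; simp

/-- By `exists_core_ge` the region below the core contains all multiindices of `T`, so what remains
of an operator after removing its principal part is automatically subordinate. -/
theorem isSubordinate_of_support (hline : ∃ a b, IsAdmissible T a b) {r : DiffOp}
    (h : ∀ α ∈ r.support, toPoint α ∈ points T ∧ toPoint α ∉ core T) : IsSubordinate T r := by
  intro α hα
  obtain ⟨q, hq, hle⟩ := exists_core_ge hline (h α hα).1
  exact ⟨(h α hα).2, q, hq, hle.1, hle.2⟩

theorem norm_diag_le_of_isSmall {R r : DiffOp} (h : IsSmall R r) {ε : ℝ} (hε : 0 < ε) :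
    ∃ M : ℕ, ∀ f : trig, (f : CT) ∈ spectralSpace ({n | |n 0| ≤ M} ∪ {n | |n 1| ≤ M})ᶜ →
      ‖diag (symbol r) f‖ ≤ ε * ‖diag (symbol R) f‖ := by
  obtain ⟨M, hM⟩ := h ε hε
  refine ⟨M, fun f hf => ?_⟩
  obtain ⟨g, hg, hg'⟩ := hM f (diag (symbol R) f : CT)
    (fun n hn => mem_spectralSpace.1 hf n fun h => h hn) (fun n => coeff_diag _ _ _)
  have : g = (diag (symbol r) f : CT) :=
    eq_of_coeff_eq fun n => (hg n).trans (coeff_diag (symbol r) f n).symm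
  rw [this] at hg'
  exact hg'

/-- On `H`, away from both axes, the symbol is that of the principal part `R`. The complement
consists of two bands, each a finite union of lines covered by `hasEquiv_line`. The symbol is glued
from these pieces and does not vanish on `H`. -/
theorem exists_equivOn {T' : Fin l → DiffOp} {j₀ : Fin l} (hline : ∃ a b, IsAdmissible T a b)
    (hspan : Submodule.span ℂ (Set.range T') = Submodule.span ℂ (Set.range T))
    (hnorm : ∀ j, j ≠ j₀ → principalPart T (T' j) = 0)
    (hell : ∀ a b : ℝ, IsAdmissible T a b → ∀ x y : ℝ, x ≠ 0 → y ≠ 0 →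
      (seniorPart a b (principalPart T (T' j₀))).charPoly x y ≠ 0) :
    ∃ q : (Fin 2 → ℤ) → ℂ, EquivOn (fun j => symbol (T' j)) Set.univ q ∧
      IsBddSet {n | q n ≠ 0} ∧
      ∃ M : ℕ, ({n : Fin 2 → ℤ | |n 0| ≤ M} ∪ {n | |n 1| ≤ M})ᶜ ⊆ {n : Fin 2 → ℤ | q n ≠ 0} := by
  classical
  set R := principalPart T (T' j₀) with hR
  have hsupp := mem_support_principalPart_iff hspan hnorm
  rw [← hR] at hsupp
  have hsmall : ∀ j, IsSmall R ((T' j).part fun α => ¬ toPoint α ∈ core T) := fun j =>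
    isSmall_of_subordinate hline hsupp hell (isSubordinate_of_support hline fun α hα => by
      rw [mem_support_part] at hα
      exact ⟨support_subset_points hspan hα.1, hα.2⟩)
  choose M hM using fun j => norm_diag_le_of_isSmall (hsmall j) (half_pos one_pos)
  obtain ⟨M₀, hM₀⟩ := exists_charPoly_ne_zero hline hsupp hell
  set K := max M₀ (Finset.univ.sup M) with hK
  set H : Set (Fin 2 → ℤ) := ({n | |n 0| ≤ K} ∪ {n | |n 1| ≤ K})ᶜ with hH
  have hHb : IsBddSet H := ((IsBddSet.coord_abs_le 0 K).union (IsBddSet.coord_abs_le 1 K)).compl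
  have hRH : ∀ n ∈ H, symbol R n ≠ 0 := fun n hn => by
    simp only [hH, Set.mem_compl_iff, Set.mem_union, Set.mem_ofPred_eq, not_or, not_le] at hn
    have h1 : (M₀ : ℤ) ≤ K := by exact_mod_cast le_max_left _ _
    refine hM₀ n (fun h => ?_) (fun h => ?_) (Or.inl (h1.trans_lt hn.1))
    · rw [h] at hn; exact absurd hn.1 (by simp)
    · rw [h] at hn; exact absurd hn.2 (by simp)
  have hEH : EquivOn (fun j => symbol (T' j)) H (symbol R) := by
    -- The coefficients record normalization: the principal part is `R` for `j₀` and zero for the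
    -- other indices, so every difference is subordinate.
    refine equivOn_of_small (fun j => if j = j₀ then 1 else 0) j₀ (by simp) fun j f hf => ?_
    have hsym : symbol (T' j) - (if j = j₀ then (1 : ℂ) else 0) • symbol R
        = symbol ((T' j).part fun α => ¬ toPoint α ∈ core T) := by
      have h1 := symbol_add ((T' j).part fun α => toPoint α ∈ core T)
        ((T' j).part fun α => ¬ toPoint α ∈ core T)
      rw [part_add_part_not] at h1
      rw [h1]
      have h2 : symbol ((T' j).part fun α => toPoint α ∈ core T)
          = (if j = j₀ then (1 : ℂ) else 0) • symbol R := by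
        split_ifs with hj
        · rw [one_smul, hR, hj, principalPart]
        · have := hnorm j hj
          rw [principalPart] at this
          rw [this, zero_smul]
          exact funext fun n => by simp [symbol, DiffOp.charPoly]
      rw [h2, add_sub_cancel_left]
    rw [hsym]
    simp only [if_true, norm_one]
    refine hM j f (spectralSpace_mono ?_ hf)
    have h1 : (M j : ℤ) ≤ K := by
      exact_mod_cast (Finset.le_sup (f := M) (Finset.mem_univ j)).trans (le_max_right _ _)
    exact Set.compl_subset_compl.2 (Set.union_subset_union
      (fun n hn => le_trans hn h1) (fun n hn => le_trans hn h1))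
  have hne : Nonempty (Fin l) := ⟨j₀⟩
  have hlines : ∀ i k : Fin 2, i ≠ k → ∀ m : ℤ,
      HasEquiv (fun j => symbol (T' j)) {n | n i = m} := fun i k hik m => by
    choose A hA using fun j => exists_polynomial_of_line (T' j) i k hik m
    exact hasEquiv_line hik m A hA
  have hfin : {m : ℤ | |m| ≤ K}.Finite :=
    (Set.finite_Icc (-(K : ℤ)) K).subset fun m hm => by simpa [abs_le] using hm
  have hbands : ∀ i k : Fin 2, i ≠ k →
      HasEquiv (fun j => symbol (T' j)) {n | |n i| ≤ K} := fun i k hik => by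
    have : {n : Fin 2 → ℤ | |n i| ≤ K} = ⋃ m ∈ {m : ℤ | |m| ≤ K}, {n | n i = m} := by
      ext n; simp
    rw [this]
    exact HasEquiv.biUnion hfin fun m _ => hlines i k hik m
  obtain ⟨hb, q, hq, hqb⟩ := (hbands 0 1 zero_ne_one).union (hbands 1 0 one_ne_zero)
  refine ⟨_, (hEH.glue hq hHb).mono ?_, ?_, K, ?_⟩
  · rw [hH, Set.compl_union_self]
  · convert hHb.union (hqb.diff hHb) using 1
    ext n
    by_cases hn : n ∈ H
    · simp [hn, hRH n hn]
    · have : n ∈ {n : Fin 2 → ℤ | |n 0| ≤ K} ∪ {n | |n 1| ≤ K} := by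
        rw [hH, Set.mem_compl_iff, not_not] at hn
        exact hn
      simp only [Set.mem_ofPred_eq, Set.mem_union, hn, false_or, Set.mem_sdiff, if_false,
        Set.mem_inter_iff, not_false_eq_true, and_true]
      exact ⟨fun h => ⟨this, h⟩, fun h => h.2⟩
  · intro n hn
    simp only [Set.mem_ofPred_eq]
    rw [if_pos hn]
    exact hRH n hn

/-- The bounded projection maps trigonometric polynomials to a dense subset of the spectral space,
and each projected polynomial is in the range of `diag q` because `q` is invertible on its support.
-/
theorem dense_diag {q : (Fin 2 → ℤ) → ℂ} (hb : IsBddSet {n | q n ≠ 0}) :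
    ∃ J : trig →ₗ[ℂ] spectralSpace {n | q n ≠ 0}, (∀ f, (J f : CT) = diag q f) ∧
      DenseRange J := by
  have hmem : ∀ f : trig, (diag q f : CT) ∈ spectralSpace {n | q n ≠ 0} := fun f => by
    rw [mem_spectralSpace]
    intro n hn
    rw [coeff_diag, not_not.1 hn, zero_mul]
  refine ⟨LinearMap.codRestrict _ (trig.subtype ∘ₗ diag q) hmem, fun f => rfl, ?_⟩
  set P : CT →L[ℂ] spectralSpace {n | q n ≠ 0} := hb.proj.codRestrict _ hb.proj_mem
  have hP : Function.Surjective P := fun g => ⟨g, Subtype.ext (hb.proj_eq_self g.2)⟩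
  have h1 : Dense (P '' (trig : Set CT)) := hP.denseRange.dense_image P.continuous dense_trig
  refine h1.mono ?_
  rintro _ ⟨f, hf, rfl⟩
  refine ⟨diag (fun n => (q n)⁻¹) ⟨f, hf⟩, Subtype.ext ?_⟩
  change (diag q (diag (fun n => (q n)⁻¹) ⟨f, hf⟩) : CT) = hb.proj f
  apply eq_of_coeff_eq
  intro n
  rw [coeff_diag, coeff_diag, hb.coeff_proj]
  split_ifs with h
  · exact mul_inv_cancel_left₀ h _
  · rw [not_not.1 h, zero_mul]

theorem norm_smooth_le_iff (f : trigPoly) {B : ℝ} (hB : 0 ≤ B) :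
    ‖(show SeminormedTrigPoly T from f)‖ ≤ B ↔ ∀ j, ‖diag (symbol (T j)) (f : trig)‖ ≤ B := by
  have h1 : ‖(show SeminormedTrigPoly T from f)‖ = ‖actAll T f‖ := rfl
  rw [h1, pi_norm_le_iff_of_nonneg hB]
  refine forall_congr' fun j => ?_
  rw [← act_eq_diag]
  rfl

/-- The canonical map from the trigonometric polynomials to `C^T(𝕋²)`. -/
def toSmooth (T : Fin l → DiffOp) : SeminormedTrigPoly T →ₗ[ℂ] SmoothSpace T :=
  (UniformSpace.Completion.toComplL (𝕜 := ℂ)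
    (E := SeparationQuotient (SeminormedTrigPoly T))).toLinearMap ∘ₗ
    (SeparationQuotient.mkCLM ℂ (SeminormedTrigPoly T)).toLinearMap

theorem denseRange_toSmooth (T : Fin l → DiffOp) : DenseRange (toSmooth T) :=
  UniformSpace.Completion.denseRange_coe.comp SeparationQuotient.surjective_mk.denseRange
    (UniformSpace.Completion.continuous_coe _)

theorem norm_toSmooth (f : SeminormedTrigPoly T) : ‖toSmooth T f‖ = ‖f‖ :=
  (UniformSpace.Completion.norm_coe _).trans (SeparationQuotient.norm_mk f)

theorem exists_norm_equiv {T' : Fin l → DiffOp}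
    (hspan : Submodule.span ℂ (Set.range T') = Submodule.span ℂ (Set.range T))
    {q : (Fin 2 → ℤ) → ℂ} (hq : EquivOn (fun j => symbol (T' j)) Set.univ q) :
    ∃ C C' : ℝ, 0 ≤ C' ∧ ∀ f : trig, (∀ B, 0 ≤ B → (∀ j, ‖diag (symbol (T j)) f‖ ≤ B) →
      ‖diag q f‖ ≤ C * B) ∧ ∀ j, ‖diag (symbol (T j)) f‖ ≤ C' * ‖diag q f‖ := by
  obtain ⟨C, hC, hq⟩ := hq
  choose A hA0 hA using fun j => norm_act_le_of_mem_span (T := T) (S := T' j)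
    (hspan ▸ Submodule.subset_span ⟨j, rfl⟩)
  choose A' hA0' hA' using fun j => norm_act_le_of_mem_span (T := T') (S := T j)
    (hspan ▸ Submodule.subset_span ⟨j, rfl⟩)
  have huniv : ∀ f : trig, (f : CT) ∈ spectralSpace Set.univ := fun f => by
    rw [mem_spectralSpace]
    exact fun n hn => absurd (Set.mem_univ n) hn
  refine ⟨C * ∑ j, A j, (∑ j, A' j) * C,
    mul_nonneg (Finset.sum_nonneg fun j _ => hA0' j) hC, fun f => ⟨fun B hB h => ?_, fun j => ?_⟩⟩
  · rw [mul_assoc]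
    exact (hq f (huniv f)).2 _ fun j => (hA j f B hB h).trans
      (mul_le_mul_of_nonneg_right (Finset.single_le_sum (fun i _ => hA0 i) (Finset.mem_univ j)) hB)
  · have h0 : 0 ≤ C * ‖diag q f‖ := mul_nonneg hC (norm_nonneg _)
    rw [mul_assoc]
    exact (hA' j f _ h0 (hq f (huniv f)).1).trans
      (mul_le_mul_of_nonneg_right (Finset.single_le_sum (fun i _ => hA0' i) (Finset.mem_univ j)) h0)

/-- Both spaces are complete and contain dense images of the trigonometric polynomials with
equivalent seminorms, so the correspondence extends to an isomorphism. -/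
theorem nonempty_smoothSpace_equiv_of_norm {Y : Type} [NormedAddCommGroup Y] [NormedSpace ℂ Y]
    [CompleteSpace Y] (J : SeminormedTrigPoly T →ₗ[ℂ] Y) (hJ : DenseRange J) (C C' : ℝ)
    (h : ∀ f, ‖J f‖ ≤ C * ‖f‖) (h' : ∀ f, ‖f‖ ≤ C' * ‖J f‖) :
    Nonempty (SmoothSpace T ≃L[ℂ] Y) := by
  simp only [← norm_toSmooth] at h h'
  exact ⟨(LinearEquiv.refl ℂ (SeminormedTrigPoly T)).extend (toSmooth T) J (denseRange_toSmooth T)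
    ⟨C, h⟩ hJ ⟨C', h'⟩⟩

theorem nonempty_smoothSpace_equiv {T' : Fin l → DiffOp}
    (hspan : Submodule.span ℂ (Set.range T') = Submodule.span ℂ (Set.range T))
    {q : (Fin 2 → ℤ) → ℂ} (hq : EquivOn (fun j => symbol (T' j)) Set.univ q)
    (hb : IsBddSet {n | q n ≠ 0}) :
    Nonempty (SmoothSpace T ≃L[ℂ] spectralSpace {n | q n ≠ 0}) := by
  obtain ⟨J, hJ, hJd⟩ := dense_diag hb
  obtain ⟨C, C', hC', h⟩ := exists_norm_equiv hspan hq
  have hJn : ∀ f : trig, ‖J f‖ = ‖diag q f‖ := fun f => by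
    rw [Submodule.coe_norm, hJ, Submodule.coe_norm]
  refine nonempty_smoothSpace_equiv_of_norm J hJd C C' (fun f => ?_) (fun f => ?_)
  · exact (hJn f).trans_le
      ((h f).1 _ (norm_nonneg f) ((norm_smooth_le_iff (T := T) f (norm_nonneg f)).1 le_rfl))
  · refine (norm_smooth_le_iff (T := T) f (mul_nonneg hC' (norm_nonneg _))).2 fun j => ?_
    exact ((h f).2 j).trans_eq (congrArg (C' * ·) (hJn f).symm)

end Reduction

/-! ### Absorption of a complemented subspace -/

section Shift

variable {X D : Type*} [NormedAddCommGroup X] [NormedSpace ℂ X]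
  [NormedAddCommGroup D] [NormedSpace ℂ D]
  {u : ℕ → X →L[ℂ] D} {v : ℕ → D →L[ℂ] X}

/-- By `hv` the blocks behave like `c₀`: a sum is controlled by its largest entry, so null sequences
can be summed. -/
theorem summable_blocks [CompleteSpace X]
    (hv : ∀ (s : Finset ℕ) (c : ℕ → D) (B : ℝ), 0 ≤ B → (∀ j ∈ s, ‖c j‖ ≤ B) →
      ‖∑ j ∈ s, v j (c j)‖ ≤ B) {c : ℕ → D} (hc : Tendsto c atTop (𝓝 0)) :
    Summable fun j => v j (c j) := by
  rw [summable_iff_vanishing_norm]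
  intro ε hε
  obtain ⟨k, hk⟩ := (Metric.tendsto_atTop.1 hc) (ε / 2) (half_pos hε)
  refine ⟨Finset.range k, fun t ht => ?_⟩
  refine (hv t c (ε / 2) (half_pos hε).le fun j hj => ?_).trans_lt (half_lt_self hε)
  have h1 : j ∉ Finset.range k := Finset.disjoint_left.1 ht hj
  have h2 := hk j (not_lt.1 fun h => h1 (Finset.mem_range.2 h))
  rw [dist_zero_right] at h2
  exact h2.le

theorem apply_tsum_blocks (huv : ∀ i j d, u i (v j d) = if i = j then d else 0) {c : ℕ → D}
    (hs : Summable fun j => v j (c j)) (i : ℕ) : u i (∑' j, v j (c j)) = c i := by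
  rw [(u i).map_tsum hs]
  simp only [huv]
  rw [tsum_eq_single i fun j hj => if_neg (Ne.symm hj), if_pos rfl]

/-- Regard `u i f` as coordinates of `f`. The operator `f ↦ f + Sh f` replaces the `i`-th coordinate
by the next one; the lost coordinate `u 0 f` fills the factor `D`. Only the differences of
consecutive coordinates have to tend to zero, because `Sh` adds just these differences. -/
theorem nonempty_equiv_prod [CompleteSpace X] [CompleteSpace D]
    (huv : ∀ i j d, u i (v j d) = if i = j then d else 0)
    (hv : ∀ (s : Finset ℕ) (c : ℕ → D) (B : ℝ), 0 ≤ B → (∀ j ∈ s, ‖c j‖ ≤ B) →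
      ‖∑ j ∈ s, v j (c j)‖ ≤ B)
    {U : ℝ} (hU : ∀ j f, ‖u j f‖ ≤ U * ‖f‖)
    (hlim : ∀ f, Tendsto (fun j => u (j + 1) f - u j f) atTop (𝓝 0)) :
    Nonempty (X ≃L[ℂ] X × D) := by
  have hs : ∀ f, Summable fun j => v j (u (j + 1) f - u j f) := fun f =>
    summable_blocks hv (hlim f)
  let Sh : X →ₗ[ℂ] X :=
    { toFun := fun f => ∑' j, v j (u (j + 1) f - u j f)
      map_add' := fun f g => by
        rw [← (hs f).tsum_add (hs g)]
        refine tsum_congr fun j => ?_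
        rw [map_add (u (j + 1)), map_add (u j), add_sub_add_comm, map_add]
      map_smul' := fun a f => by
        rw [RingHom.id_apply, ← (hs f).tsum_const_smul a]
        refine tsum_congr fun j => ?_
        rw [map_smul, map_smul, ← smul_sub, map_smul] }
  have hSh : ∀ f, Sh f = ∑' j, v j (u (j + 1) f - u j f) := fun f => rfl
  have hbound : ∀ f, ‖Sh f‖ ≤ (2 * U) * ‖f‖ := fun f => by
    refine le_of_tendsto (hs f).hasSum.norm (Eventually.of_forall fun s => ?_)
    refine hv s _ _ ((norm_nonneg (u 1 f - u 0 f)).trans ?_) fun j _ => ?_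
    · have := norm_sub_le (u 1 f) (u 0 f)
      linarith [hU 1 f, hU 0 f]
    · have := norm_sub_le (u (j + 1) f) (u j f)
      linarith [hU (j + 1) f, hU j f]
  have hu : ∀ i f, u i (Sh f) = u (i + 1) f - u i f := fun i f => apply_tsum_blocks huv (hs f) i
  let Ψ : X →L[ℂ] X × D :=
    (ContinuousLinearMap.id ℂ X + Sh.mkContinuous _ hbound).prod (u 0)
  have hΨ : ∀ g, Ψ g = (g + Sh g, u 0 g) := fun g => rfl
  have hbij : Function.Bijective Ψ := by
    constructor
    · rw [injective_iff_map_eq_zero]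
      intro g hg
      rw [hΨ, Prod.mk_eq_zero] at hg
      have h1 : ∀ i, u (i + 1) g = 0 := fun i => by
        have := congrArg (u i) hg.1
        rw [map_add, hu, map_zero] at this
        simpa using this
      have h2 : ∀ i, u i g = 0 := fun i => by
        cases i with
        | zero => exact hg.2
        | succ i => exact h1 i
      have h3 : Sh g = 0 := by
        rw [hSh]
        simp [h2]
      simpa [h3] using hg.1
    · rintro ⟨f, d⟩
      -- The preimage must have the coordinates `d, u 0 f, u 1 f, …`; `c` is the required correction
      -- of the coordinates of `f`.
      set c : ℕ → D := fun j => (if j = 0 then d else u (j - 1) f) - u j f with hc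
      have hc0 : Tendsto c atTop (𝓝 0) := by
        rw [← tendsto_add_atTop_iff_nat 1]
        simpa [hc] using (hlim f).neg
      have hsc := summable_blocks hv hc0
      have huc : ∀ i, u i (f + ∑' j, v j (c j)) = if i = 0 then d else u (i - 1) f := fun i => by
        rw [map_add, apply_tsum_blocks huv hsc, hc]
        exact add_sub_cancel _ _
      refine ⟨f + ∑' j, v j (c j), ?_⟩
      rw [hΨ, huc]
      refine Prod.ext ?_ rfl
      change f + ∑' j, v j (c j) + Sh _ = f
      have : ∀ j, v j (u (j + 1) (f + ∑' j, v j (c j)) - u j (f + ∑' j, v j (c j)))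
          = -v j (c j) := fun j => by
        rw [huc, huc, ← map_neg]
        congr 1
        simp [hc]
      rw [hSh, tsum_congr this, tsum_neg, add_neg_cancel_right]
  exact ⟨ContinuousLinearEquiv.ofBijective Ψ (LinearMap.ker_eq_bot.2 hbij.1)
    (LinearMap.range_eq_top.2 hbij.2)⟩

end Shift

/-! ### Products of functions with spectra in bounded sets -/

section Product

/-- The multiplication of continuous functions. -/
def mulCT (f : CT) : CT →L[ℂ] CT :=
  LinearMap.mkContinuous
    { toFun := fun g => CT.mk (fun x => f x * g x) (f.continuous.mul g.continuous)
      map_add' := fun g h => CT.ext fun x => mul_add _ _ _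
      map_smul' := fun c g => CT.ext fun x => mul_left_comm _ _ _ } ‖f‖
    (fun g => (CT.norm_le (by positivity)).2 fun x => (norm_mul_le _ _).trans
      (mul_le_mul (f.norm_apply_le x) (g.norm_apply_le x) (norm_nonneg _) (norm_nonneg _)))

theorem mulCT_apply (f g : CT) (x : Torus) : mulCT f g x = f x * g x := rfl

theorem mulCT_comm (f g : CT) : mulCT f g = mulCT g f := CT.ext fun _ => mul_comm _ _

theorem mulCT_expo (k n : Fin 2 → ℤ) : mulCT (expo k) (expo n) = expo (k + n) :=
  CT.ext fun x => (UnitAddTorus.mFourier_add (m := k) (n := n) (x := x)).symm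

/-- For exponentials the frequencies add. Inserting the projections to `A` and `B` allows the
vanishing of a coefficient to be extended by density, one factor at a time. -/
theorem mulCT_mem {A B S : Set (Fin 2 → ℤ)} (hA : IsBddSet A) (hB : IsBddSet B)
    (hS : ∀ a ∈ A, ∀ b ∈ B, a + b ∈ S) {f g : CT} (hf : f ∈ spectralSpace A)
    (hg : g ∈ spectralSpace B) : mulCT f g ∈ spectralSpace S := by
  classical
  rw [mem_spectralSpace]
  intro n hn
  have key : ∀ k m : Fin 2 → ℤ, coeff n (mulCT (hA.proj (expo k)) (hB.proj (expo m))) = 0 := by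
    intro k m
    rw [hA.isMult_proj k, hB.isMult_proj m]
    dsimp only
    split_ifs with hk hm
    · rw [one_smul, one_smul, mulCT_expo, coeff_expo, if_neg]
      rintro rfl
      exact hn (hS k hk m hm)
    · rw [zero_smul, map_zero, map_zero]
    · rw [zero_smul, mulCT_comm, map_zero, map_zero]
    · rw [zero_smul, mulCT_comm, map_zero, map_zero]
  have h1 : ∀ k, coeff n (mulCT (hA.proj (expo k)) (hB.proj g)) = 0 := fun k => by
    have : (coeff n).comp ((mulCT (hA.proj (expo k))).comp hB.proj) = 0 :=
      clm_ext_expo fun m => key k m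
    exact congrArg (fun Z => Z g) this
  have h2 : (coeff n).comp ((mulCT (hB.proj g)).comp hA.proj) = 0 :=
    clm_ext_expo fun k => by
      rw [ContinuousLinearMap.comp_apply, ContinuousLinearMap.comp_apply, mulCT_comm]
      exact h1 k
  have h3 : coeff n (mulCT (hB.proj g) (hA.proj f)) = 0 := congrArg (fun Z => Z f) h2
  rwa [hA.proj_eq_self hf, hB.proj_eq_self hg, mulCT_comm] at h3

end Product

/-! ### Bump functions with high frequencies -/

section Bump

/-- The odd function that consists of two triangles, over the points `±2^{-j-1}`. -/
def tent (j : ℕ) (s : ℝ) : ℝ :=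
  max 0 (1 - 3 * 2 ^ (j + 1) * |s - (1 / 2) ^ (j + 1)|)
    - max 0 (1 - 3 * 2 ^ (j + 1) * |s + (1 / 2) ^ (j + 1)|)

theorem continuous_tent (j : ℕ) : Continuous (tent j) := by
  unfold tent; fun_prop

theorem tent_neg (j : ℕ) (s : ℝ) : tent j (-s) = -tent j s := by
  have h1 : |-s - (1 / 2 : ℝ) ^ (j + 1)| = |s + (1 / 2) ^ (j + 1)| := by
    rw [← abs_neg]; congr 1; ring
  have h2 : |-s + (1 / 2 : ℝ) ^ (j + 1)| = |s - (1 / 2) ^ (j + 1)| := by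
    rw [← abs_neg]; congr 1; ring
  rw [tent, h1, h2, tent]
  ring

theorem abs_tent_le (j : ℕ) (s : ℝ) : |tent j s| ≤ 1 := by
  have h : ∀ a : ℝ, 0 ≤ max 0 (1 - 3 * 2 ^ (j + 1) * |a|) ∧
      max 0 (1 - 3 * 2 ^ (j + 1) * |a|) ≤ 1 := fun a => by
    refine ⟨le_max_left _ _, max_le zero_le_one ?_⟩
    have : 0 ≤ 3 * 2 ^ (j + 1) * |a| := by positivity
    linarith
  have h1 := h (s - (1 / 2) ^ (j + 1))
  have h2 := h (s + (1 / 2) ^ (j + 1))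
  rw [tent, abs_le]
  constructor <;> linarith

/-- The support lies over `2/3 ≤ 2^(j+1) |s| ≤ 4/3`; the ratio of the endpoints is `2`, so the open
annuli for different `j` are disjoint. -/
theorem of_tent_ne_zero {j : ℕ} {s : ℝ} (h : tent j s ≠ 0) :
    2 < 3 * 2 ^ (j + 1) * |s| ∧ 3 * 2 ^ (j + 1) * |s| < 4 := by
  set a : ℝ := 2 ^ (j + 1) with ha
  have ha0 : 0 < a := by positivity
  have hb : (1 / 2 : ℝ) ^ (j + 1) = a⁻¹ := by rw [one_div, inv_pow]
  have hab : a * a⁻¹ = 1 := mul_inv_cancel₀ ha0.ne'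
  rw [tent, hb] at h
  have h1 : 3 * a * |s - a⁻¹| < 1 ∨ 3 * a * |s + a⁻¹| < 1 := by
    by_contra! hc
    rw [max_eq_left (by linarith [hc.1]), max_eq_left (by linarith [hc.2])] at h
    exact h (sub_zero _)
  have h2 : 3 * a * |(|s| - a⁻¹)| < 1 := by
    have hi : |a⁻¹| = a⁻¹ := abs_of_pos (inv_pos.2 ha0)
    rcases h1 with h1 | h1
    · refine lt_of_le_of_lt (mul_le_mul_of_nonneg_left ?_ (by positivity)) h1
      have := abs_abs_sub_abs_le_abs_sub s a⁻¹
      rwa [hi] at this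
    · refine lt_of_le_of_lt (mul_le_mul_of_nonneg_left ?_ (by positivity)) h1
      have := abs_abs_sub_abs_le_abs_sub s (-a⁻¹)
      rwa [abs_neg, hi, sub_neg_eq_add] at this
  have h3 : |3 * a * (|s| - a⁻¹)| < 1 := by
    rwa [abs_mul, abs_of_pos (by positivity : 0 < 3 * a)]
  rw [abs_lt] at h3
  constructor <;> nlinarith

theorem eq_of_tent_ne_zero {j k : ℕ} {s : ℝ} (hj : tent j s ≠ 0) (hk : tent k s ≠ 0) : j = k := by
  have aux : ∀ {j k : ℕ}, tent j s ≠ 0 → tent k s ≠ 0 → ¬ j < k := by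
    intro j k hj hk hlt
    have h1 := of_tent_ne_zero hj
    have h2 := of_tent_ne_zero hk
    have h3 : (2 : ℝ) ^ (j + 1) * 2 ≤ 2 ^ (k + 1) := by
      rw [← pow_succ]
      exact pow_le_pow_right₀ one_le_two (by omega)
    have h4 := mul_le_mul_of_nonneg_right h3 (abs_nonneg s)
    linarith
  exact le_antisymm (not_lt.1 (aux hk hj)) (not_lt.1 (aux hj hk))

theorem tent_self (j : ℕ) : tent j ((1 / 2) ^ (j + 1)) = 1 := by
  have h : (1 / 2 : ℝ) ^ (j + 1) = (2 ^ (j + 1))⁻¹ := by rw [one_div, inv_pow]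
  have hp : (0 : ℝ) < 2 ^ (j + 1) := by positivity
  have h0 : (2 : ℝ) ^ (j + 1) * (2 ^ (j + 1))⁻¹ = 1 := mul_inv_cancel₀ hp.ne'
  rw [tent, h, sub_self, abs_zero, abs_of_pos (by positivity), max_eq_right (by norm_num),
    max_eq_left (by nlinarith)]
  norm_num

theorem tent_point (j k : ℕ) : tent j ((1 / 2) ^ (k + 1)) = if k = j then 1 else 0 := by
  split_ifs with h
  · rw [h, tent_self]
  · by_contra h0
    exact h (eq_of_tent_ne_zero (by rw [tent_self]; exact one_ne_zero) h0)

/-- The bump functions on the torus that depend on the `i`-th variable only. -/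
def bump (i : Fin 2) (N : ℕ) (j : ℕ) : CT :=
  CT.mk (fun x => (tent j (fourier (N : ℤ) (x i) : ℂ).im : ℂ)) (by
    refine Complex.continuous_ofReal.comp ((continuous_tent j).comp
      (Complex.continuous_im.comp ?_))
    exact (fourier (N : ℤ)).continuous.comp (continuous_apply i))

theorem bump_apply (i : Fin 2) (N j : ℕ) (x : Torus) :
    bump i N j x = (tent j (fourier (N : ℤ) (x i) : ℂ).im : ℂ) := rfl

/-- The spectrum of the bump functions. -/
def bumpSet (i : Fin 2) (N : ℕ) : Set (Fin 2 → ℤ) := {n | (∀ k, k ≠ i → n k = 0) ∧ (N : ℤ) ≤ |n i|}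

theorem isBddSet_bumpSet (i : Fin 2) (N : ℕ) (hN : 0 < N) : IsBddSet (bumpSet i N) := by
  obtain ⟨k, hk⟩ : ∃ k : Fin 2, k ≠ i := exists_ne i
  convert (IsBddSet.coord_eq k 0).inter (IsBddSet.coord_abs_le i (N - 1)).compl using 1
  ext n
  have h1 : (∀ t, t ≠ i → n t = 0) ↔ n k = 0 := by
    refine ⟨fun h => h k hk, fun h t ht => ?_⟩
    have : t = k := by
      have h1 := t.isLt
      have h2 := i.isLt
      have h3 := k.isLt
      rw [Ne, Fin.ext_iff] at hk ht
      rw [Fin.ext_iff]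
      omega
    rw [this, h]
  have h2 : (N : ℤ) ≤ |n i| ↔ ¬ |n i| ≤ ((N - 1 : ℕ) : ℤ) := by
    rw [Nat.cast_sub hN]
    push_cast
    omega
  simp only [bumpSet, Set.mem_ofPred_eq, Set.mem_inter_iff, Set.mem_compl_iff, h1, h2]

theorem coeff_translate (j : Fin 2) (t : UnitAddCircle) (f : CT) (n : Fin 2 → ℤ) :
    coeff n (translate j t f) = fourier (n j) t * coeff n f := (isMult_translate j t).coeff n f

/-- Invariance under translations in the other variable leaves only frequencies along the `i`-th
axis. The tent is odd, so the bump changes sign under translation by the half period `1 / (2N)`;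
this excludes the zero frequency and leaves nonzero multiples of `N`. -/
theorem bump_mem (i : Fin 2) {N : ℕ} (hN : 0 < N) (j : ℕ) :
    bump i N j ∈ spectralSpace (bumpSet i N) := by
  rw [mem_spectralSpace]
  intro n hn
  by_contra hc
  apply hn
  have hN' : (N : ℂ) ≠ 0 := by exact_mod_cast hN.ne'
  constructor
  · intro k hk
    by_contra hnk
    -- This translation multiplies the coefficient of frequency `n` by `e^(πi) = -1`.
    have h1 : translate k ((1 / (2 * n k) : ℝ) : UnitAddCircle) (bump i N j) = bump i N j := by
      apply CT.ext
      intro x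
      rw [translate_apply, bump_apply, bump_apply, Pi.add_apply, Pi.single_eq_of_ne hk.symm,
        add_zero]
    have h2 := congrArg (coeff n) h1
    rw [coeff_translate, fourier_eq_wave, mul_eq_right₀ hc, wave] at h2
    have h3 : (2 * Real.pi * Complex.I * n k * (1 / (2 * n k) : ℝ) : ℂ) = Real.pi * Complex.I := by
      have : (n k : ℂ) ≠ 0 := by exact_mod_cast hnk
      push_cast
      field_simp
    rw [h3, Complex.exp_pi_mul_I] at h2
    norm_num at h2
  · have h1 : translate i ((1 / (2 * N) : ℝ) : UnitAddCircle) (bump i N j)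
        = (-1 : ℂ) • bump i N j := by
      apply CT.ext
      intro x
      rw [translate_apply, CT.smul_apply, bump_apply, bump_apply, Pi.add_apply, Pi.single_eq_same]
      have h2 : (fourier (N : ℤ) (x i + ((1 / (2 * N) : ℝ) : UnitAddCircle)) : ℂ)
          = -fourier (N : ℤ) (x i) := by
        have h3 : (fourier (N : ℤ) (x i + ((1 / (2 * N) : ℝ) : UnitAddCircle)) : ℂ)
            = fourier (N : ℤ) (x i) * fourier (N : ℤ) ((1 / (2 * N) : ℝ) : UnitAddCircle) := by
          simp [fourier_apply, smul_add, AddCircle.toCircle_add]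
        rw [h3, fourier_eq_wave, wave]
        have h4 : (2 * Real.pi * Complex.I * (N : ℤ) * (1 / (2 * N) : ℝ) : ℂ)
            = Real.pi * Complex.I := by
          push_cast
          field_simp
        rw [h4, Complex.exp_pi_mul_I, mul_neg_one]
      rw [h2, Complex.neg_im, tent_neg]
      push_cast
      ring
    have h2 := congrArg (coeff n) h1
    rw [coeff_translate, fourier_eq_wave, map_smul, smul_eq_mul] at h2
    have h3 := mul_right_cancel₀ hc h2
    have h5 : n i ≠ 0 := by
      intro h0
      rw [h0, wave] at h3
      norm_num at h3
    have h4 : Complex.exp (2 * Real.pi * Complex.I * n i / N) = 1 := by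
      have : (2 * Real.pi * Complex.I * n i / N : ℂ)
          = 2 * Real.pi * Complex.I * n i * (1 / (2 * N) : ℝ)
            + 2 * Real.pi * Complex.I * n i * (1 / (2 * N) : ℝ) := by
        push_cast
        field_simp
        ring
      rw [this, Complex.exp_add]
      rw [wave] at h3
      rw [h3]
      norm_num
    rw [Complex.exp_eq_one_iff] at h4
    obtain ⟨k, hk⟩ := h4
    have h6 : (n i : ℂ) = k * N := by
      have hpi : (2 * Real.pi * Complex.I : ℂ) ≠ 0 := by simp [Real.pi_ne_zero]
      field_simp at hk
      have : (2 * Real.pi * Complex.I : ℂ) * n i = (2 * Real.pi * Complex.I) * (k * N) := by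
        linear_combination (2 * Real.pi * Complex.I) * hk
      exact mul_left_cancel₀ hpi this
    have h7 : n i = k * N := by exact_mod_cast h6
    have hk0 : k ≠ 0 := by
      rintro rfl
      exact h5 (by simpa using h7)
    rw [h7, abs_mul, Nat.abs_cast]
    exact le_mul_of_one_le_left (Int.natCast_nonneg N) (Int.one_le_abs hk0)

end Bump

/-! ### Absorption of lines -/

section Absorption

theorem continuous_slice (i : Fin 2) (t : ℝ) :
    Continuous fun x : Torus => x + Pi.single i ((t : UnitAddCircle) - x i) := by
  have h : Continuous fun x : Torus => x i := continuous_apply i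
  have h' : Continuous fun x : Torus => (t : UnitAddCircle) - x i := continuous_const.sub h
  exact continuous_id.add ((continuous_single i).comp h')

/-- The restriction to the line `x i = t`, extended to the torus with the frequency `m`. -/
def slice (i : Fin 2) (m : ℤ) (t : ℝ) : CT →L[ℂ] CT :=
  (mulCT (CT.mk (fun x => fourier m (x i - (t : UnitAddCircle)))
    ((fourier m).continuous.comp ((continuous_apply i).sub continuous_const)))).comp
    (compMap _ (continuous_slice i t))

theorem slice_apply (i : Fin 2) (m : ℤ) (t : ℝ) (f : CT) (x : Torus) :
    slice i m t f x = fourier m (x i - (t : UnitAddCircle))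
      * f (x + Pi.single i ((t : UnitAddCircle) - x i)) := rfl

theorem norm_slice_le (i : Fin 2) (m : ℤ) (t : ℝ) (f : CT) : ‖slice i m t f‖ ≤ ‖f‖ := by
  refine (CT.norm_le (norm_nonneg _)).2 fun x => ?_
  rw [slice_apply, norm_mul]
  have h1 : ‖(fourier m (x i - (t : UnitAddCircle)) : ℂ)‖ = 1 := by
    rw [fourier_apply]; exact Circle.norm_coe _
  rw [h1, one_mul]
  exact f.norm_apply_le _

theorem continuous_slice_param (i : Fin 2) (m : ℤ) (f : CT) :
    Continuous fun t : ℝ => slice i m t f := by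
  apply continuous_ct_of_uncurry
  simp only [slice_apply]
  have h1 : Continuous fun p : ℝ × Torus => ((p.1 : ℝ) : UnitAddCircle) :=
    (AddCircle.continuous_mk' (1 : ℝ)).comp continuous_fst
  have h2 : Continuous fun p : ℝ × Torus => p.2 i := (continuous_apply i).comp continuous_snd
  exact ((fourier m).continuous.comp (h2.sub h1)).mul
    (f.continuous.comp (continuous_snd.add ((continuous_single i).comp (h1.sub h2))))

theorem apply_add_single {i : Fin 2} {m : ℤ} {L : Set (Fin 2 → ℤ)} (hL : ∀ n ∈ L, n i = m)
    {d : CT} (hd : d ∈ spectralSpace L) (x : Torus) (s : UnitAddCircle) :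
    d (x + Pi.single i s) = fourier m s * d x := by
  have : translate i s d = (fourier m s : ℂ) • d := by
    apply eq_of_coeff_eq
    intro n
    rw [coeff_translate, map_smul, smul_eq_mul]
    by_cases hn : n ∈ L
    · rw [hL n hn]
    · rw [mem_spectralSpace.1 hd n hn, mul_zero, mul_zero]
  exact congrArg (fun g : CT => g x) this

/-- A function with spectrum in `n i = m` is determined by its restriction to `x i = t`, and the
extension with frequency `m` recovers it. The bump contributes only its constant value on that
slice. -/
theorem slice_mulCT {i : Fin 2} {m : ℤ} {L : Set (Fin 2 → ℤ)} (hL : ∀ n ∈ L, n i = m)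
    {d : CT} (hd : d ∈ spectralSpace L) (N j : ℕ) (t : ℝ) :
    slice i m t (mulCT (bump i N j) d)
      = (tent j (fourier (N : ℤ) (t : UnitAddCircle) : ℂ).im : ℂ) • d := by
  apply CT.ext
  intro x
  rw [slice_apply, mulCT_apply, bump_apply, apply_add_single hL hd, CT.smul_apply, Pi.add_apply,
    Pi.single_eq_same, add_sub_cancel, mul_left_comm, ← mul_assoc (fourier m (x i - _))]
  congr 1
  have : (fourier m (x i - (t : UnitAddCircle)) : ℂ) * fourier m ((t : UnitAddCircle) - x i)
      = 1 := by
    rw [fourier_apply, fourier_apply, ← Circle.coe_mul, ← AddCircle.toCircle_add, ← smul_add,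
      sub_add_sub_cancel, sub_self, smul_zero, AddCircle.toCircle_zero, Circle.coe_one]
  rw [this, one_mul]

/-- The points at which the bump functions are normalised. -/
def bumpPoint (N j : ℕ) : ℝ := Real.arcsin ((1 / 2) ^ (j + 1)) / (2 * Real.pi * N)

theorem tendsto_bumpPoint (N : ℕ) : Tendsto (bumpPoint N) atTop (𝓝 0) := by
  have h1 : Tendsto (fun j : ℕ => (1 / 2 : ℝ) ^ (j + 1)) atTop (𝓝 0) :=
    (tendsto_pow_atTop_nhds_zero_of_lt_one (by norm_num) (by norm_num)).comp (tendsto_add_atTop_nat 1)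
  have h2 := ((Real.continuous_arcsin.tendsto 0).comp h1).div_const (2 * Real.pi * N)
  rw [Real.arcsin_zero, zero_div] at h2
  exact h2

theorem fourier_bumpPoint_im {N : ℕ} (hN : 0 < N) (j : ℕ) :
    (fourier (N : ℤ) ((bumpPoint N j : ℝ) : UnitAddCircle) : ℂ).im = (1 / 2) ^ (j + 1) := by
  have hN' : (N : ℂ) ≠ 0 := by exact_mod_cast hN.ne'
  have hpi : (Real.pi : ℂ) ≠ 0 := by exact_mod_cast Real.pi_ne_zero
  have h1 : (2 * Real.pi * Complex.I * (N : ℤ) * (bumpPoint N j : ℝ) : ℂ)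
      = (Real.arcsin ((1 / 2) ^ (j + 1)) : ℝ) * Complex.I := by
    rw [bumpPoint]
    push_cast
    field_simp
  rw [fourier_eq_wave, wave, h1, Complex.exp_ofReal_mul_I_im, Real.sin_arcsin]
  · have : (0 : ℝ) ≤ (1 / 2) ^ (j + 1) := by positivity
    linarith
  · exact pow_le_one₀ (by norm_num) (by norm_num)

/-- The supports are disjoint, so at each point at most one summand is nonzero. -/
theorem norm_sum_bump_le (i : Fin 2) (N : ℕ) (s : Finset ℕ) (c : ℕ → CT) {B : ℝ} (hB : 0 ≤ B)
    (hc : ∀ j ∈ s, ‖c j‖ ≤ B) : ‖∑ j ∈ s, mulCT (bump i N j) (c j)‖ ≤ B := by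
  refine (CT.norm_le hB).2 fun x => ?_
  rw [CT.sum_apply]
  simp only [mulCT_apply, bump_apply]
  set y := (fourier (N : ℤ) (x i) : ℂ).im
  by_cases h : ∃ j ∈ s, tent j y ≠ 0
  · obtain ⟨j, hj, hj0⟩ := h
    rw [Finset.sum_eq_single_of_mem j hj fun k _ hk => ?_]
    · rw [norm_mul, Complex.norm_real, Real.norm_eq_abs]
      have h1 := abs_tent_le j y
      have h2 := ((c j).norm_apply_le x).trans (hc j hj)
      calc |tent j y| * ‖c j x‖ ≤ 1 * B :=
            mul_le_mul h1 h2 (norm_nonneg _) zero_le_one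
        _ = B := one_mul B
    · have : tent k y = 0 := by
        by_contra h0
        exact hk (eq_of_tent_ne_zero h0 hj0)
      rw [this, Complex.ofReal_zero, zero_mul]
  · push Not at h
    rw [Finset.sum_eq_zero fun j hj => by rw [h j hj, Complex.ofReal_zero, zero_mul], norm_zero]
    exact hB

/-- The copies of the line are embedded by multiplication with bumps, and the coordinates are the
projections of slices at the normalisation points, where exactly one bump equals one and the others
vanish. -/
theorem nonempty_spectralSpace_equiv_prod {i : Fin 2} {m : ℤ} {L Ω : Set (Fin 2 → ℤ)}
    (hL : IsBddSet L) (hLm : ∀ n ∈ L, n i = m) (K : ℕ)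
    (hΩ : ∀ b ∈ L, ∀ n : Fin 2 → ℤ, (∀ k, k ≠ i → n k = b k) → K < |n i| → n ∈ Ω) :
    Nonempty (spectralSpace Ω ≃L[ℂ] spectralSpace Ω × spectralSpace L) := by
  -- Adding a bump frequency of modulus at least `N` to `m` gives modulus greater than `K`, which
  -- brings the product into the spectrum `Ω`.
  set N : ℕ := K + m.natAbs + 1 with hN
  have hN0 : 0 < N := Nat.succ_pos _
  have hmem : ∀ j, ∀ d : spectralSpace L, mulCT (bump i N j) (d : CT) ∈ spectralSpace Ω :=
    fun j d => by
      refine mulCT_mem (isBddSet_bumpSet i N hN0) hL (fun a ha b hb => ?_) (bump_mem i hN0 j) d.2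
      refine hΩ b hb _ (fun k hk => by rw [Pi.add_apply, ha.1 k hk, zero_add]) ?_
      have h1 := ha.2
      have h2 := hLm b hb
      rw [Pi.add_apply, h2]
      rw [hN] at h1
      push_cast at h1
      have h3 := abs_sub_abs_le_abs_sub (a i) (-m)
      rw [abs_neg, sub_neg_eq_add] at h3
      linarith
  let u : ℕ → spectralSpace Ω →L[ℂ] spectralSpace L := fun j =>
    (hL.proj.codRestrict _ hL.proj_mem).comp
      ((slice i m (bumpPoint N j)).comp (spectralSpace Ω).subtypeL)
  let v : ℕ → spectralSpace L →L[ℂ] spectralSpace Ω := fun j =>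
    ((mulCT (bump i N j)).comp (spectralSpace L).subtypeL).codRestrict _ (hmem j)
  have hu : ∀ j f, ((u j f : spectralSpace L) : CT) = hL.proj (slice i m (bumpPoint N j) (f : CT)) :=
    fun j f => rfl
  have hv : ∀ j d, ((v j d : spectralSpace Ω) : CT) = mulCT (bump i N j) (d : CT) :=
    fun j d => rfl
  refine nonempty_equiv_prod (u := u) (v := v) (U := ‖hL.proj‖) ?_ ?_ ?_ ?_
  · intro a b d
    apply Subtype.ext
    rw [hu, hv, slice_mulCT hLm d.2, fourier_bumpPoint_im hN0, tent_point, map_smul,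
      hL.proj_eq_self d.2]
    split_ifs <;> simp
  · intro s c B hB hc
    rw [Submodule.coe_norm, Submodule.coe_sum]
    simp only [hv]
    exact norm_sum_bump_le i N s (fun j => (c j : CT)) hB hc
  · intro j f
    rw [Submodule.coe_norm, hu]
    exact (hL.proj.le_opNorm _).trans
      (mul_le_mul_of_nonneg_left (norm_slice_le _ _ _ _) (norm_nonneg _))
  · intro f
    rw [tendsto_subtype_rng]
    -- The points accumulate at zero, so the slices converge to the slice at zero, and consecutive
    -- differences vanish in the limit.
    have h1 : Tendsto (fun j => hL.proj (slice i m (bumpPoint N j) (f : CT))) atTop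
        (𝓝 (hL.proj (slice i m 0 (f : CT)))) :=
      (hL.proj.continuous.tendsto _).comp
        (((continuous_slice_param i m (f : CT)).tendsto 0).comp (tendsto_bumpPoint N))
    have h2 := ((tendsto_add_atTop_iff_nat 1).2 h1).sub h1
    rw [sub_self] at h2
    exact h2

theorem nonempty_spectralSpace_union {L Ω : Set (Fin 2 → ℤ)} (hL : IsBddSet L)
    (hd : Disjoint Ω L) :
    Nonempty ((spectralSpace Ω × spectralSpace L) ≃L[ℂ] spectralSpace (Ω ∪ L)) := by
  have h1 : ∀ f : spectralSpace (Ω ∪ L), hL.compl.proj (f : CT) ∈ spectralSpace Ω := fun f => by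
    rw [mem_spectralSpace]
    intro n hn
    rw [hL.compl.coeff_proj]
    split_ifs with h
    · exact mem_spectralSpace.1 f.2 n fun h' => h'.elim hn h
    · rfl
  let A : (spectralSpace Ω × spectralSpace L) →L[ℂ] spectralSpace (Ω ∪ L) :=
    (((spectralSpace Ω).subtypeL).coprod ((spectralSpace L).subtypeL)).codRestrict _ fun p =>
      Submodule.add_mem _ (spectralSpace_mono Set.subset_union_left p.1.2)
        (spectralSpace_mono Set.subset_union_right p.2.2)
  let B : spectralSpace (Ω ∪ L) →L[ℂ] (spectralSpace Ω × spectralSpace L) :=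
    ((hL.compl.proj.comp (spectralSpace (Ω ∪ L)).subtypeL).codRestrict _ h1).prod
      ((hL.proj.comp (spectralSpace (Ω ∪ L)).subtypeL).codRestrict _ fun f => hL.proj_mem _)
  have hA : ∀ p, ((A p : spectralSpace (Ω ∪ L)) : CT) = (p.1 : CT) + (p.2 : CT) := fun p => rfl
  have hB1 : ∀ f, ((B f).1 : CT) = hL.compl.proj (f : CT) := fun f => rfl
  have hB2 : ∀ f, ((B f).2 : CT) = hL.proj (f : CT) := fun f => rfl
  have hΩ : ∀ n, n ∈ Ω → n ∉ L := fun n hn hn' => Set.disjoint_left.1 hd hn hn'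
  refine ⟨ContinuousLinearEquiv.equivOfInverse A B (fun p => ?_) (fun f => ?_)⟩
  · refine Prod.ext (Subtype.ext (eq_of_coeff_eq fun n => ?_))
      (Subtype.ext (eq_of_coeff_eq fun n => ?_))
    · rw [hB1, hA, hL.compl.coeff_proj, map_add]
      split_ifs with h
      · rw [mem_spectralSpace.1 p.2.2 n h, add_zero]
      · exact (mem_spectralSpace.1 p.1.2 n fun h' => h (hΩ n h')).symm
    · rw [hB2, hA, hL.coeff_proj, map_add]
      split_ifs with h
      · rw [mem_spectralSpace.1 p.1.2 n fun h' => hΩ n h' h, zero_add]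
      · exact (mem_spectralSpace.1 p.2.2 n h).symm
  · refine Subtype.ext (eq_of_coeff_eq fun n => ?_)
    rw [hA, hB1, hB2, map_add, hL.compl.coeff_proj, hL.coeff_proj]
    by_cases h : n ∈ L <;> simp [h]

/-- Only `L \ Ω` has to be added; the space absorbs it as a direct factor, and this factor is then
put back as part of the spectrum. -/
theorem nonempty_spectralSpace_absorb {i : Fin 2} {m : ℤ} {L Ω : Set (Fin 2 → ℤ)}
    (hΩb : IsBddSet Ω) (hL : IsBddSet L) (hLm : ∀ n ∈ L, n i = m) (K : ℕ)
    (hΩ : ∀ b ∈ L, ∀ n : Fin 2 → ℤ, (∀ k, k ≠ i → n k = b k) → K < |n i| → n ∈ Ω) :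
    Nonempty (spectralSpace Ω ≃L[ℂ] spectralSpace (Ω ∪ L)) := by
  obtain ⟨e⟩ := nonempty_spectralSpace_equiv_prod (hL.diff hΩb) (fun n hn => hLm n hn.1) K
    (fun b hb => hΩ b hb.1)
  obtain ⟨e'⟩ := nonempty_spectralSpace_union (hL.diff hΩb) Set.disjoint_sdiff_right
  rw [Set.union_sdiff_self] at e'
  exact ⟨e.trans e'⟩

theorem nonempty_spectralSpace_absorb_biUnion {i : Fin 2} {L : ℤ → Set (Fin 2 → ℤ)}
    {Ω : Set (Fin 2 → ℤ)} (hΩb : IsBddSet Ω) {s : Set ℤ} (hs : s.Finite)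
    (hL : ∀ m, IsBddSet (L m)) (hLm : ∀ m, ∀ n ∈ L m, n i = m) (K : ℕ)
    (hΩ : ∀ m, ∀ b ∈ L m, ∀ n : Fin 2 → ℤ, (∀ k, k ≠ i → n k = b k) → K < |n i| → n ∈ Ω) :
    Nonempty (spectralSpace Ω ≃L[ℂ] spectralSpace (Ω ∪ ⋃ m ∈ s, L m)) := by
  induction s, hs using Set.Finite.induction_on with
  | empty =>
    rw [Set.biUnion_empty, Set.union_empty]
    exact ⟨ContinuousLinearEquiv.refl ℂ _⟩
  | @insert a s _ hs ih =>
    obtain ⟨e⟩ := ih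
    obtain ⟨e'⟩ := nonempty_spectralSpace_absorb (hΩb.union (IsBddSet.biUnion hs fun m _ => hL m))
      (hL a) (hLm a) K fun b hb n hn hK => Or.inl (hΩ a b hb n hn hK)
    rw [Set.biUnion_insert, Set.union_comm (L a), ← Set.union_assoc]
    exact ⟨e.trans e'⟩

/-- The order of absorption matters. The lines `n 0 = m` are first added only where `|n 1| > K`,
since moving along the first coordinate then leads into `Ω`. After that the whole half-planes `|n 1|
> K` are available, and the full lines `n 1 = m` can be absorbed. -/
theorem nonempty_spectralSpace_equiv_top {Ω : Set (Fin 2 → ℤ)} (hΩb : IsBddSet Ω) (K : ℕ)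
    (hΩ : ({n : Fin 2 → ℤ | |n 0| ≤ K} ∪ {n | |n 1| ≤ K})ᶜ ⊆ Ω) :
    Nonempty (spectralSpace Ω ≃L[ℂ] CT) := by
  have hmem : ∀ n : Fin 2 → ℤ, (K : ℤ) < |n 0| → (K : ℤ) < |n 1| → n ∈ Ω := fun n h0 h1 =>
    hΩ fun h => h.elim (not_le.2 h0) (not_le.2 h1)
  have hfin : {m : ℤ | |m| ≤ K}.Finite :=
    (Set.finite_Icc (-(K : ℤ)) K).subset fun m hm => by simpa [abs_le] using hm
  have hb : ∀ m : ℤ, IsBddSet ({n : Fin 2 → ℤ | n 0 = m} ∩ {n : Fin 2 → ℤ | |n 1| ≤ K}ᶜ) :=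
    fun m => (IsBddSet.coord_eq 0 m).inter (IsBddSet.coord_abs_le 1 K).compl
  obtain ⟨e⟩ := nonempty_spectralSpace_absorb_biUnion (i := 0) hΩb hfin hb
    (fun m n hn => hn.1) K fun m b hb n hn hK => by
      refine hmem n hK ?_
      rw [hn 1 one_ne_zero]
      exact not_le.1 hb.2
  set Ω₁ := Ω ∪ ⋃ m ∈ {m : ℤ | |m| ≤ K}, ({n : Fin 2 → ℤ | n 0 = m} ∩ {n | |n 1| ≤ K}ᶜ) with hΩ₁
  have hΩ₁b : IsBddSet Ω₁ := hΩb.union (IsBddSet.biUnion hfin fun m _ => hb m)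
  have hmem₁ : ∀ n : Fin 2 → ℤ, (K : ℤ) < |n 1| → n ∈ Ω₁ := fun n h1 => by
    by_cases h0 : |n 0| ≤ K
    · exact Or.inr (Set.mem_biUnion (x := n 0) h0 ⟨rfl, not_le.2 h1⟩)
    · exact Or.inl (hmem n (not_le.1 h0) h1)
  obtain ⟨e'⟩ := nonempty_spectralSpace_absorb_biUnion (i := 1) (L := fun m => {n | n 1 = m}) hΩ₁b
    hfin (fun m => IsBddSet.coord_eq 1 m) (fun m n hn => hn) K fun m b _ n _ hK => hmem₁ n hK
  have huniv : Ω₁ ∪ ⋃ m ∈ {m : ℤ | |m| ≤ K}, {n : Fin 2 → ℤ | n 1 = m} = Set.univ := by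
    rw [Set.eq_univ_iff_forall]
    intro n
    by_cases h1 : |n 1| ≤ K
    · exact Or.inr (Set.mem_biUnion (x := n 1) h1 rfl)
    · exact Or.inl (hmem₁ n (not_le.1 h1))
  rw [huniv] at e'
  have htop : spectralSpace Set.univ = ⊤ := by
    rw [eq_top_iff]
    intro f _
    rw [mem_spectralSpace]
    exact fun n hn => absurd (Set.mem_univ n) hn
  rw [htop] at e'
  exact ⟨(e.trans e').trans (LinearIsometryEquiv.ofTop CT ⊤ rfl).toContinuousLinearEquiv⟩

end Absorption

end SmoothTorus

end

/-! ### The main theorem -/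

theorem mainTheorem5 {l : ℕ} (T T' : Fin l → SmoothTorus.DiffOp) (j₀ : Fin l)
    -- no admissible line has two linearly independent senior parts
    (hT : ¬ ∃ a b : ℝ, SmoothTorus.IsAdmissible T a b ∧ ∃ i j : Fin l,
      LinearIndependent ℂ
        ![SmoothTorus.seniorPart a b (T i), SmoothTorus.seniorPart a b (T j)])
    -- there is an admissible line
    (hline : ∃ a b : ℝ, SmoothTorus.IsAdmissible T a b)
    -- `T'` is a normalization of `T`: only the operator with index `j₀` has a principal part
    (hspan : Submodule.span ℂ (Set.range T') = Submodule.span ℂ (Set.range T))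
    (hnorm : ∀ j, j ≠ j₀ → SmoothTorus.principalPart T (T' j) = 0)
    -- the ellipticity condition
    (hell : SmoothTorus.IsElliptic T (T' j₀)) :
    Nonempty (SmoothTorus.SmoothSpace T ≃L[ℂ] C(SmoothTorus.Torus, ℂ)) ∧
    -- subordinate operators, spectrum in `{|m| > M, |n| > M}`
    (∀ r : SmoothTorus.DiffOp, SmoothTorus.IsSubordinate T r → ∀ ε : ℝ, 0 < ε → ∃ M : ℕ,
      ∀ f g : C(SmoothTorus.Torus, ℂ), SmoothTorus.IsProper f →
        (∀ n : Fin 2 → ℤ, |n 0| ≤ M ∨ |n 1| ≤ M → UnitAddTorus.mFourierCoeff f n = 0) →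
        (SmoothTorus.principalPart T (T' j₀)).Maps f g →
        ∃ h : C(SmoothTorus.Torus, ℂ), r.Maps f h ∧ ‖h‖ ≤ ε * ‖g‖) ∧
    -- strictly subordinate operators, spectrum outside the square `[-M, M]²`
    (∀ r : SmoothTorus.DiffOp, SmoothTorus.IsStrictlySubordinate T r → ∀ ε : ℝ, 0 < ε → ∃ M : ℕ,
      ∀ f g : C(SmoothTorus.Torus, ℂ), SmoothTorus.IsProper f →
        (∀ n : Fin 2 → ℤ, |n 0| ≤ M ∧ |n 1| ≤ M → UnitAddTorus.mFourierCoeff f n = 0) →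
        (SmoothTorus.principalPart T (T' j₀)).Maps f g →
        ∃ h : C(SmoothTorus.Torus, ℂ), r.Maps f h ∧ ‖h‖ ≤ ε * ‖g‖) := by
  have hell' : ∀ a b : ℝ, SmoothTorus.IsAdmissible T a b → ∀ x y : ℝ, x ≠ 0 → y ≠ 0 →
      (SmoothTorus.seniorPart a b (SmoothTorus.principalPart T (T' j₀))).charPoly x y ≠ 0 := by
    intro a b hab x y hx hy
    rw [SmoothTorus.seniorPart_principalPart
      (fun α hα => SmoothTorus.support_subset_points hspan hα) hab]
    exact hell a b hab x y hx hy
  have hsupp := SmoothTorus.mem_support_principalPart_iff hspan hnorm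
  refine ⟨?_, fun r hr ε hε => ?_, fun r hr ε hε => ?_⟩
  · obtain ⟨q, hq, hb, M, hM⟩ := SmoothTorus.exists_equivOn hline hspan hnorm hell'
    obtain ⟨e⟩ := SmoothTorus.nonempty_smoothSpace_equiv hspan hq hb
    obtain ⟨e'⟩ := SmoothTorus.nonempty_spectralSpace_equiv_top hb M hM
    exact ⟨e.trans e'⟩
  · obtain ⟨M, hM⟩ := SmoothTorus.isSmall_of_subordinate hline hsupp hell' hr ε hε
    exact ⟨M, fun f g _ hf hg => hM f g hf hg⟩
  · obtain ⟨M, hM⟩ := SmoothTorus.strictly_subordinate_estimate hline hsupp hell' hr hε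
    exact ⟨M, fun f g hp hf hg => hM f g hp hf hg⟩
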